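/- **Proposition 2.3.** Let $n\ge 1$, let $x_1,\dots,x_n$ be real data points and let $\delta,\mu,\sigma,\tau$ be real parameters. For $\lambda=(\lambda_1,\lambda_2,\lambda_3)$ put $$\Psi_i(\lambda)=\sup_{x\in\mathbb R}\big[\mathbf 1_{\{x\ge\tau\}}-\lambda_1(x-x_i)^2-\lambda_2x-\lambda_3x^2\big]\in(-\infty,\infty],$$ $$F(\lambda)=\lambda_1\delta+\lambda_2\mu+\lambda_3(\sigma^2+\mu^2)+\frac1n\sum_{i=1}^n\Psi_i(\lambda).$$ The UZPM dual problem (D2) is $\inf\{F(\lambda):\lambda_1\ge0,\ \lambda_2,\lambda_3\in\mathbb R\}$. With $\xi=\lambda_1+\lambda_3$, let $f(\xi)=\inf_{\lambda_1\ge0,\ \lambda_2}F(\lambda_1,\lambda_2,\xi-\lambda_1)\in[-\infty,\infty]$. 1. For all real $\lambda_1,\lambda_2,\xi$, with $\lambda_3=\xi-\lambda_1$ and $c_i=2\lambda_1x_i-\lambda_2$, $$\Psi_i=-\lambda_1x_i^2+\begin{cases}\infty,&\xi<0,\ \text{or}\ \xi=0\ \text{and}\ c_i\ne0,\\ 1,&\xi=0\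 \text{and}\ c_i=0,\\ 1+\frac{c_i^2}{4\xi},&\xi>0,\ \tau\le\frac{c_i}{2\xi},\\ 1-\xi\tau^2+c_i\tau,&\xi>0,\ \frac{c_i}{2\xi}<\tau<\frac{c_i}{2\xi}+\frac1{\sqrt\xi},\\ \frac{c_i^2}{4\xi},&\xi>0,\ \tau\ge\frac{c_i}{2\xi}+\frac1{\sqrt\xi}.\end{cases}$$ 2. The function $f$ is convex on $(0,\infty)$ (its epigraph over $(0,\infty)$ is convex), and the optimal value of (D2) equals $\inf_{\xi>0}f(\xi)$. 3. For $\xi>0$, the value $f(\xi)$ can be computed in polynomial time. That is, there are a single program for the real random access machine (unit cost for $+,-,\times,/,\sqrt{\ }$, comparisons, memory accesses and index arithmetic, and no constants but rational ones) and a polynomial $P$ such that on every input $(n,x,\delta,\mu,\sigma,\tau,\xi)$ with $n\ge1$ and $\xi>0$ the program halts after at most $P(n)$ steps, and either reports, correctly, that $f(\xi)=-\infty$, or returns the real number $f(\xi)$. 4. The solution to (D2) can be computed in polynomial time: there are a program for the same machine and a polynomial $P$ such that on every input $(n,x,\delta,\mu,\sigma,\tau)$ with $n\ge1$ the program halts after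 at most $P(n)$ steps, and either reports, correctly, that the optimal value of (D2) is $-\infty$, or returns the optimal value, which is then a real number, together with an optimal solution $(\lambda_1,\lambda_2,\lambda_3)$, $\lambda_1\ge0$, at which $F$ attains it. -/

import Mathlib

open scoped BigOperators

/-! ### The dual problem for the robust upper tail probability -/

namespace UZPM

/-- `Ψ_i(λ₁, λ₂, λ₃) = sup_x [1{x ≥ τ} - λ₁ (x - x_i)² - λ₂ x - λ₃ x²]`, with values in `[-∞, ∞]`. -/
noncomputable def Psi (τ xi l₁ l₂ l₃ : ℝ) : EReal :=
  ⨆ x : ℝ, ((Set.indicator (Set.Ici τ) (fun _ => (1 : ℝ)) x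
    - l₁ * (x - xi) ^ 2 - l₂ * x - l₃ * x ^ 2 : ℝ) : EReal)

/-- The dual objective
`F(λ) = λ₁ δ + λ₂ μ + λ₃ (σ² + μ²) + (1/n) ∑ᵢ Ψ_i(λ)`, with values in `(-∞, ∞]` . -/
noncomputable def F {n : ℕ} (x : Fin n → ℝ) (δ μ σ τ l₁ l₂ l₃ : ℝ) : EReal :=
  ((l₁ * δ + l₂ * μ + l₃ * (σ ^ 2 + μ ^ 2) : ℝ) : EReal)
    + ((1 / (n : ℝ) : ℝ) : EReal) * ∑ i, Psi τ (x i) l₁ l₂ l₃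

/-- The optimal value of the dual problem: the infimum of `F` over `λ₁ ≥ 0` and real `λ₂`, `λ₃`. -/
noncomputable def dualValue {n : ℕ} (x : Fin n → ℝ) (δ μ σ τ : ℝ) : EReal :=
  ⨅ (l₁ : ℝ) (_ : 0 ≤ l₁) (l₂ : ℝ) (l₃ : ℝ), F x δ μ σ τ l₁ l₂ l₃

/-- `f(ξ)`: the infimum of `F` over `λ₁ ≥ 0` and `λ₂`, with `λ₃ = ξ - λ₁`. -/
noncomputable def innerValue {n : ℕ} (x : Fin n → ℝ) (δ μ σ τ ξ : ℝ) : EReal :=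
  ⨅ (l₁ : ℝ) (_ : 0 ≤ l₁) (l₂ : ℝ), F x δ μ σ τ l₁ l₂ (ξ - l₁)

end UZPM

/-! ### The real RAM

A random access machine over the reals with unit cost. A program is a finite text, the same for
all input lengths. It works on index registers (natural numbers), real registers, and a real
array which is addressed through index registers. -/

namespace RealRAM

/-- A configuration of the memory. -/
structure State where
  idx : ℕ → ℕ
  reg : ℕ → ℝ
  mem : ℕ → ℝ

/-- The elementary operations; the first argument is the destination, except in `store`. -/
inductive Instr where
  | setIdx (d c : ℕ)
  | addIdx (d a b : ℕ)
  | subIdx (d a b : ℕ)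
  | const (d : ℕ) (q : ℚ)
  | add (d a b : ℕ)
  | sub (d a b : ℕ)
  | mul (d a b : ℕ)
  | div (d a b : ℕ)
  | sqrt (d a : ℕ)
  | load (d i : ℕ)
  | store (i a : ℕ)

/-- The effect of an elementary operation. (Division by zero and square roots of negative numbers
give `0`; index subtraction is truncated.) -/
noncomputable def Instr.run : Instr → State → State
  | .setIdx d c, s => { s with idx := Function.update s.idx d c }
  | .addIdx d a b, s => { s with idx := Function.update s.idx d (s.idx a + s.idx b) }
  | .subIdx d a b, s => { s with idx := Function.update s.idx d (s.idx a - s.idx b) }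
  | .const d q, s => { s with reg := Function.update s.reg d (q : ℝ) }
  | .add d a b, s => { s with reg := Function.update s.reg d (s.reg a + s.reg b) }
  | .sub d a b, s => { s with reg := Function.update s.reg d (s.reg a - s.reg b) }
  | .mul d a b, s => { s with reg := Function.update s.reg d (s.reg a * s.reg b) }
  | .div d a b, s => { s with reg := Function.update s.reg d (s.reg a / s.reg b) }
  | .sqrt d a, s => { s with reg := Function.update s.reg d (Real.sqrt (s.reg a)) }
  | .load d i, s => { s with reg := Function.update s.reg d (s.mem (s.idx i)) }
  | .store i a, s => { s with mem := Function.update s.mem (s.idx i) (s.reg a) }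

/-- The elementary tests: comparison of two index registers or of two real registers. -/
inductive Test where
  | ltIdx (a b : ℕ)
  | ltReg (a b : ℕ)

/-- The truth value of a test. -/
def Test.Holds : Test → State → Prop
  | .ltIdx a b, s => s.idx a < s.idx b
  | .ltReg a b, s => s.reg a < s.reg b

/-- Programs. -/
inductive Prog where
  | skip
  | instr (c : Instr)
  | seq (p q : Prog)
  | ite (b : Test) (p q : Prog)
  | while (b : Test) (p : Prog)

/-- `Exec p s s' t`: started in `s`, the program `p` halts in `s'` after `t` steps. Every elementary
operation, every `skip` and every evaluation of a test is one step. -/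
inductive Exec : Prog → State → State → ℕ → Prop where
  | skip (s : State) : Exec .skip s s 1
  | instr (c : Instr) (s : State) : Exec (.instr c) s (c.run s) 1
  | seq {p q : Prog} {s s' s'' : State} {t t' : ℕ} :
      Exec p s s' t → Exec q s' s'' t' → Exec (.seq p q) s s'' (t + t')
  | iteTrue {b : Test} {p q : Prog} {s s' : State} {t : ℕ} :
      b.Holds s → Exec p s s' t → Exec (.ite b p q) s s' (t + 1)
  | iteFalse {b : Test} {p q : Prog} {s s' : State} {t : ℕ} :
      ¬ b.Holds s → Exec q s s' t → Exec (.ite b p q) s s' (t + 1)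
  | whileFalse {b : Test} {p : Prog} {s : State} :
      ¬ b.Holds s → Exec (.while b p) s s 1
  | whileTrue {b : Test} {p : Prog} {s s' s'' : State} {t t' : ℕ} :
      b.Holds s → Exec p s s' t → Exec (.while b p) s' s'' t' →
        Exec (.while b p) s s'' (t + t' + 1)

/-- The input configuration: index register `0` holds `n`, the array holds the `n` data points, the
first real registers hold the scalar parameters, and everything else is `0`. -/
noncomputable def input {n : ℕ} (x : Fin n → ℝ) (params : List ℝ) : State where
  idx := fun k => if k = 0 then n else 0
  reg := fun k => params.getD k 0
  mem := fun k => if h : k < n then x ⟨k, h⟩ else 0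

end RealRAM

/-! Convexity. For fixed `x` the expression under the supremum in `Ψ_i` is affine in `(λ₁, λ₂, ξ)`,
so `Ψ_i` and `F` are jointly convex, and minimizing out `λ₁`, `λ₂` keeps the epigraph convex.
Negative `ξ` gives `∞`, and `ξ = 0` is a limit of `ξ > 0`, because adding `ε` to `λ₃` raises `F` by
at most `ε (σ² + μ²)`.

Reduction. Put `s = √ξ` and `m = c_i / (2s)`. Completing the square gives `Ψ_i = -λ₁ x_i² + m² +
hinge (s τ - m)`. With slope `α = λ₁ / s` and a centered offset `w`, `F` becomes `phi (α, w, s)`: a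
homogeneous quadratic form `quad` plus an average of hinges of linear forms (`realF_eq_phi`). It is
to be minimized for `α ≥ 0`, with `s = √ξ` prescribed for `f(ξ)` and with `s ≥ 0` free for the dual
problem.

Finitely many candidates. `phi` is not convex, but `hinge` has only one kink, at `1`. Along
directions that keep the active kinks fixed, `phi` is bounded above by a quadratic that agrees with
it at the point (`phi_local`), so a minimizer solves a linear stationarity system. Among the
minimizers one of largest slope is taken: a null direction that changes the slope would lead to a
minimizer of larger slope, so the system is nonsingular (`form_self_ne_zero`) and Cramer's rule
recovers the point. The system depends on the active kink and on the set of indices with `0 < h <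
1`. That set is a range in the order of the data, so two indices describe each case, and there are
quadratically many candidates. With `s` free a kink must be active, as otherwise homogeneity makes
the minimizer itself a null direction.

Boundary cases. For the dual problem `phi` is unbounded below when `κ < -2√(q v)`; at equality an
explicit ray is optimal; on the face of slope zero the Cantelli bound is. For fixed `s` it is
unbounded below exactly when `v = 0` and `κ < 0`.

Machine. The search is written in a small language of expressions with sums, and of commands with
loops over the data. Its compiler to the real RAM is proved correct, with a polynomial time bound
read off from the syntax. -/

namespace RealRAM

/-! ### A structured language of real expressions and commands -/

/-- Real expressions over `64` real variables and the input array. Array cells are addressed through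
the bound variables of `sum` and of loops, by de Bruijn index. -/
inductive RExpr where
  | var (r : Fin 64)
  | const (q : ℚ)
  | add (a b : RExpr)
  | sub (a b : RExpr)
  | mul (a b : RExpr)
  | div (a b : RExpr)
  | sqrt (a : RExpr)
  | elem (j : ℕ)
  | sum (e : RExpr)
  | ite (a b c e : RExpr)

namespace RExpr

/-- The value of an expression; `ι` lists the values of the bound variables, innermost first. -/
noncomputable def eval (n : ℕ) (x : ℕ → ℝ) (ρ : Fin 64 → ℝ) : RExpr → List ℕ → ℝ
  | var r, _ => ρ r
  | const q, _ => q
  | add a b, ι => eval n x ρ a ι + eval n x ρ b ι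
  | sub a b, ι => eval n x ρ a ι - eval n x ρ b ι
  | mul a b, ι => eval n x ρ a ι * eval n x ρ b ι
  | div a b, ι => eval n x ρ a ι / eval n x ρ b ι
  | sqrt a, ι => Real.sqrt (eval n x ρ a ι)
  | elem j, ι => if j < ι.length then x (ι.getD j 0) else 0
  | sum e, ι => ∑ i ∈ Finset.range n, eval n x ρ e (i :: ι)
  | ite a b c e, ι =>
      open Classical in if eval n x ρ a ι < eval n x ρ b ι then eval n x ρ c ι else eval n x ρ e ι

/-- Code which writes the value of an expression to the real register `d`. It uses only real
registers from `d` on and index registers from `m + 2` on, where `m` is the number of bound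
variables in scope. -/
def compile : RExpr → ℕ → ℕ → Prog
  -- There is no move instruction, so a copy is an addition to a cleared register; the source
  -- survives because `r < 64 ≤ d` wherever the code is used.
  | var r, d, _ => .seq (.instr (.const d 0)) (.instr (.add d d r))
  | const q, d, _ => .instr (.const d q)
  | add a b, d, m => .seq (compile a d m) (.seq (compile b (d + 1) m) (.instr (.add d d (d + 1))))
  | sub a b, d, m => .seq (compile a d m) (.seq (compile b (d + 1) m) (.instr (.sub d d (d + 1))))
  | mul a b, d, m => .seq (compile a d m) (.seq (compile b (d + 1) m) (.instr (.mul d d (d + 1))))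
  | div a b, d, m => .seq (compile a d m) (.seq (compile b (d + 1) m) (.instr (.div d d (d + 1))))
  | sqrt a, d, m => .seq (compile a d m) (.instr (.sqrt d d))
  | elem j, d, m => if j < m then .instr (.load d (m + 1 - j)) else .instr (.const d 0)
  | sum e, d, m =>
      .seq (.instr (.const d 0)) (.seq (.instr (.setIdx (m + 2) 0))
        (.while (.ltIdx (m + 2) 0)
          (.seq (compile e (d + 1) (m + 1))
            (.seq (.instr (.add d d (d + 1))) (.instr (.addIdx (m + 2) (m + 2) 1))))))
  | ite a b c e, d, m =>
      .seq (compile a d m) (.seq (compile b (d + 1) m)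
        (.ite (.ltReg d (d + 1)) (compile c d m) (compile e d m)))

/-- A bound for the running time of the code of an expression. -/
noncomputable def time : RExpr → Polynomial ℕ
  | var _ => 2
  | const _ => 1
  | add a b => time a + time b + 1
  | sub a b => time a + time b + 1
  | mul a b => time a + time b + 1
  | div a b => time a + time b + 1
  | sqrt a => time a + 1
  | elem _ => 1
  | sum e => Polynomial.X * (time e + 3) + 3
  | ite a b c e => time a + time b + time c + time e + 1

end RExpr

/-- The memory holds the input array, its length, the constant one and the bound variables. -/
structure Rep (n : ℕ) (x : ℕ → ℝ) (ι : List ℕ) (s : State) : Prop where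
  len : s.idx 0 = n
  one : s.idx 1 = 1
  mem : s.mem = x
  bound : ∀ j, j < ι.length → s.idx (ι.length + 1 - j) = ι.getD j 0

theorem Rep.congr {n : ℕ} {x : ℕ → ℝ} {ι : List ℕ} {s s' : State} (h : Rep n x ι s)
    (hm : s'.mem = s.mem) (hi : ∀ k < ι.length + 2, s'.idx k = s.idx k) : Rep n x ι s' where
  len := by rw [hi 0 (by omega), h.len]
  one := by rw [hi 1 (by omega), h.one]
  mem := by rw [hm, h.mem]
  bound j hj := by rw [hi _ (by omega), h.bound j hj]

/-- Bound variables occupy the index registers `2, …, m + 1`, outermost first. A new one enters at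
`m + 2`, and the older ones keep their registers while their de Bruijn indices shift. -/
theorem Rep.cons {n : ℕ} {x : ℕ → ℝ} {ι : List ℕ} {s : State} (h : Rep n x ι s) {i : ℕ}
    (hi : s.idx (ι.length + 2) = i) : Rep n x (i :: ι) s where
  len := h.len
  one := h.one
  mem := h.mem
  bound j hj := by
    cases j with
    | zero => simpa using hi
    | succ j =>
      have := h.bound j (by simpa using hj)
      simp only [List.length_cons, List.getD_cons_succ]
      rw [← this]
      congr 1
      omega

/-- A loop which increases the index register `c` from its current value to the length of the
input. -/
theorem exec_while_ltIdx {n c T : ℕ} {p : Prog} (I : ℕ → State → Prop)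
    (hI : ∀ i s, I i s → s.idx c = i ∧ s.idx 0 = n)
    (hstep : ∀ i s, i < n → I i s → ∃ s' t, Exec p s s' t ∧ t ≤ T ∧ I (i + 1) s') :
    ∀ k i s, i + k = n → I i s →
      ∃ s' t, Exec (.while (.ltIdx c 0) p) s s' t ∧ t ≤ k * (T + 1) + 1 ∧ I n s' := by
  intro k
  induction k with
  | zero =>
    intro i s hik h
    obtain rfl : i = n := by omega
    refine ⟨s, 1, Exec.whileFalse ?_, by omega, h⟩
    have := hI _ _ h
    simp [Test.Holds, this.1, this.2]
  | succ k ih =>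
    intro i s hik h
    obtain ⟨s', t, hx, ht, h'⟩ := hstep i s (by omega) h
    obtain ⟨s'', t', hx', ht', h''⟩ := ih (i + 1) s' (by omega) h'
    refine ⟨s'', t + t' + 1, Exec.whileTrue ?_ hx hx', ?_, h''⟩
    · have := hI _ _ h
      simp only [Test.Holds, this.1, this.2]
      omega
    · rw [Nat.add_mul]
      omega

/-- `p` writes the value `a` to register `d`, in time `T`, and changes only registers from `d` on
and index registers from `m + 2` on. -/
def Writes (p : Prog) (s : State) (d m : ℕ) (a : ℝ) (T : ℕ) : Prop :=
  ∃ s' t, Exec p s s' t ∧ t ≤ T ∧ s'.reg d = a ∧ (∀ r < d, s'.reg r = s.reg r) ∧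
    s'.mem = s.mem ∧ ∀ k < m + 2, s'.idx k = s.idx k

/-- The registers from `d` on act as a stack: the second operand is computed at `d + 1`, which
leaves the first one intact in `d`. -/
theorem Writes.binary {p p' : Prog} {s : State} {d m T T' : ℕ} {a b c : ℝ} {ins : Instr}
    (h : Writes p s d m a T)
    (h' : ∀ s', (∀ r < d, s'.reg r = s.reg r) → s'.mem = s.mem →
      (∀ k < m + 2, s'.idx k = s.idx k) → Writes p' s' (d + 1) m b T')
    (hins : ∀ s' : State, s'.reg d = a → s'.reg (d + 1) = b →
      ins.run s' = { s' with reg := Function.update s'.reg d c }) :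
    Writes (.seq p (.seq p' (.instr ins))) s d m c (T + T' + 1) := by
  obtain ⟨s1, t1, e1, ht1, ha, hr1, hm1, hi1⟩ := h
  obtain ⟨s2, t2, e2, ht2, hb, hr2, hm2, hi2⟩ := h' s1 hr1 hm1 hi1
  have key := hins s2 ((hr2 d (by omega)).trans ha) hb
  refine ⟨_, _, .seq e1 (.seq e2 (.instr _ _)), by omega, ?_⟩
  rw [key]
  refine ⟨by simp, fun r hr => ?_, hm2.trans hm1, fun k hk => (hi2 k hk).trans (hi1 k hk)⟩
  simp only [Function.update_of_ne (by omega : r ≠ d)]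
  rw [hr2 r (by omega), hr1 r hr]

/-- Stack discipline makes the induction work: variables lie below `64 ≤ d`, pending operands below
`d`, and enclosing loop counters below index register `m + 2`, so subexpressions disturb none of
them. -/
theorem RExpr.writes_compile (n : ℕ) (x : ℕ → ℝ) (ρ : Fin 64 → ℝ) (e : RExpr) :
    ∀ (ι : List ℕ) (d : ℕ) (s : State), 64 ≤ d → Rep n x ι s → (∀ r : Fin 64, s.reg r = ρ r) →
      Writes (e.compile d ι.length) s d ι.length (e.eval n x ρ ι) (e.time.eval n) := by
  induction e with
  | var r =>
    intro ι d s hd _ hρ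
    have hrd : (r : ℕ) ≠ d := by have := r.2; omega
    refine ⟨_, _, .seq (.instr _ _) (.instr _ _), by simp [RExpr.time], ?_, ?_, rfl, fun _ _ => rfl⟩
    · simp [Instr.run, hrd, hρ, RExpr.eval]
    · intro r' hr'
      simp [Instr.run, Function.update_of_ne (by omega : r' ≠ d)]
  | const q =>
    intro ι d s hd _ _
    refine ⟨_, _, .instr _ _, by simp [RExpr.time], by simp [Instr.run, RExpr.eval], ?_, rfl,
      fun _ _ => rfl⟩
    intro r' hr'
    simp [Instr.run, Function.update_of_ne (by omega : r' ≠ d)]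
  | add a b iha ihb | sub a b iha ihb | mul a b iha ihb | div a b iha ihb =>
    intro ι d s hd hrep hρ
    simp only [RExpr.time, Polynomial.eval_add, Polynomial.eval_one]
    refine (iha ι d s hd hrep hρ).binary (fun s' hr hm hi => ihb ι (d + 1) s' (by omega)
      (hrep.congr hm hi) fun r => ?_) ?_
    · rw [hr r (by have := r.2; omega), hρ]
    · intro s' h1 h2
      simp [Instr.run, h1, h2, RExpr.eval]
  | sqrt a iha =>
    intro ι d s hd hrep hρ
    obtain ⟨s1, t1, e1, ht1, ha, hr1, hm1, hi1⟩ := iha ι d s hd hrep hρ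
    refine ⟨_, _, .seq e1 (.instr _ _), ?_, ?_, ?_, hm1, hi1⟩
    · simp only [RExpr.time, Polynomial.eval_add, Polynomial.eval_one]
      omega
    · simp [Instr.run, ha, RExpr.eval]
    · intro r hr
      simp only [Instr.run, Function.update_of_ne (by omega : r ≠ d)]
      exact hr1 r hr
  | elem j =>
    intro ι d s hd hrep _
    simp only [RExpr.compile, RExpr.eval]
    split_ifs with hj
    · refine ⟨_, _, .instr _ _, by simp [RExpr.time], ?_, ?_, rfl, fun _ _ => rfl⟩
      · simp only [Instr.run, Function.update_self, hrep.mem, hrep.bound j hj]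
      · intro r' hr'
        simp [Instr.run, Function.update_of_ne (by omega : r' ≠ d)]
    · refine ⟨_, _, .instr _ _, by simp [RExpr.time], by simp [Instr.run], ?_, rfl, fun _ _ => rfl⟩
      intro r' hr'
      simp [Instr.run, Function.update_of_ne (by omega : r' ≠ d)]
  | sum e ih =>
    intro ι d s hd hrep hρ
    set m := ι.length with hm
    let I : ℕ → State → Prop := fun i s' =>
      s'.idx (m + 2) = i ∧ s'.reg d = ∑ i' ∈ Finset.range i, e.eval n x ρ (i' :: ι) ∧
        (∀ r < d, s'.reg r = s.reg r) ∧ s'.mem = s.mem ∧ ∀ k < m + 2, s'.idx k = s.idx k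
    have hloop := exec_while_ltIdx (n := n) (c := m + 2) (T := e.time.eval n + 2)
      (p := .seq (e.compile (d + 1) (m + 1))
            (.seq (.instr (.add d d (d + 1))) (.instr (.addIdx (m + 2) (m + 2) 1)))) I
      (fun i s' h => ⟨h.1, by rw [h.2.2.2.2 0 (by omega), hrep.len]⟩) (by
        rintro i s' hi ⟨h1, h2, h3, h4, h5⟩
        have hrep' : Rep n x ι s' := hrep.congr h4 h5
        have hρ' : ∀ r : Fin 64, s'.reg r = ρ r := fun r => by
          rw [h3 r (by have := r.2; omega), hρ]
        obtain ⟨s1, t1, e1, ht1, ha, hr1, hm1, hi1⟩ :=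
          ih (i :: ι) (d + 1) s' (by omega) (hrep'.cons h1) hρ'
        simp only [List.length_cons] at e1 hi1
        refine ⟨_, _, .seq e1 (.seq (.instr _ _) (.instr _ _)), by omega, ?_, ?_, ?_, ?_, ?_⟩
        · simp [Instr.run, hi1 (m + 2) (by omega), hi1 1 (by omega), hrep'.one, h1]
        · simp [Instr.run, ha, hr1 d (by omega), h2, Finset.sum_range_succ]
        · intro r hr
          simp only [Instr.run, Function.update_of_ne (by omega : r ≠ d)]
          rw [hr1 r (by omega), h3 r hr]
        · simp [Instr.run, hm1, h4]
        · intro k hk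
          simp only [Instr.run, Function.update_of_ne (by omega : k ≠ m + 2)]
          rw [hi1 k (by omega), h5 k hk])
    obtain ⟨s', t, hx, ht, h1, h2, h3, h4, h5⟩ := hloop n 0
      { s with reg := Function.update s.reg d 0, idx := Function.update s.idx (m + 2) 0 }
      (by omega) ⟨by simp, by simp, fun r hr => by simp [Function.update_of_ne (by omega : r ≠ d)],
        rfl, fun k hk => by simp [Function.update_of_ne (by omega : k ≠ m + 2)]⟩
    refine ⟨s', 1 + (1 + t), .seq (.instr _ _) (.seq (.instr _ _) ?_), ?_, h2, h3, h4, h5⟩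
    · simpa [Instr.run] using hx
    · simp only [RExpr.time, Polynomial.eval_add, Polynomial.eval_mul, Polynomial.eval_X,
        Polynomial.eval_ofNat]
      rw [show e.time.eval n + 2 + 1 = e.time.eval n + 3 by ring] at ht
      omega
  | ite a b c e iha ihb ihc ihe =>
    intro ι d s hd hrep hρ
    obtain ⟨s1, t1, e1, ht1, ha, hr1, hm1, hi1⟩ := iha ι d s hd hrep hρ
    have hρ1 : ∀ r : Fin 64, s1.reg r = ρ r := fun r => by
      rw [hr1 r (by have := r.2; omega), hρ]
    obtain ⟨s2, t2, e2, ht2, hb, hr2, hm2, hi2⟩ :=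
      ihb ι (d + 1) s1 (by omega) (hrep.congr hm1 hi1) hρ1
    have hρ2 : ∀ r : Fin 64, s2.reg r = ρ r := fun r => by
      rw [hr2 r (by have := r.2; omega), hρ1]
    have hrep2 := (hrep.congr hm1 hi1).congr hm2 hi2
    have ha2 : s2.reg d = a.eval n x ρ ι := (hr2 d (by omega)).trans ha
    simp only [RExpr.time, Polynomial.eval_add, Polynomial.eval_one, RExpr.eval]
    split_ifs with hlt
    · obtain ⟨s3, t3, e3, ht3, hc, hr3, hm3, hi3⟩ := ihc ι d s2 hd hrep2 hρ2
      refine ⟨s3, _, .seq e1 (.seq e2 (.iteTrue ?_ e3)), by omega, hc, fun r hr => ?_,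
        hm3.trans (hm2.trans hm1), fun k hk => ?_⟩
      · simpa [Test.Holds, ha2, hb] using hlt
      · rw [hr3 r hr, hr2 r (by omega), hr1 r hr]
      · rw [hi3 k hk, hi2 k hk, hi1 k hk]
    · obtain ⟨s3, t3, e3, ht3, hc, hr3, hm3, hi3⟩ := ihe ι d s2 hd hrep2 hρ2
      refine ⟨s3, _, .seq e1 (.seq e2 (.iteFalse ?_ e3)), by omega, hc, fun r hr => ?_,
        hm3.trans (hm2.trans hm1), fun k hk => ?_⟩
      · simpa [Test.Holds, ha2, hb] using hlt
      · rw [hr3 r hr, hr2 r (by omega), hr1 r hr]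
      · rw [hi3 k hk, hi2 k hk, hi1 k hk]

/-- Commands: assignments, composition, conditionals, and loops over the indices of the input
array. -/
inductive Cmd where
  | skip
  | assign (r : Fin 64) (e : RExpr)
  | seq (p q : Cmd)
  | ite (a b : RExpr) (p q : Cmd)
  | loop (p : Cmd)

/-! ### Commands: semantics, code and running time -/

namespace Cmd

/-- The effect of a command on the variables. -/
noncomputable def run (n : ℕ) (x : ℕ → ℝ) : Cmd → List ℕ → (Fin 64 → ℝ) → (Fin 64 → ℝ)
  | skip, _, ρ => ρ
  | assign r e, ι, ρ => Function.update ρ r (e.eval n x ρ ι)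
  | seq p q, ι, ρ => run n x q ι (run n x p ι ρ)
  | ite a b p q, ι, ρ =>
      open Classical in
      if a.eval n x ρ ι < b.eval n x ρ ι then run n x p ι ρ else run n x q ι ρ
  | loop p, ι, ρ => (List.range n).foldl (fun ρ i => run n x p (i :: ι) ρ) ρ

/-- The code of a command in the scope of `m` bound variables. -/
def compile : Cmd → ℕ → Prog
  | skip, _ => .skip
  | assign r e, m =>
      .seq (e.compile 64 m) (.seq (.instr (.const 65 0)) (.instr (.add r 64 65)))
  | seq p q, m => .seq (compile p m) (compile q m)
  | ite a b p q, m =>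
      .seq (a.compile 64 m) (.seq (b.compile 65 m)
        (.ite (.ltReg 64 65) (compile p m) (compile q m)))
  | loop p, m =>
      .seq (.instr (.setIdx (m + 2) 0))
        (.while (.ltIdx (m + 2) 0)
          (.seq (compile p (m + 1)) (.instr (.addIdx (m + 2) (m + 2) 1))))

/-- A bound for the running time of the code of a command. -/
noncomputable def time : Cmd → Polynomial ℕ
  | skip => 1
  | assign _ e => e.time + 2
  | seq p q => time p + time q
  | ite a b p q => a.time + b.time + time p + time q + 1
  | loop p => Polynomial.X * (time p + 2) + 2

theorem exec_compile (n : ℕ) (x : ℕ → ℝ) (c : Cmd) :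
    ∀ (ι : List ℕ) (ρ : Fin 64 → ℝ) (s : State), Rep n x ι s → (∀ r : Fin 64, s.reg r = ρ r) →
      ∃ s' t, Exec (c.compile ι.length) s s' t ∧ t ≤ c.time.eval n ∧
        (∀ r : Fin 64, s'.reg r = c.run n x ι ρ r) ∧ s'.mem = s.mem ∧
        ∀ k < ι.length + 2, s'.idx k = s.idx k := by
  induction c with
  | skip =>
    intro ι ρ s _ hρ
    exact ⟨s, 1, .skip s, by simp [time], hρ, rfl, fun _ _ => rfl⟩
  | assign r e =>
    intro ι ρ s hrep hρ
    obtain ⟨s1, t1, e1, ht1, ha, hr1, hm1, hi1⟩ := e.writes_compile n x ρ ι 64 s le_rfl hrep hρ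
    refine ⟨_, _, .seq e1 (.seq (.instr _ _) (.instr _ _)), ?_, ?_, hm1, hi1⟩
    · simp only [time, Polynomial.eval_add, Polynomial.eval_ofNat]
      omega
    · intro r'
      by_cases hrr : r' = r
      · subst hrr
        simp [Instr.run, run, ha]
      · have h1 : (r' : ℕ) ≠ r := fun h => hrr (Fin.ext h)
        have h2 : (r' : ℕ) ≠ 65 := by have := r'.2; omega
        simp only [Instr.run, run, Function.update_of_ne h1, Function.update_of_ne h2,
          Function.update_of_ne hrr]
        rw [hr1 r' r'.2, hρ]
  | seq p q ihp ihq =>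
    intro ι ρ s hrep hρ
    obtain ⟨s1, t1, e1, ht1, hr1, hm1, hi1⟩ := ihp ι ρ s hrep hρ
    obtain ⟨s2, t2, e2, ht2, hr2, hm2, hi2⟩ := ihq ι _ s1 (hrep.congr hm1 hi1) hr1
    refine ⟨s2, _, .seq e1 e2, ?_, hr2, hm2.trans hm1, fun k hk => (hi2 k hk).trans (hi1 k hk)⟩
    simp only [time, Polynomial.eval_add]
    omega
  | ite a b p q ihp ihq =>
    intro ι ρ s hrep hρ
    obtain ⟨s1, t1, e1, ht1, ha, hr1, hm1, hi1⟩ := a.writes_compile n x ρ ι 64 s le_rfl hrep hρ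
    have hρ1 : ∀ r : Fin 64, s1.reg r = ρ r := fun r => by rw [hr1 r r.2, hρ]
    have hrep1 := hrep.congr hm1 hi1
    obtain ⟨s2, t2, e2, ht2, hb, hr2, hm2, hi2⟩ :=
      b.writes_compile n x ρ ι 65 s1 (by omega) hrep1 hρ1
    have hρ2 : ∀ r : Fin 64, s2.reg r = ρ r := fun r => by
      rw [hr2 r (by have := r.2; omega), hρ1]
    have hrep2 := hrep1.congr hm2 hi2
    have ha2 : s2.reg 64 = a.eval n x ρ ι := (hr2 64 (by omega)).trans ha
    simp only [time, Polynomial.eval_add, Polynomial.eval_one, run]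
    split_ifs with hlt
    · obtain ⟨s3, t3, e3, ht3, hr3, hm3, hi3⟩ := ihp ι ρ s2 hrep2 hρ2
      refine ⟨s3, _, .seq e1 (.seq e2 (.iteTrue ?_ e3)), by omega, hr3,
        hm3.trans (hm2.trans hm1), fun k hk => ?_⟩
      · simpa [Test.Holds, ha2, hb] using hlt
      · rw [hi3 k hk, hi2 k hk, hi1 k hk]
    · obtain ⟨s3, t3, e3, ht3, hr3, hm3, hi3⟩ := ihq ι ρ s2 hrep2 hρ2
      refine ⟨s3, _, .seq e1 (.seq e2 (.iteFalse ?_ e3)), by omega, hr3,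
        hm3.trans (hm2.trans hm1), fun k hk => ?_⟩
      · simpa [Test.Holds, ha2, hb] using hlt
      · rw [hi3 k hk, hi2 k hk, hi1 k hk]
  | loop p ih =>
    intro ι ρ s hrep hρ
    set m := ι.length with hm
    let I : ℕ → State → Prop := fun i s' =>
      s'.idx (m + 2) = i ∧
        (∀ r : Fin 64, s'.reg r =
          (List.range i).foldl (fun ρ i => run n x p (i :: ι) ρ) ρ r) ∧
        s'.mem = s.mem ∧ ∀ k < m + 2, s'.idx k = s.idx k
    have hloop := exec_while_ltIdx (n := n) (c := m + 2) (T := p.time.eval n + 1)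
      (p := .seq (p.compile (m + 1)) (.instr (.addIdx (m + 2) (m + 2) 1))) I
      (fun i s' h => ⟨h.1, by rw [h.2.2.2 0 (by omega), hrep.len]⟩) (by
        rintro i s' hi ⟨h1, h3, h4, h5⟩
        have hrep' : Rep n x ι s' := hrep.congr h4 h5
        obtain ⟨s1, t1, e1, ht1, hr1, hm1, hi1⟩ := ih (i :: ι) _ s' (hrep'.cons h1) h3
        simp only [List.length_cons] at e1 hi1
        refine ⟨_, _, .seq e1 (.instr _ _), by omega, ?_, ?_, ?_, ?_⟩
        · simp [Instr.run, hi1 (m + 2) (by omega), hi1 1 (by omega), hrep'.one, h1]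
        · intro r
          simp only [Instr.run, List.range_succ, List.foldl_append, List.foldl_cons,
            List.foldl_nil, hr1]
        · simp [Instr.run, hm1, h4]
        · intro k hk
          simp only [Instr.run, Function.update_of_ne (by omega : k ≠ m + 2)]
          rw [hi1 k (by omega), h5 k hk])
    obtain ⟨s', t, hx, ht, h1, h3, h4, h5⟩ := hloop n 0
      { s with idx := Function.update s.idx (m + 2) 0 }
      (by omega) ⟨by simp, fun r => by simpa using hρ r,
        rfl, fun k hk => by simp [Function.update_of_ne (by omega : k ≠ m + 2)]⟩
    refine ⟨s', 1 + t, .seq (.instr _ _) ?_, ?_, h3, h4, h5⟩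
    · simpa [Instr.run] using hx
    · simp only [time, Polynomial.eval_add, Polynomial.eval_mul, Polynomial.eval_X,
        Polynomial.eval_ofNat]
      rw [show p.time.eval n + 1 + 1 = p.time.eval n + 2 by ring] at ht
      omega

/-- The complete program: run the command and report failure if `ρ a < ρ b` holds at the end. -/
def program (c : Cmd) (a b : Fin 64) : Prog :=
  .seq (.instr (.setIdx 1 1)) (.seq (c.compile 0)
    (.ite (.ltReg a b) (.instr (.setIdx 0 0)) (.instr (.setIdx 0 1))))

/-- The array in the input configuration. -/
noncomputable def array {n : ℕ} (x : Fin n → ℝ) (k : ℕ) : ℝ := if h : k < n then x ⟨k, h⟩ else 0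

/-- The three additional steps initialize the constant one, make the final test and write the
verdict. -/
theorem exec_program (c : Cmd) (a b : Fin 64) {n : ℕ} (x : Fin n → ℝ) (params : List ℝ)
    {ρ : Fin 64 → ℝ} (hρ : ρ = c.run n (array x) [] fun r => params.getD r 0) :
    ∃ (s : State) (t : ℕ), Exec (c.program a b) (input x params) s t ∧
      t ≤ (c.time + 3).eval n ∧ (∀ r : Fin 64, s.reg r = ρ r) ∧
      s.idx 0 = open Classical in if ρ a < ρ b then 0 else 1 := by
  subst hρ
  obtain ⟨s1, t1, e1, ht1, hr1, -, -⟩ := c.exec_compile n (array x) []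
    (fun r => params.getD r 0) ((Instr.setIdx 1 1).run (input x params))
    ⟨by simp [Instr.run, input], by simp [Instr.run, input], rfl, by simp⟩ (fun _ => rfl)
  by_cases h : s1.reg a < s1.reg b
  · refine ⟨_, _, .seq (.instr _ _) (.seq e1 (.iteTrue h (.instr _ _))), ?_, hr1, ?_⟩
    · simp only [Polynomial.eval_add, Polynomial.eval_ofNat]
      omega
    · rw [hr1, hr1] at h
      simp only [Instr.run, Function.update_self, h, if_true]
  · refine ⟨_, _, .seq (.instr _ _) (.seq e1 (.iteFalse h (.instr _ _))), ?_, hr1, ?_⟩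
    · simp only [Polynomial.eval_add, Polynomial.eval_ofNat]
      omega
    · rw [hr1, hr1] at h
      simp only [Instr.run, Function.update_self, h, if_false]

end Cmd

end RealRAM

namespace UZPM

open Filter Topology

/-! ### The reduced objective -/

/-- `max 0 (1 - h₊²)`. -/
noncomputable def hinge (h : ℝ) : ℝ := max 0 (1 - (max 0 h) ^ 2)

theorem hinge_nonneg (h : ℝ) : 0 ≤ hinge h := le_max_left _ _

theorem hinge_le_one (h : ℝ) : hinge h ≤ 1 :=
  max_le zero_le_one (by nlinarith [sq_nonneg (max 0 h)])

theorem hinge_of_nonpos {h : ℝ} (hh : h ≤ 0) : hinge h = 1 := by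
  simp [hinge, max_eq_left hh]

theorem hinge_of_one_le {h : ℝ} (hh : 1 ≤ h) : hinge h = 0 := by
  rw [hinge, max_eq_right (by linarith : (0 : ℝ) ≤ h)]
  exact max_eq_left (by nlinarith)

theorem hinge_of_mem {h : ℝ} (h0 : 0 ≤ h) (h1 : h ≤ 1) : hinge h = 1 - h ^ 2 := by
  rw [hinge, max_eq_right h0]
  exact max_eq_right (by nlinarith)

theorem continuous_hinge : Continuous hinge := by
  unfold hinge
  fun_prop

/-- The value at `X` of the function maximized in `Ψ` is bounded by the closed form. -/
theorem le_sq_add_hinge (t X m : ℝ) :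
    (if t ≤ X then 1 else 0) + 2 * X * m - X ^ 2 ≤ m ^ 2 + hinge (t - m) := by
  have h0 := hinge_nonneg (t - m)
  split_ifs with h
  · rcases le_or_gt (t - m) 0 with h1 | h1
    · rw [hinge_of_nonpos h1]
      nlinarith [sq_nonneg (m - X)]
    · have : 1 - (t - m) ^ 2 ≤ hinge (t - m) := by
        rw [hinge, max_eq_right h1.le]
        exact le_max_right _ _
      nlinarith
  · nlinarith [sq_nonneg (m - X)]

/-- `hinge` is constant on `h ≤ 0` and on `h ≥ 1` and equals `1 - h²` in between. At `0` the global
maximum `1` already serves as an upper bound. At `1` the kink is convex and has no smooth upper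
bound touching it, so the direction must not leave it. -/
theorem hinge_local {h h' : ℝ} (hk : h = 1 → h' = 0) : ∀ᶠ t in 𝓝 (0 : ℝ),
    hinge (h + t * h') ≤
      hinge h - (if 0 < h ∧ h < 1 then 2 * t * (h * h') + t ^ 2 * (h' * h') else 0) := by
  have hcont : Tendsto (fun t : ℝ => h + t * h') (𝓝 0) (𝓝 h) := by
    have : Continuous fun t : ℝ => h + t * h' := by fun_prop
    simpa using this.tendsto 0
  rcases le_or_gt h 0 with h0 | h0
  · refine Eventually.of_forall fun t => ?_
    rw [if_neg (fun hh => absurd hh.1 (not_lt.2 h0)), hinge_of_nonpos h0]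
    simpa using hinge_le_one _
  rcases lt_trichotomy h 1 with h1 | h1 | h1
  · filter_upwards [hcont.eventually (Ioo_mem_nhds h0 h1)] with t ht
    rw [if_pos ⟨h0, h1⟩, hinge_of_mem h0.le h1.le, hinge_of_mem ht.1.le ht.2.le]
    nlinarith
  · refine Eventually.of_forall fun t => ?_
    rw [hk h1, if_neg (fun hh => absurd hh.2 (not_lt.2 h1.ge))]
    simp
  · filter_upwards [hcont.eventually (Ioi_mem_nhds h1)] with t ht
    rw [if_neg (fun hh => absurd hh.2 (not_lt.2 h1.le)), hinge_of_one_le (le_of_lt ht)]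
    simpa using hinge_nonneg h

/-- The data of the dual problem after centering: deviations `z` from the mean, `q = σ²`, the
coefficient `κ` of the mixed term and `θ = τ - μ`. -/
structure Reduced where
  n : ℕ
  z : ℕ → ℝ
  q : ℝ
  κ : ℝ
  θ : ℝ
  n_pos : 0 < n
  sum_z : ∑ i ∈ Finset.range n, z i = 0
  q_nonneg : 0 ≤ q

/-! ### Averages, the reduced objective and its local quadratic bounds -/

namespace Reduced

variable (D : Reduced)

/-- Averages over the data points. -/
noncomputable def avg (f : ℕ → ℝ) : ℝ := (∑ i ∈ Finset.range D.n, f i) / D.n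

theorem cast_pos : (0 : ℝ) < D.n := Nat.cast_pos.2 D.n_pos

theorem avg_add (f g : ℕ → ℝ) : D.avg (fun i => f i + g i) = D.avg f + D.avg g := by
  simp [avg, Finset.sum_add_distrib, add_div]

theorem avg_sub (f g : ℕ → ℝ) : D.avg (fun i => f i - g i) = D.avg f - D.avg g := by
  simp [avg, Finset.sum_sub_distrib, sub_div]

theorem avg_mul (c : ℝ) (f : ℕ → ℝ) : D.avg (fun i => c * f i) = c * D.avg f := by
  simp [avg, ← Finset.mul_sum, mul_div_assoc]

theorem avg_const (c : ℝ) : D.avg (fun _ => c) = c := by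
  have := D.cast_pos.ne'
  simp [avg]
  field_simp

theorem avg_z : D.avg D.z = 0 := by simp [avg, D.sum_z]

variable {D} in
theorem avg_congr {f g : ℕ → ℝ} (h : ∀ i < D.n, f i = g i) : D.avg f = D.avg g := by
  unfold avg
  rw [Finset.sum_congr rfl fun i hi => h i (Finset.mem_range.1 hi)]

variable {D} in
theorem avg_mono {f g : ℕ → ℝ} (h : ∀ i < D.n, f i ≤ g i) : D.avg f ≤ D.avg g :=
  div_le_div_of_nonneg_right (Finset.sum_le_sum fun i hi => h i (Finset.mem_range.1 hi))
    D.cast_pos.le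

variable {D} in
theorem avg_nonneg {f : ℕ → ℝ} (h : ∀ i < D.n, 0 ≤ f i) : 0 ≤ D.avg f := by
  have := avg_mono (D := D) (f := fun _ => 0) h
  rwa [avg_const] at this

/-- The empirical variance. -/
noncomputable def v : ℝ := D.avg fun i => D.z i ^ 2

theorem v_nonneg : 0 ≤ D.v := avg_nonneg fun i _ => sq_nonneg (D.z i)

theorem z_eq_zero (hv : D.v = 0) {i : ℕ} (hi : i < D.n) : D.z i = 0 := by
  have h := (div_eq_zero_iff.1 hv).resolve_right D.cast_pos.ne'
  rw [Finset.sum_eq_zero_iff_of_nonneg fun i _ => sq_nonneg (D.z i)] at h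
  exact pow_eq_zero_iff (two_ne_zero) |>.1 (h i (Finset.mem_range.2 hi))

theorem avg_sq (a b : ℝ) : D.avg (fun i => (a * D.z i + b) ^ 2) = a ^ 2 * D.v + b ^ 2 := by
  have : (fun i => (a * D.z i + b) ^ 2) =
      fun i => (a ^ 2 * D.z i ^ 2 + (2 * a * b) * D.z i) + b ^ 2 := by
    funext i; ring
  rw [this, avg_add, avg_add, avg_mul, avg_mul, avg_const, avg_z, v]
  ring

/-- The slope variable `p.1`, the offset variable `p.2.1` and the scale variable `p.2.2` determine
the linear forms `m i` and `h i`. -/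
def m (p : ℝ × ℝ × ℝ) (i : ℕ) : ℝ := p.1 * D.z i + p.2.1

/-- The distance of the threshold from the `i`-th vertex, in the scaled coordinate. -/
def h (p : ℝ × ℝ × ℝ) (i : ℕ) : ℝ := D.θ * p.2.2 - p.1 * D.z i - p.2.1

/-- The reduced objective. -/
noncomputable def phi (p : ℝ × ℝ × ℝ) : ℝ :=
  D.q * p.2.2 ^ 2 + D.κ * p.1 * p.2.2 + D.avg fun i => D.m p i ^ 2 + hinge (D.h p i)

/-- The quadratic part of the reduced objective. -/
noncomputable def quad (p : ℝ × ℝ × ℝ) : ℝ :=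
  D.q * p.2.2 ^ 2 + D.κ * p.1 * p.2.2 + D.v * p.1 ^ 2 + p.2.1 ^ 2

theorem phi_eq (p : ℝ × ℝ × ℝ) : D.phi p = D.quad p + D.avg fun i => hinge (D.h p i) := by
  simp only [phi, quad, avg_add, m, avg_sq]
  ring

theorem quad_le_phi (p : ℝ × ℝ × ℝ) : D.quad p ≤ D.phi p := by
  rw [phi_eq]
  have := avg_nonneg (D := D) fun i _ => hinge_nonneg (D.h p i)
  linarith

theorem phi_le_quad (p : ℝ × ℝ × ℝ) : D.phi p ≤ D.quad p + 1 := by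
  rw [phi_eq]
  have := avg_mono (D := D) fun i _ => hinge_le_one (D.h p i)
  rw [avg_const] at this
  linarith

theorem continuous_phi : Continuous D.phi := by
  have := continuous_hinge
  unfold phi avg m h
  fun_prop

theorem phi_zero : D.phi 0 = 1 := by
  simp [phi, m, h, hinge_of_nonpos, avg_const]

/-- The lower bound given by transporting the data points to the positions `X`. -/
theorem transport_le_phi (p : ℝ × ℝ × ℝ) (X : ℕ → ℝ) :
    D.q * p.2.2 ^ 2 + D.κ * p.1 * p.2.2 +
        D.avg (fun i => (if D.θ * p.2.2 ≤ X i then 1 else 0) + 2 * X i * D.m p i - X i ^ 2) ≤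
      D.phi p := by
  unfold phi
  gcongr
  refine avg_mono fun i _ => ?_
  have := le_sq_add_hinge (D.θ * p.2.2) (X i) (D.m p i)
  have e : D.θ * p.2.2 - D.m p i = D.h p i := by simp only [m, h]; ring
  rwa [e] at this

/-- The symmetric bilinear form which belongs to the objective near a point whose active set of
strictly intermediate indices is `M`. -/
noncomputable def form (M : Set ℕ) (p d : ℝ × ℝ × ℝ) : ℝ :=
  open Classical in
  D.q * (p.2.2 * d.2.2) + D.κ / 2 * (p.1 * d.2.2 + d.1 * p.2.2) +
    D.avg fun i => D.m p i * D.m d i - if i ∈ M then D.h p i * D.h d i else 0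

/-- The strictly intermediate indices at `p`. -/
def mid (p : ℝ × ℝ × ℝ) : Set ℕ := {i | 0 < D.h p i ∧ D.h p i < 1}

/-- The quadratic part and the squares `m²` expand exactly; only the hinges are estimated, by
`hinge_local`. An upper bound suffices, since it is used at minimizers. -/
theorem phi_local {p d : ℝ × ℝ × ℝ} (hk : ∀ i < D.n, D.h p i = 1 → D.h d i = 0) :
    ∀ᶠ t in 𝓝 (0 : ℝ), D.phi (p + t • d) ≤
      D.phi p + 2 * t * D.form (D.mid p) p d + t ^ 2 * D.form (D.mid p) d d := by
  classical
  have hall : ∀ᶠ t in 𝓝 (0 : ℝ), ∀ i ∈ Finset.range D.n, hinge (D.h p i + t * D.h d i) ≤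
      hinge (D.h p i) - (if i ∈ D.mid p then
        2 * t * (D.h p i * D.h d i) + t ^ 2 * (D.h d i * D.h d i) else 0) := by
    rw [eventually_all_finset]
    intro i hi
    filter_upwards [hinge_local (hk i (Finset.mem_range.1 hi))] with t ht
    have hiff : i ∈ D.mid p ↔ 0 < D.h p i ∧ D.h p i < 1 := Iff.rfl
    simpa only [hiff] using ht
  filter_upwards [hall] with t ht
  have e1 : ∀ i, D.h (p + t • d) i = D.h p i + t * D.h d i := fun i => by
    simp [h]; ring
  have e2 : ∀ i, D.m (p + t • d) i = D.m p i + t * D.m d i := fun i => by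
    simp [m]; ring
  have hle : D.avg (fun i => D.m (p + t • d) i ^ 2 + hinge (D.h (p + t • d) i)) ≤
      D.avg (fun i => (D.m p i ^ 2 + hinge (D.h p i)) +
        ((2 * t) * (D.m p i * D.m d i - if i ∈ D.mid p then D.h p i * D.h d i else 0) +
        t ^ 2 * (D.m d i * D.m d i - if i ∈ D.mid p then D.h d i * D.h d i else 0))) := by
    refine avg_mono fun i hi => ?_
    have := ht i (Finset.mem_range.2 hi)
    rw [e1, e2]
    split_ifs at this ⊢ <;> nlinarith
  have hsplit := hle.trans_eq (D.avg_add _ _)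
  rw [D.avg_add (fun i => 2 * t * _), avg_mul, avg_mul] at hsplit
  simp only [phi, form] at *
  simp only [Prod.fst_add, Prod.snd_add, Prod.smul_fst, Prod.smul_snd, smul_eq_mul] at *
  nlinarith

/-! ### Extremal points: existence, stationarity and nondegeneracy -/

theorem eq_zero_of_eventually_nonneg {b c : ℝ}
    (h : ∀ᶠ t in 𝓝 (0 : ℝ), 0 ≤ t * b + t ^ 2 * c) : b = 0 := by
  have hd : HasDerivAt (fun t : ℝ => t * b + t ^ 2 * c) b 0 := by
    have := ((hasDerivAt_id' (0 : ℝ)).mul_const b).fun_add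
      ((hasDerivAt_pow 2 (0 : ℝ)).mul_const c)
    simpa using this
  have hm : IsLocalMin (fun t : ℝ => t * b + t ^ 2 * c) 0 := by
    simpa [IsLocalMin, IsMinFilter] using h
  exact hm.hasDerivAt_eq_zero hd

/-- `p` minimizes the reduced objective over `S` and has the largest slope among the minimizers. -/
structure IsExtremal (S : Set (ℝ × ℝ × ℝ)) (p : ℝ × ℝ × ℝ) : Prop where
  mem : p ∈ S
  min : ∀ p' ∈ S, D.phi p ≤ D.phi p'
  max : ∀ p' ∈ S, D.phi p' ≤ D.phi p → p'.1 ≤ p.1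

variable {D} in
-- Both signs of `t` are feasible, and minimality makes the quadratic bound of `phi_local` at least
-- `phi p`, so its linear coefficient vanishes.
theorem IsExtremal.form_eq_zero {S : Set (ℝ × ℝ × ℝ)} {p d : ℝ × ℝ × ℝ} (hp : D.IsExtremal S p)
    (hd : ∀ᶠ t in 𝓝 (0 : ℝ), p + t • d ∈ S) (hk : ∀ i < D.n, D.h p i = 1 → D.h d i = 0) :
    D.form (D.mid p) p d = 0 := by
  have : ∀ᶠ t in 𝓝 (0 : ℝ),
      0 ≤ t * (2 * D.form (D.mid p) p d) + t ^ 2 * D.form (D.mid p) d d := by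
    filter_upwards [hd, D.phi_local hk] with t h1 h2
    have := hp.min _ h1
    linarith
  linarith [eq_zero_of_eventually_nonneg this]

variable {D} in
-- If the second-order term vanished too, all `p + t • d` with small `t` would be minimizers, and
-- one sign of `t` would increase the slope. This is why the extremal point is chosen with the
-- largest slope.
theorem IsExtremal.form_self_ne_zero {S : Set (ℝ × ℝ × ℝ)} {p d : ℝ × ℝ × ℝ}
    (hp : D.IsExtremal S p) (hd : ∀ᶠ t in 𝓝 (0 : ℝ), p + t • d ∈ S)
    (hk : ∀ i < D.n, D.h p i = 1 → D.h d i = 0) (hd1 : d.1 ≠ 0) :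
    D.form (D.mid p) d d ≠ 0 := by
  intro h0
  have : ∀ᶠ t in 𝓝 (0 : ℝ), 0 ≤ t * (-d.1) + t ^ 2 * 0 := by
    filter_upwards [hd, D.phi_local hk] with t h1 h2
    rw [hp.form_eq_zero hd hk, h0] at h2
    have := hp.max _ h1 (by linarith)
    simp at this
    linarith
  have := eq_zero_of_eventually_nonneg this
  exact hd1 (by linarith)

/-- The bound puts the relevant sublevel set into a compact box. `phi` is minimized there first, and
then the slope is maximized over the compact set of minimizers. -/
theorem exists_isExtremal {S : Set (ℝ × ℝ × ℝ)} (hS : IsClosed S) {p₀ : ℝ × ℝ × ℝ} (h₀ : p₀ ∈ S)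
    {R : ℝ} (hR : ∀ p ∈ S, D.phi p ≤ D.phi p₀ → |p.1| ≤ R ∧ |p.2.1| ≤ R ∧ |p.2.2| ≤ R) :
    ∃ p, D.IsExtremal S p := by
  set C : Set (ℝ × ℝ × ℝ) := S ∩ Set.Icc (-R, -R, -R) (R, R, R)
  have hC : IsCompact C := isCompact_Icc.inter_left hS
  have hmem : ∀ p ∈ S, D.phi p ≤ D.phi p₀ → p ∈ C := fun p hp hle => by
    obtain ⟨h1, h2, h3⟩ := hR p hp hle
    rw [abs_le] at h1 h2 h3
    exact ⟨hp, ⟨h1.1, h2.1, h3.1⟩, ⟨h1.2, h2.2, h3.2⟩⟩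
  obtain ⟨p₁, hp₁, hmin⟩ := hC.exists_isMinOn ⟨p₀, hmem p₀ h₀ le_rfl⟩ D.continuous_phi.continuousOn
  have hmin' : ∀ p' ∈ S, D.phi p₁ ≤ D.phi p' := fun p' hp' => by
    rcases le_total (D.phi p') (D.phi p₀) with h | h
    · exact hmin (hmem p' hp' h)
    · exact (hmin (hmem p₀ h₀ le_rfl)).trans h
  have hC' : IsCompact (C ∩ {p | D.phi p ≤ D.phi p₁}) :=
    hC.inter_right (isClosed_le D.continuous_phi continuous_const)
  obtain ⟨p, ⟨hp, hple⟩, hmax⟩ := hC'.exists_isMaxOn ⟨p₁, hp₁, le_refl (D.phi p₁)⟩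
    (f := fun p : ℝ × ℝ × ℝ => p.1) continuous_fst.continuousOn
  refine ⟨p, hp.1, fun p' hp' => (le_trans hple (hmin' p' hp') : _), fun p' hp' hle => ?_⟩
  have hle₁ : D.phi p' ≤ D.phi p₁ := hle.trans hple
  exact hmax ⟨hmem p' hp' (hle₁.trans (hmin' p₀ h₀)), hle₁⟩

end Reduced

end UZPM

namespace UZPM

open Filter Topology

namespace Reduced

variable (D : Reduced)

/-! ### Lower bounds which do not need a search -/

/-- The optimal point on the face where the slope vanishes. -/
noncomputable def cantelli : ℝ × ℝ × ℝ :=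
  (0, -D.q / (D.q + D.θ ^ 2), max 0 (D.θ / (D.q + D.θ ^ 2)))

/-- All data points are transported to `0`; at scale zero the threshold is `0` as well, so every
indicator equals `1`. -/
theorem one_le_phi_of_scale_eq_zero {p : ℝ × ℝ × ℝ} (hs : p.2.2 = 0) : 1 ≤ D.phi p := by
  have := D.transport_le_phi p fun _ => 0
  simpa [hs, avg_const] using this

theorem one_le_phi_of_nonpos {p : ℝ × ℝ × ℝ} (hθ : D.θ ≤ 0) (hs : 0 ≤ p.2.2)
    (hκ : 0 ≤ D.κ * p.1) : 1 ≤ D.phi p := by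
  have := D.transport_le_phi p fun _ => 0
  rw [show (fun i : ℕ => (if D.θ * p.2.2 ≤ 0 then (1 : ℝ) else 0) + 2 * 0 * D.m p i - 0 ^ 2) =
    fun _ => 1 by funext i; simp [mul_nonpos_of_nonpos_of_nonneg hθ hs], avg_const] at this
  have h1 := mul_nonneg D.q_nonneg (sq_nonneg p.2.2)
  have h2 := mul_nonneg hκ hs
  linarith

theorem avg_const' {f : ℕ → ℝ} {c : ℝ} (h : ∀ i < D.n, f i = c) : D.avg f = c := by
  rw [avg_congr h, avg_const]

theorem phi_cantelli (hθ : 0 < D.θ) : D.phi D.cantelli = D.q / (D.q + D.θ ^ 2) := by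
  have hq := D.q_nonneg
  have hpos : 0 < D.q + D.θ ^ 2 := by positivity
  have h1 : ∀ i, D.h D.cantelli i = 1 := fun i => by
    simp only [h, cantelli]
    rw [max_eq_right (by positivity)]
    field_simp
    ring
  rw [phi_eq, D.avg_const' (c := 0) fun i _ => by rw [h1, hinge_of_one_le le_rfl]]
  simp only [quad, cantelli]
  rw [max_eq_right (by positivity)]
  field_simp
  ring

/-- The data points no longer matter, and what remains is the one-sided Chebyshev (Cantelli)
inequality. With `r = q / (q + θ²)` the quadratic cost is at least `r k²`, and `r k² + hinge k ≥ r`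
for every `k`. -/
theorem le_phi_of_constant {p : ℝ × ℝ × ℝ} (hs : 0 ≤ p.2.2) (hκ : 0 ≤ D.κ * p.1)
    (hz : ∀ i < D.n, p.1 * D.z i = 0) {B : ℝ} (h1 : B ≤ 1) (hB : B ≤ D.phi D.cantelli) :
    B ≤ D.phi p := by
  rcases le_or_gt D.θ 0 with hθ | hθ
  · exact h1.trans (D.one_le_phi_of_nonpos hθ hs hκ)
  have hq := D.q_nonneg
  have hpos : 0 < D.q + D.θ ^ 2 := by positivity
  rw [D.phi_cantelli hθ] at hB
  set r := D.q / (D.q + D.θ ^ 2) with hr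
  have hr0 : 0 ≤ r := by positivity
  have hrq : r * (D.q + D.θ ^ 2) = D.q := by rw [hr]; field_simp
  have hr1 : r ≤ 1 := by rw [hr, div_le_one hpos]; nlinarith
  set k := D.θ * p.2.2 - p.2.1 with hk
  have hh : ∀ i < D.n, D.h p i = k := fun i hi => by simp only [h, hz i hi, hk]; ring
  have hm : ∀ i < D.n, D.m p i = p.2.1 := fun i hi => by simp only [m, hz i hi]; ring
  have he : D.phi p = D.q * p.2.2 ^ 2 + D.κ * p.1 * p.2.2 + (p.2.1 ^ 2 + hinge k) := by
    unfold phi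
    rw [D.avg_const' fun i hi => by rw [hh i hi, hm i hi]]
  rw [he]
  have hκs := mul_nonneg hκ hs
  -- Cauchy–Schwarz; after clearing the denominator the defect is a perfect square.
  have hcs : r * k ^ 2 ≤ D.q * p.2.2 ^ 2 + p.2.1 ^ 2 := by
    have : 0 ≤ (D.q + D.θ ^ 2) * (D.q * p.2.2 ^ 2 + p.2.1 ^ 2) - D.q * k ^ 2 := by
      have : (D.q + D.θ ^ 2) * (D.q * p.2.2 ^ 2 + p.2.1 ^ 2) - D.q * k ^ 2 =
          (D.q * p.2.2 + D.θ * p.2.1) ^ 2 := by rw [hk]; ring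
      rw [this]
      positivity
    have h2 : r * k ^ 2 = D.q * k ^ 2 / (D.q + D.θ ^ 2) := by rw [hr]; ring
    rw [h2, div_le_iff₀ hpos]
    linarith
  have hqs : 0 ≤ D.q * p.2.2 ^ 2 := by positivity
  rcases le_or_gt k 0 with h0 | h0
  · rw [hinge_of_nonpos h0]
    nlinarith [sq_nonneg p.2.1]
  rcases le_or_gt k 1 with hk1 | hk1
  · rw [hinge_of_mem h0.le hk1]
    have : k ^ 2 ≤ 1 := by nlinarith
    nlinarith
  · rw [hinge_of_one_le hk1.le]
    have : 1 ≤ k ^ 2 := by nlinarith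
    nlinarith

/-! ### The degenerate direction -/

/-- The direction along which the quadratic part vanishes at the critical transport cost. -/
noncomputable def dir : ℝ × ℝ × ℝ := (√D.q, 0, √D.v)

/-- A multiple of the degenerate direction at which no index is strictly intermediate. -/
noncomputable def ray : ℝ × ℝ × ℝ :=
  (√D.q * ∑ i ∈ Finset.range D.n, (if 0 < D.h D.dir i then 1 / D.h D.dir i else 0), 0,
    √D.v * ∑ i ∈ Finset.range D.n, (if 0 < D.h D.dir i then 1 / D.h D.dir i else 0))

/-- The critical coefficient makes `quad` vanish along `dir`, so `phi D.ray` is just the fraction of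
indices with nonpositive distance. A matching lower bound comes from transport to a rescaled copy of
the data. -/
theorem phi_ray_le (hv : 0 < D.v) (hκ : D.κ = -(2 * √(D.q * D.v))) {p : ℝ × ℝ × ℝ}
    (hs : 0 ≤ p.2.2) : D.phi D.ray ≤ D.phi p := by
  have hq := D.q_nonneg
  have hsv : 0 < √D.v := Real.sqrt_pos.2 hv
  have hsq := Real.sqrt_nonneg D.q
  have ev : √D.v ^ 2 = D.v := Real.sq_sqrt hv.le
  have eq' : √D.q ^ 2 = D.q := Real.sq_sqrt hq
  rw [Real.sqrt_mul hq] at hκ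
  set T := ∑ i ∈ Finset.range D.n, (if 0 < D.h D.dir i then 1 / D.h D.dir i else 0) with hT
  have hterm : ∀ i ∈ Finset.range D.n,
      0 ≤ (if 0 < D.h D.dir i then 1 / D.h D.dir i else 0) := fun i _ => by
    split_ifs <;> positivity
  have hT0 : 0 ≤ T := Finset.sum_nonneg hterm
  have hrayT : D.ray = T • D.dir := by
    ext
    · exact mul_comm _ _
    · simp [ray, dir]
    · exact mul_comm _ _
  have hray : ∀ i, D.h D.ray i = T * D.h D.dir i := fun i => by
    rw [hrayT]
    simp [h]
    ring
  have hquad : D.quad D.ray = 0 := by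
    simp only [hrayT, quad, dir, Prod.smul_fst, Prod.smul_snd, smul_eq_mul, hκ]
    linear_combination (T ^ 2 * √D.v ^ 2) * (-eq') + (√D.q ^ 2 * T ^ 2) * (-ev)
  rw [phi_eq, hquad, zero_add]
  -- These positions have mean `0` and variance `q s²`; at the critical `κ` everything except the
  -- indicators cancels.
  refine le_trans ?_ (D.transport_le_phi p fun i => p.2.2 * (√D.q / √D.v * D.z i))
  have hval : D.q * p.2.2 ^ 2 + D.κ * p.1 * p.2.2 +
      D.avg (fun i => (if D.θ * p.2.2 ≤ p.2.2 * (√D.q / √D.v * D.z i) then 1 else 0) +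
        2 * (p.2.2 * (√D.q / √D.v * D.z i)) * D.m p i -
        (p.2.2 * (√D.q / √D.v * D.z i)) ^ 2) =
      D.avg (fun i => if D.θ * p.2.2 ≤ p.2.2 * (√D.q / √D.v * D.z i) then 1 else 0) := by
    have : (fun i => (if D.θ * p.2.2 ≤ p.2.2 * (√D.q / √D.v * D.z i) then (1 : ℝ) else 0) +
        2 * (p.2.2 * (√D.q / √D.v * D.z i)) * D.m p i -
        (p.2.2 * (√D.q / √D.v * D.z i)) ^ 2) = fun i =>
        ((if D.θ * p.2.2 ≤ p.2.2 * (√D.q / √D.v * D.z i) then (1 : ℝ) else 0) +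
        (2 * p.2.2 * p.1 * (√D.q / √D.v) - p.2.2 ^ 2 * (√D.q / √D.v) ^ 2) * D.z i ^ 2) +
        (2 * p.2.2 * (√D.q / √D.v) * p.2.1) * D.z i := by
      funext i; simp only [m]; ring
    rw [this, avg_add, avg_add, avg_mul, avg_mul, avg_z]
    change _ + (_ + _ * D.v + _) = _
    have e1 : (√D.q / √D.v) * D.v = √D.q * √D.v := by
      calc (√D.q / √D.v) * D.v = (√D.q / √D.v) * √D.v ^ 2 := by rw [ev]
        _ = _ := by field_simp
    have e2 : (√D.q / √D.v) ^ 2 * D.v = D.q := by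
      rw [div_pow, eq', ev]; field_simp
    rw [hκ]
    linear_combination 2 * p.2.2 * p.1 * e1 - p.2.2 ^ 2 * e2
  rw [hval]
  refine avg_mono fun i hi => ?_
  rw [hray]
  split_ifs with hc
  · exact hinge_le_one _
  · have hpos : 0 < D.h D.dir i := by
      by_contra hle
      apply hc
      have h1 : D.θ * √D.v ≤ √D.q * D.z i := by
        simp only [h, dir] at hle; linarith
      have h2 : D.θ ≤ √D.q / √D.v * D.z i := by
        rw [div_mul_eq_mul_div, le_div_iff₀ hsv]; exact h1
      nlinarith
    -- The factor `T` contains `1 / h` for each positive distance `h`, so it scales all of them to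
    -- at least `1`, where the hinge is zero.
    have hle := Finset.single_le_sum hterm (Finset.mem_range.2 hi)
    rw [if_pos hpos, ← hT] at hle
    have : 1 ≤ T * D.h D.dir i := by
      rwa [div_le_iff₀ hpos] at hle
    rw [hinge_of_one_le this]

/-! ### Candidates on the face where the `k`-th kink is active -/

open Classical in
/-- First moment of the deviations from `z k` in the range `(z k, z j]`. -/
noncomputable def kinkMoment₁ (k j : ℕ) : ℝ :=
  D.avg fun i => if D.z k < D.z i then if D.z j < D.z i then 0 else D.z i - D.z k else 0

open Classical in
/-- Second moment of the deviations from `z k` in the range `(z k, z j]`. -/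
noncomputable def kinkMoment₂ (k j : ℕ) : ℝ :=
  D.avg fun i => if D.z k < D.z i then if D.z j < D.z i then 0 else (D.z i - D.z k) ^ 2 else 0

/-- Coefficients of the stationarity system on the `k`-th kink. -/
noncomputable def kinkA (k j : ℕ) : ℝ := D.z k ^ 2 + D.v - D.kinkMoment₂ k j

/-- The mixed coefficient. -/
noncomputable def kinkB (k : ℕ) : ℝ := D.κ / 2 - D.θ * D.z k

/-- The coefficient of the scale. -/
noncomputable def kinkC : ℝ := D.θ ^ 2 + D.q

/-- The right-hand side. -/
noncomputable def kinkR (k j : ℕ) : ℝ := -D.z k - D.kinkMoment₁ k j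

/-- The point on the `k`-th kink with given slope and scale, both truncated at `0`. -/
noncomputable def kinkPoint (k : ℕ) (α s : ℝ) : ℝ × ℝ × ℝ :=
  (max 0 α, D.θ * max 0 s - max 0 α * D.z k - 1, max 0 s)

/-- The stationary point on the `k`-th kink. -/
noncomputable def jointCand (k j : ℕ) : ℝ × ℝ × ℝ :=
  D.kinkPoint k
    ((D.kinkR k j * D.kinkC - D.kinkB k * D.θ) /
      (D.kinkA k j * D.kinkC - D.kinkB k * D.kinkB k))
    ((D.kinkA k j * D.θ - D.kinkB k * D.kinkR k j) /
      (D.kinkA k j * D.kinkC - D.kinkB k * D.kinkB k))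

/-- The stationary point on the `k`-th kink for a prescribed scale. -/
noncomputable def kinkCand (s : ℝ) (k j : ℕ) : ℝ × ℝ × ℝ :=
  D.kinkPoint k ((D.kinkR k j - D.kinkB k * s) / D.kinkA k j) s

open Classical in
/-- The moments of the data points in the range `[z j, z k]`. -/
noncomputable def rangeMoment (r j k : ℕ) : ℝ :=
  D.avg fun i => if D.z i < D.z j then 0 else if D.z k < D.z i then 0 else D.z i ^ r

/-- The determinant of the stationarity system away from the kinks. -/
noncomputable def smoothDet (j k : ℕ) : ℝ :=
  (D.v - D.rangeMoment 2 j k) * (1 - D.rangeMoment 0 j k) -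
    D.rangeMoment 1 j k * D.rangeMoment 1 j k

/-- The stationary point for a prescribed scale, away from the kinks. -/
noncomputable def smoothCand (s : ℝ) (j k : ℕ) : ℝ × ℝ × ℝ :=
  (max 0 (((-D.κ * s / 2 - D.θ * s * D.rangeMoment 1 j k) * (1 - D.rangeMoment 0 j k) -
      D.rangeMoment 1 j k * (D.θ * s * D.rangeMoment 0 j k)) / D.smoothDet j k),
    ((D.v - D.rangeMoment 2 j k) * (-(D.θ * s * D.rangeMoment 0 j k)) +
      D.rangeMoment 1 j k * (-D.κ * s / 2 - D.θ * s * D.rangeMoment 1 j k)) / D.smoothDet j k, s)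

/-- On the `k`-th kink the strictly intermediate indices form a range. -/
theorem exists_mid_eq_range {p : ℝ × ℝ × ℝ} (hα : 0 < p.1) {k : ℕ} (hk : k < D.n)
    (h1 : D.h p k = 1) :
    ∃ j < D.n, ∀ i < D.n, i ∈ D.mid p ↔ D.z k < D.z i ∧ ¬ D.z j < D.z i := by
  classical
  -- On the kink the intermediate indices are those with `z k < z i < z k + 1 / α`. The index `j`
  -- marks the largest such value; taking `j = k` encodes the empty range.
  have hh : ∀ i, D.h p i = 1 - p.1 * (D.z i - D.z k) := fun i => by
    simp only [h] at h1 ⊢; linarith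
  rcases ((Finset.range D.n).filter (· ∈ D.mid p)).eq_empty_or_nonempty with he | hne
  · refine ⟨k, hk, fun i hi => ⟨fun hm => ?_, fun hm => absurd hm.1 hm.2⟩⟩
    exact absurd (Finset.mem_filter.2 ⟨Finset.mem_range.2 hi, hm⟩) (by simp [he])
  · obtain ⟨j, hj, hmax⟩ := Finset.exists_max_image _ D.z hne
    obtain ⟨hjn, hjm⟩ := Finset.mem_filter.1 hj
    refine ⟨j, Finset.mem_range.1 hjn, fun i hi => ⟨fun hm => ⟨?_, ?_⟩, fun hm => ?_⟩⟩
    · have := hm.2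
      rw [hh] at this
      nlinarith
    · exact not_lt.2 (hmax i (Finset.mem_filter.2 ⟨Finset.mem_range.2 hi, hm⟩))
    · have h2 := hjm.1
      rw [hh] at h2
      constructor
      · rw [hh]; nlinarith [hm.2]
      · rw [hh]; nlinarith [hm.1]

/-- The direction along the `k`-th kink which changes the slope. -/
def slopeDir (k : ℕ) : ℝ × ℝ × ℝ := (1, -D.z k, 0)

/-- The direction along the kinks which changes the scale. -/
def scaleDir : ℝ × ℝ × ℝ := (0, D.θ, 1)

theorem h_slopeDir (k i : ℕ) : D.h (D.slopeDir k) i = D.z k - D.z i := by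
  simp [h, slopeDir]; ring

theorem m_slopeDir (k i : ℕ) : D.m (D.slopeDir k) i = D.z i - D.z k := by
  simp [m, slopeDir]; ring

theorem h_scaleDir (i : ℕ) : D.h D.scaleDir i = 0 := by
  simp [h, scaleDir]

theorem m_scaleDir (i : ℕ) : D.m D.scaleDir i = D.θ := by
  simp [m, scaleDir]

theorem avg_linear (a b : ℝ) : D.avg (fun i => a * D.z i + b) = b := by
  rw [avg_add, avg_mul, avg_z, avg_const]; ring

/-! ### The matrix and the right-hand side of the stationarity system on a kink -/

section kink

variable {D} {p : ℝ × ℝ × ℝ} {k j : ℕ}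

theorem form_slope_slope
    (hM : ∀ i < D.n, i ∈ D.mid p ↔ D.z k < D.z i ∧ ¬ D.z j < D.z i) :
    D.form (D.mid p) (D.slopeDir k) (D.slopeDir k) = D.kinkA k j := by
  classical
  have h2 : D.avg (fun i => D.m (D.slopeDir k) i * D.m (D.slopeDir k) i -
      if i ∈ D.mid p then D.h (D.slopeDir k) i * D.h (D.slopeDir k) i else 0) =
      D.avg (fun i => (1 * D.z i + -D.z k) ^ 2) - D.kinkMoment₂ k j := by
    rw [kinkMoment₂, ← avg_sub]
    refine avg_congr fun i hi => ?_
    simp only [hM i hi, h_slopeDir, m_slopeDir]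
    by_cases a : D.z k < D.z i <;> by_cases b : D.z j < D.z i <;> simp [a, b] <;> ring
  unfold form
  simp only [h2, avg_sq, kinkA]
  simp [slopeDir]
  ring

theorem form_slope_scale (M : Set ℕ) :
    D.form M (D.slopeDir k) D.scaleDir = D.kinkB k := by
  classical
  have h2 : D.avg (fun i => D.m (D.slopeDir k) i * D.m D.scaleDir i -
      if i ∈ M then D.h (D.slopeDir k) i * D.h D.scaleDir i else 0) =
      D.avg (fun i => D.θ * D.z i + -(D.z k * D.θ)) := by
    refine avg_congr fun i hi => ?_
    rw [h_scaleDir, m_scaleDir, m_slopeDir]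
    simp
    ring
  unfold form
  simp only [h2, avg_linear, kinkB]
  simp [slopeDir, scaleDir]
  ring

theorem form_scale_scale (M : Set ℕ) : D.form M D.scaleDir D.scaleDir = D.kinkC := by
  classical
  unfold form
  simp only [h_scaleDir, m_scaleDir, kinkC]
  simp [scaleDir, avg_const]
  ring

theorem form_add_left (M : Set ℕ) (p p' d : ℝ × ℝ × ℝ) :
    D.form M (p + p') d = D.form M p d + D.form M p' d := by
  classical
  unfold form
  have : (fun i => D.m (p + p') i * D.m d i -
      if i ∈ M then D.h (p + p') i * D.h d i else 0) = fun i =>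
      (D.m p i * D.m d i - if i ∈ M then D.h p i * D.h d i else 0) +
      (D.m p' i * D.m d i - if i ∈ M then D.h p' i * D.h d i else 0) := by
    funext i
    split_ifs <;> simp [m, h] <;> ring
  rw [this, avg_add]
  simp
  ring

theorem form_smul_left (M : Set ℕ) (c : ℝ) (p d : ℝ × ℝ × ℝ) :
    D.form M (c • p) d = c * D.form M p d := by
  classical
  unfold form
  have : (fun i => D.m (c • p) i * D.m d i -
      if i ∈ M then D.h (c • p) i * D.h d i else 0) = fun i =>
      c * (D.m p i * D.m d i - if i ∈ M then D.h p i * D.h d i else 0) := by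
    funext i
    split_ifs <;> simp [m, h] <;> ring
  rw [this, avg_mul]
  simp
  ring

theorem form_comm (M : Set ℕ) (p d : ℝ × ℝ × ℝ) : D.form M p d = D.form M d p := by
  unfold form
  simp only [mul_comm, add_comm]

theorem form_offset_slope
    (hM : ∀ i < D.n, i ∈ D.mid p ↔ D.z k < D.z i ∧ ¬ D.z j < D.z i) :
    D.form (D.mid p) (0, -1, 0) (D.slopeDir k) = -D.kinkR k j := by
  classical
  have h2 : D.avg (fun i => D.m (0, -1, 0) i * D.m (D.slopeDir k) i -
      if i ∈ D.mid p then D.h (0, -1, 0) i * D.h (D.slopeDir k) i else 0) =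
      D.avg (fun i => -1 * D.z i + D.z k) + D.kinkMoment₁ k j := by
    rw [kinkMoment₁, ← avg_add]
    refine avg_congr fun i hi => ?_
    simp only [hM i hi, h_slopeDir, m_slopeDir]
    by_cases a : D.z k < D.z i <;> by_cases b : D.z j < D.z i <;> simp [a, b, m, h] <;> ring
  unfold form
  simp only [h2, avg_linear, kinkR]
  simp [slopeDir]
  ring

theorem form_offset_scale (M : Set ℕ) : D.form M (0, -1, 0) D.scaleDir = -D.θ := by
  classical
  unfold form
  simp only [h_scaleDir, m_scaleDir]
  simp [scaleDir, m, avg_const]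

/-- The affine parametrization of the kink by slope and scale: stationarity in the two directions
becomes a linear system in these two unknowns. -/
theorem eq_of_kink (h1 : D.h p k = 1) :
    p = p.1 • D.slopeDir k + p.2.2 • D.scaleDir + (0, -1, 0) := by
  ext
  · simp [slopeDir, scaleDir]
  · simp [slopeDir, scaleDir, h] at h1 ⊢
    linarith
  · simp [slopeDir, scaleDir]

theorem form_slopeDir
    (hM : ∀ i < D.n, i ∈ D.mid p ↔ D.z k < D.z i ∧ ¬ D.z j < D.z i) (h1 : D.h p k = 1) :
    D.form (D.mid p) p (D.slopeDir k) =
      p.1 * D.kinkA k j + p.2.2 * D.kinkB k - D.kinkR k j := by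
  conv_lhs => arg 3; rw [eq_of_kink h1]
  rw [form_add_left, form_add_left, form_smul_left, form_smul_left, form_slope_slope hM,
    form_comm _ D.scaleDir, form_slope_scale, form_offset_slope hM]
  ring

theorem form_scaleDir (M : Set ℕ) (h1 : D.h p k = 1) :
    D.form M p D.scaleDir = p.1 * D.kinkB k + p.2.2 * D.kinkC - D.θ := by
  conv_lhs => arg 3; rw [eq_of_kink h1]
  rw [form_add_left, form_add_left, form_smul_left, form_smul_left, form_slope_scale,
    form_scale_scale, form_offset_scale]
  ring

theorem h_slopeDir_eq_zero (hα : 0 < p.1) (h1 : D.h p k = 1) {i : ℕ} (hi : D.h p i = 1) :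
    D.h (D.slopeDir k) i = 0 := by
  rw [h_slopeDir]
  simp only [h] at h1 hi
  have : p.1 * (D.z k - D.z i) = 0 := by linarith
  exact (mul_eq_zero.1 this).resolve_left hα.ne'

theorem eq_kinkPoint (hα : 0 ≤ p.1) (hs : 0 ≤ p.2.2) (h1 : D.h p k = 1) :
    D.kinkPoint k p.1 p.2.2 = p := by
  simp only [kinkPoint, max_eq_right hα, max_eq_right hs]
  ext
  · rfl
  · simp only [h] at h1 ⊢; linarith
  · rfl

end kink

end Reduced

end UZPM

namespace UZPM

open Filter Topology

namespace Reduced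

variable (D : Reduced)

/-! ### Optimality of the candidates -/

theorem abs_le_of_sq_le {x c R : ℝ} (h : x ^ 2 ≤ c) (hR : 1 + c ≤ R) : |x| ≤ R := by
  rw [abs_le]
  constructor <;> nlinarith [sq_nonneg (x - 1), sq_nonneg (x + 1)]

theorem eventually_add_smul_pos {a : ℝ} (ha : 0 < a) (b : ℝ) :
    ∀ᶠ t in 𝓝 (0 : ℝ), 0 ≤ a + t * b := by
  have hcont : Tendsto (fun t : ℝ => a + t * b) (𝓝 0) (𝓝 a) := by
    have : Continuous fun t : ℝ => a + t * b := by fun_prop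
    simpa using this.tendsto 0
  filter_upwards [hcont.eventually (Ioi_mem_nhds ha)] with t ht using le_of_lt ht

/-- The feasible set of the reduced problem. -/
def cone : Set (ℝ × ℝ × ℝ) := {p | 0 ≤ p.1 ∧ 0 ≤ p.2.2}

/-- The feasible set of the reduced problem for a prescribed scale. -/
def slice (s : ℝ) : Set (ℝ × ℝ × ℝ) := {p | 0 ≤ p.1 ∧ p.2.2 = s}

theorem isClosed_cone : IsClosed cone := by
  have h1 : IsClosed {p : ℝ × ℝ × ℝ | 0 ≤ p.1} := isClosed_le continuous_const (by fun_prop)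
  have h2 : IsClosed {p : ℝ × ℝ × ℝ | 0 ≤ p.2.2} := isClosed_le continuous_const (by fun_prop)
  exact h1.inter h2

theorem isClosed_slice (s : ℝ) : IsClosed (slice s) := by
  have h1 : IsClosed {p : ℝ × ℝ × ℝ | 0 ≤ p.1} := isClosed_le continuous_const (by fun_prop)
  have h2 : IsClosed {p : ℝ × ℝ × ℝ | p.2.2 = s} := isClosed_eq (by fun_prop) continuous_const
  exact h1.inter h2

variable {D} in
theorem mem_cone_add {p : ℝ × ℝ × ℝ} (hα : 0 < p.1) (hs : 0 < p.2.2) (d : ℝ × ℝ × ℝ) :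
    ∀ᶠ t in 𝓝 (0 : ℝ), p + t • d ∈ cone := by
  filter_upwards [eventually_add_smul_pos hα d.1, eventually_add_smul_pos hs d.2.2] with t h1 h2
  exact ⟨by simpa using h1, by simpa using h2⟩

variable {D} in
theorem mem_slice_add {p : ℝ × ℝ × ℝ} {s : ℝ} (hα : 0 < p.1) (hs : p.2.2 = s) {d : ℝ × ℝ × ℝ}
    (hd : d.2.2 = 0) : ∀ᶠ t in 𝓝 (0 : ℝ), p + t • d ∈ slice s := by
  filter_upwards [eventually_add_smul_pos hα d.1] with t h1
  exact ⟨by simpa using h1, by simp [hd, hs]⟩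

/-- Strictly above the critical coefficient `quad` is coercive on the cone, and `phi ≥ quad`. -/
theorem exists_isExtremal_cone (hv : 0 < D.v) (hq : 0 < D.q) (hκ : -(2 * √(D.q * D.v)) < D.κ) :
    ∃ p, D.IsExtremal cone p := by
  rw [Real.sqrt_mul hq.le] at hκ
  have hsv : 0 < √D.v := Real.sqrt_pos.2 hv
  have hsq : 0 < √D.q := Real.sqrt_pos.2 hq
  have ev : √D.v ^ 2 = D.v := Real.sq_sqrt hv.le
  have eq' : √D.q ^ 2 = D.q := Real.sq_sqrt hq.le
  set c := √D.q * √D.v with hc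
  have hcpos : 0 < c := by positivity
  -- `η` is the relative distance of `κ` from the critical value `-2c`, capped at `1`; this fraction
  -- of the two squares survives the mixed term.
  obtain ⟨η, hη0, hη1, hη⟩ : ∃ η : ℝ, 0 < η ∧ η ≤ 1 ∧ -(2 * c * (1 - η)) ≤ D.κ := by
    refine ⟨min 1 ((D.κ + 2 * c) / (2 * c)), lt_min one_pos (by apply div_pos <;> linarith),
      min_le_left _ _, ?_⟩
    have h1 := min_le_right 1 ((D.κ + 2 * c) / (2 * c))
    rw [le_div_iff₀ (by positivity)] at h1
    linarith
  have hlow : ∀ p ∈ cone, p.2.1 ^ 2 + η * (D.v * p.1 ^ 2) + η * (D.q * p.2.2 ^ 2) ≤ D.quad p := by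
    rintro p ⟨h1, h2⟩
    have h3 : -(2 * c * (1 - η)) * (p.1 * p.2.2) ≤ D.κ * (p.1 * p.2.2) :=
      mul_le_mul_of_nonneg_right hη (mul_nonneg h1 h2)
    have h4 : 0 ≤ (1 - η) * (√D.v * p.1 - √D.q * p.2.2) ^ 2 :=
      mul_nonneg (by linarith) (sq_nonneg _)
    have h5 : (√D.v * p.1 - √D.q * p.2.2) ^ 2 =
        D.v * p.1 ^ 2 - 2 * c * (p.1 * p.2.2) + D.q * p.2.2 ^ 2 := by
      rw [hc]; linear_combination p.1 ^ 2 * ev + p.2.2 ^ 2 * eq'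
    rw [h5] at h4
    simp only [quad]
    linarith
  refine D.exists_isExtremal isClosed_cone (p₀ := 0) ⟨le_rfl, le_rfl⟩
    (R := 2 + 1 / (η * D.v) + 1 / (η * D.q)) fun p hp hle => ?_
  rw [phi_zero] at hle
  have hle' := (hlow p hp).trans ((D.quad_le_phi p).trans hle)
  have a1 : 0 ≤ η * (D.v * p.1 ^ 2) := by positivity
  have a2 : 0 ≤ η * (D.q * p.2.2 ^ 2) := by positivity
  have b1 : 0 ≤ 1 / (η * D.v) := by positivity
  have b2 : 0 ≤ 1 / (η * D.q) := by positivity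
  refine ⟨abs_le_of_sq_le (c := 1 / (η * D.v)) ?_ (by linarith),
    abs_le_of_sq_le (c := 1) (by linarith) (by linarith),
    abs_le_of_sq_le (c := 1 / (η * D.q)) ?_ (by linarith)⟩
  · rw [le_div_iff₀ (by positivity)]
    nlinarith [sq_nonneg p.2.1]
  · rw [le_div_iff₀ (by positivity)]
    nlinarith [sq_nonneg p.2.1]

/-- With the scale fixed, the mixed term is linear in the slope. Completing the square absorbs it
into half of `v α²`. -/
theorem exists_isExtremal_slice (hv : 0 < D.v) (s : ℝ) : ∃ p, D.IsExtremal (slice s) p := by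
  set C := |D.phi (0, 0, s)| + (D.κ * s) ^ 2 / D.v with hC
  have hC0 : 0 ≤ C := by positivity
  refine D.exists_isExtremal (isClosed_slice s) (p₀ := (0, 0, s)) ⟨le_rfl, rfl⟩
    (R := 1 + C + 2 * C / D.v + |s|) fun p hp hle => ?_
  have hle' := (D.quad_le_phi p).trans (hle.trans (le_abs_self _))
  have hs : p.2.2 = s := hp.2
  have hbound : p.2.1 ^ 2 + D.v / 2 * p.1 ^ 2 ≤ C := by
    simp only [quad, hs] at hle'
    have h1 : 0 ≤ D.q * s ^ 2 := mul_nonneg D.q_nonneg (sq_nonneg s)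
    have h2 : 0 ≤ (D.v * p.1 + D.κ * s) ^ 2 / (2 * D.v) := by positivity
    have h3 : (D.v * p.1 + D.κ * s) ^ 2 / (2 * D.v) =
        D.v / 2 * p.1 ^ 2 + D.κ * p.1 * s + (D.κ * s) ^ 2 / D.v / 2 := by
      field_simp
      ring
    have h4 : 0 ≤ (D.κ * s) ^ 2 / D.v := by positivity
    rw [h3] at h2
    linarith
  have b1 : 0 ≤ 2 * C / D.v := by positivity
  have b2 := abs_nonneg s
  have c1 : 0 ≤ D.v / 2 * p.1 ^ 2 := by positivity
  refine ⟨abs_le_of_sq_le (c := 2 * C / D.v) ?_ (by linarith),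
    abs_le_of_sq_le (c := C) (by linarith) (by linarith), by rw [hs]; linarith⟩
  rw [le_div_iff₀ hv]
  nlinarith [sq_nonneg p.2.1]

/-- With slope and scale both positive all directions are feasible. An active kink is therefore
forced, and on it the stationarity system is nonsingular and has `p` as its solution. -/
theorem exists_jointCand_eq {p : ℝ × ℝ × ℝ} (hp : D.IsExtremal cone p) (hα : 0 < p.1)
    (hs : 0 < p.2.2) (hq : 0 < D.q) : ∃ k < D.n, ∃ j < D.n, D.jointCand k j = p := by
  -- Without an active kink `p` itself is an admissible direction; then `form p p = 0` by
  -- stationarity, against nondegeneracy.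
  obtain ⟨k, hk, h1⟩ : ∃ k < D.n, D.h p k = 1 := by
    by_contra! hno
    have hkk : ∀ i < D.n, D.h p i = 1 → D.h p i = 0 := fun i hi h => absurd h (hno i hi)
    exact hp.form_self_ne_zero (mem_cone_add hα hs p) hkk hα.ne'
      (hp.form_eq_zero (mem_cone_add hα hs p) hkk)
  obtain ⟨j, hj, hM⟩ := D.exists_mid_eq_range hα hk h1
  refine ⟨k, hk, j, hj, ?_⟩
  have hk1 : ∀ i < D.n, D.h p i = 1 → D.h (D.slopeDir k) i = 0 := fun i _ hi =>
    h_slopeDir_eq_zero hα h1 hi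
  have hk2 : ∀ i < D.n, D.h p i = 1 → D.h D.scaleDir i = 0 := fun i _ _ => D.h_scaleDir i
  have e1 := hp.form_eq_zero (mem_cone_add hα hs _) hk1
  have e2 := hp.form_eq_zero (mem_cone_add hα hs _) hk2
  rw [form_slopeDir hM h1] at e1
  rw [form_scaleDir _ h1] at e2
  have hC : 0 < D.kinkC := by
    unfold kinkC; positivity
  have hdet : D.kinkA k j * D.kinkC - D.kinkB k * D.kinkB k ≠ 0 := by
    -- `u` is orthogonal to `scaleDir` for `form`, and `form u u` is `kinkC` times the determinant,
    -- while its slope component is `kinkC ≠ 0`.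
    set u := D.kinkC • D.slopeDir k + (-D.kinkB k) • D.scaleDir with hu
    have hku : ∀ i < D.n, D.h p i = 1 → D.h u i = 0 := fun i hi hpi => by
      have a1 := hk1 i hi hpi
      have a2 := hk2 i hi hpi
      simp only [h, hu, Prod.fst_add, Prod.snd_add, Prod.smul_fst, Prod.smul_snd,
        smul_eq_mul] at a1 a2 ⊢
      linear_combination D.kinkC * a1 - D.kinkB k * a2
    have hne := hp.form_self_ne_zero (mem_cone_add hα hs u) hku
      (by simp [hu, slopeDir, scaleDir, hC.ne'])
    intro h0
    apply hne
    have f1 : D.form (D.mid p) u (D.slopeDir k) =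
        D.kinkC * D.kinkA k j - D.kinkB k * D.kinkB k := by
      rw [hu, form_add_left, form_smul_left, form_smul_left, form_slope_slope hM,
        form_comm _ D.scaleDir, form_slope_scale]
      ring
    have f2 : D.form (D.mid p) u D.scaleDir = 0 := by
      rw [hu, form_add_left, form_smul_left, form_smul_left, form_slope_scale, form_scale_scale]
      ring
    conv_lhs => arg 3; rw [hu]
    rw [form_add_left, form_smul_left, form_smul_left, form_comm _ (D.slopeDir k),
      form_comm _ D.scaleDir, f1, f2]
    linear_combination D.kinkC * h0
  have hx : (D.kinkR k j * D.kinkC - D.kinkB k * D.θ) /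
      (D.kinkA k j * D.kinkC - D.kinkB k * D.kinkB k) = p.1 := by
    rw [div_eq_iff hdet]
    linear_combination D.kinkB k * e2 - D.kinkC * e1
  have hy : (D.kinkA k j * D.θ - D.kinkB k * D.kinkR k j) /
      (D.kinkA k j * D.kinkC - D.kinkB k * D.kinkB k) = p.2.2 := by
    rw [div_eq_iff hdet]
    linear_combination D.kinkB k * e1 - D.kinkA k j * e2
  rw [jointCand, hx, hy, eq_kinkPoint hα.le hs.le h1]

/-- With the scale fixed only `slopeDir` remains, so the system is one equation, and nondegeneracy
says that its coefficient `kinkA` is nonzero. -/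
theorem exists_kinkCand_eq {s : ℝ} {p : ℝ × ℝ × ℝ} (hp : D.IsExtremal (slice s) p) (hs : 0 ≤ s)
    (hα : 0 < p.1) {k : ℕ} (hk : k < D.n) (h1 : D.h p k = 1) :
    ∃ j < D.n, D.kinkCand s k j = p := by
  obtain ⟨j, hj, hM⟩ := D.exists_mid_eq_range hα hk h1
  refine ⟨j, hj, ?_⟩
  have hps : p.2.2 = s := hp.mem.2
  have hk1 : ∀ i < D.n, D.h p i = 1 → D.h (D.slopeDir k) i = 0 := fun i _ hi =>
    h_slopeDir_eq_zero hα h1 hi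
  have hmem := mem_slice_add hα hps (d := D.slopeDir k) rfl
  have e1 := hp.form_eq_zero hmem hk1
  rw [form_slopeDir hM h1, hps] at e1
  have hA := hp.form_self_ne_zero hmem hk1 one_ne_zero
  rw [form_slope_slope hM] at hA
  have hx : (D.kinkR k j - D.kinkB k * s) / D.kinkA k j = p.1 := by
    rw [div_eq_iff hA]
    linear_combination -e1
  rw [kinkCand, hx, ← hps, eq_kinkPoint hα.le (hps ▸ hs) h1]

/-- The strictly intermediate indices form a range. -/
theorem exists_mid_eq_interval {p : ℝ × ℝ × ℝ} (hα : 0 < p.1) (hv : 0 < D.v) :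
    ∃ j < D.n, ∃ k < D.n, ∀ i < D.n, i ∈ D.mid p ↔ ¬ D.z i < D.z j ∧ ¬ D.z k < D.z i := by
  classical
  rcases ((Finset.range D.n).filter (· ∈ D.mid p)).eq_empty_or_nonempty with he | hne
  -- No intermediate index: a reversed pair encodes the empty interval. It exists because positive
  -- variance excludes constant data.
  · obtain ⟨j, hj, k, hk, hjk⟩ : ∃ j < D.n, ∃ k < D.n, D.z k < D.z j := by
      by_contra! hall
      have hz : ∀ i < D.n, D.z i = D.z 0 := fun i hi =>
        le_antisymm (hall i hi 0 D.n_pos) (hall 0 D.n_pos i hi)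
      have h0 : D.z 0 = 0 := by
        have := D.avg_const' hz
        rwa [show D.avg (fun i => D.z i) = 0 from D.avg_z, eq_comm] at this
      have : D.v = 0 := D.avg_const' fun i hi => by rw [hz i hi, h0]; ring
      exact hv.ne' this
    refine ⟨j, hj, k, hk, fun i hi => ⟨fun hm => ?_, fun hm => ?_⟩⟩
    · exact absurd (Finset.mem_filter.2 ⟨Finset.mem_range.2 hi, hm⟩) (by simp [he])
    · exact absurd (hjk.trans_le (not_lt.1 hm.1)) hm.2
  · obtain ⟨j, hj, hmin⟩ := Finset.exists_min_image _ D.z hne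
    obtain ⟨k, hk, hmax⟩ := Finset.exists_max_image _ D.z hne
    obtain ⟨hjn, hjm⟩ := Finset.mem_filter.1 hj
    obtain ⟨hkn, hkm⟩ := Finset.mem_filter.1 hk
    refine ⟨j, Finset.mem_range.1 hjn, k, Finset.mem_range.1 hkn,
      fun i hi => ⟨fun hm => ?_, fun hm => ?_⟩⟩
    · have := Finset.mem_filter.2 ⟨Finset.mem_range.2 hi, hm⟩
      exact ⟨not_lt.2 (hmin i this), not_lt.2 (hmax i this)⟩
    · have h1 := hkm.1
      have h2 := hjm.2
      simp only [h] at h1 h2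
      have h3 := mul_le_mul_of_nonneg_left (not_lt.1 hm.1) hα.le
      have h4 := mul_le_mul_of_nonneg_left (not_lt.1 hm.2) hα.le
      constructor <;> simp only [h] <;> linarith

/-! ### Stationarity away from the kinks -/

section smooth

variable {D} {p : ℝ × ℝ × ℝ} {j k : ℕ}

theorem avg_mid (hM : ∀ i < D.n, i ∈ D.mid p ↔ ¬ D.z i < D.z j ∧ ¬ D.z k < D.z i)
    (a b c : ℝ) : open Classical in
    D.avg (fun i => if i ∈ D.mid p then a * D.z i ^ 2 + b * D.z i + c else 0) =
      a * D.rangeMoment 2 j k + b * D.rangeMoment 1 j k + c * D.rangeMoment 0 j k := by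
  classical
  unfold rangeMoment
  rw [← avg_mul, ← avg_mul, ← avg_mul, ← avg_add, ← avg_add]
  refine avg_congr fun i hi => ?_
  simp only [hM i hi]
  by_cases a : D.z i < D.z j <;> by_cases b : D.z k < D.z i <;> simp [a, b]

theorem form_interval (hM : ∀ i < D.n, i ∈ D.mid p ↔ ¬ D.z i < D.z j ∧ ¬ D.z k < D.z i)
    (p' d : ℝ × ℝ × ℝ) (hd : d.2.2 = 0) :
    D.form (D.mid p) p' d = d.1 * (p'.1 * (D.v - D.rangeMoment 2 j k) -
        p'.2.1 * D.rangeMoment 1 j k + D.κ * p'.2.2 / 2 + D.θ * p'.2.2 * D.rangeMoment 1 j k) +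
      d.2.1 * (p'.2.1 * (1 - D.rangeMoment 0 j k) - p'.1 * D.rangeMoment 1 j k +
        D.θ * p'.2.2 * D.rangeMoment 0 j k) := by
  classical
  unfold form
  rw [avg_sub]
  have e1 : D.avg (fun i => D.m p' i * D.m d i) = p'.1 * d.1 * D.v + p'.2.1 * d.2.1 := by
    have : (fun i => D.m p' i * D.m d i) = fun i => (p'.1 * d.1) * D.z i ^ 2 +
        ((p'.1 * d.2.1 + p'.2.1 * d.1) * D.z i + p'.2.1 * d.2.1) := by
      funext i; simp only [m]; ring
    rw [this, avg_add, avg_mul, avg_linear]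
    rfl
  have e2 : (fun i => if i ∈ D.mid p then D.h p' i * D.h d i else 0) =
      fun i => if i ∈ D.mid p then (p'.1 * d.1) * D.z i ^ 2 +
        (p'.1 * d.2.1 + (p'.2.1 - D.θ * p'.2.2) * d.1) * D.z i +
        (p'.2.1 - D.θ * p'.2.2) * d.2.1 else 0 := by
    funext i
    refine if_congr Iff.rfl ?_ rfl
    simp only [h, hd]; ring
  rw [e1, e2, avg_mid hM, hd]
  ring

end smooth

/-- Slope and offset may vary freely near `p`, which gives a symmetric `2 × 2` system; a singular
system would provide a null direction that changes the slope. -/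
theorem exists_smoothCand_eq {s : ℝ} {p : ℝ × ℝ × ℝ} (hp : D.IsExtremal (slice s) p)
    (hv : 0 < D.v) (hα : 0 < p.1) (hk : ∀ k < D.n, D.h p k ≠ 1) :
    ∃ j < D.n, ∃ k < D.n, D.smoothCand s j k = p := by
  classical
  obtain ⟨j, hj, k, hk', hM⟩ := D.exists_mid_eq_interval hα hv
  refine ⟨j, hj, k, hk', ?_⟩
  have hps : p.2.2 = s := hp.mem.2
  have hkk : ∀ d : ℝ × ℝ × ℝ, ∀ i < D.n, D.h p i = 1 → D.h d i = 0 :=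
    fun d i hi h => absurd h (hk i hi)
  have e1 := hp.form_eq_zero (mem_slice_add hα hps (d := (1, 0, 0)) rfl) (hkk _)
  have e2 := hp.form_eq_zero (mem_slice_add hα hps (d := (0, 1, 0)) rfl) (hkk _)
  rw [form_interval hM _ _ rfl] at e1 e2
  simp only [one_mul, zero_mul, add_zero, zero_add, hps] at e1 e2
  set M0 := D.rangeMoment 0 j k with hM0
  set M1 := D.rangeMoment 1 j k
  set M2 := D.rangeMoment 2 j k
  have hdet : D.smoothDet j k ≠ 0 := by
    intro h0
    have h0' : (D.v - M2) * (1 - M0) - M1 * M1 = 0 := h0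
    -- A null direction is exhibited in each case. If all indices are intermediate, then `M2 = v`
    -- and `(1, 0, 0)` is null; otherwise eliminating the offset gives `(1 - M0, M1, 0)`.
    by_cases hM0 : 1 - M0 = 0
    · have hne := hp.form_self_ne_zero (mem_slice_add hα hps (d := (1, 0, 0)) rfl) (hkk _)
        one_ne_zero
      apply hne
      rw [form_interval hM _ _ rfl]
      change (1 : ℝ) * (1 * (D.v - M2) - 0 * M1 + D.κ * 0 / 2 + D.θ * 0 * M1) + 0 * _ = 0
      have hall : ∀ i < D.n, ¬ D.z i < D.z j ∧ ¬ D.z k < D.z i := by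
        have hs : ∑ i ∈ Finset.range D.n, (1 - if D.z i < D.z j then (0 : ℝ) else
            if D.z k < D.z i then 0 else D.z i ^ 0) = 0 := by
          have hn := D.cast_pos
          have : M0 * D.n = ∑ i ∈ Finset.range D.n, (if D.z i < D.z j then (0 : ℝ) else
            if D.z k < D.z i then 0 else D.z i ^ 0) := div_mul_cancel₀ _ hn.ne'
          rw [Finset.sum_sub_distrib, ← this]
          simp
          linear_combination (D.n : ℝ) * hM0
        rw [Finset.sum_eq_zero_iff_of_nonneg (fun i _ => by split_ifs <;> simp)] at hs
        intro i hi
        have := hs i (Finset.mem_range.2 hi)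
        by_cases a : D.z i < D.z j <;> by_cases b : D.z k < D.z i <;> simp [a, b] at this ⊢
      have : M2 = D.v := avg_congr fun i hi => by
        rw [if_neg (hall i hi).1, if_neg (hall i hi).2]
      rw [this]
      ring
    · have hne := hp.form_self_ne_zero (mem_slice_add hα hps (d := (1 - M0, M1, 0)) rfl) (hkk _)
        hM0
      apply hne
      rw [form_interval hM _ _ rfl]
      linear_combination (1 - M0) * h0'
  have hx : ((-D.κ * s / 2 - D.θ * s * M1) * (1 - M0) - M1 * (D.θ * s * M0)) / D.smoothDet j k =
      p.1 := by
    rw [div_eq_iff hdet, smoothDet]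
    linear_combination (-(1 - M0)) * e1 - M1 * e2
  have hy : ((D.v - M2) * (-(D.θ * s * M0)) + M1 * (-D.κ * s / 2 - D.θ * s * M1)) /
      D.smoothDet j k = p.2.1 := by
    rw [div_eq_iff hdet, smoothDet]
    linear_combination (-(D.v - M2)) * e2 - M1 * e1
  simp only [smoothCand]
  rw [hx, hy, max_eq_right hα.le, ← hps]

/-- The candidates solve the reduced problem. -/
theorem le_phi_of_le_candidates (hκ : -(2 * √(D.q * D.v)) ≤ D.κ) {B : ℝ} (h1 : B ≤ 1)
    (hc : B ≤ D.phi D.cantelli) (hr : B ≤ D.phi D.ray)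
    (hj : ∀ k < D.n, ∀ j < D.n, B ≤ D.phi (D.jointCand k j))
    {p : ℝ × ℝ × ℝ} (hp : p ∈ cone) : B ≤ D.phi p := by
  rcases D.v_nonneg.eq_or_lt with hv | hv
  · rw [← hv] at hκ
    simp at hκ
    exact D.le_phi_of_constant hp.2 (mul_nonneg hκ hp.1)
      (fun i hi => by rw [D.z_eq_zero hv.symm hi, mul_zero]) h1 hc
  rcases D.q_nonneg.eq_or_lt with hq | hq
  · rw [← hq] at hκ
    simp at hκ
    rcases le_or_gt D.θ 0 with hθ | hθ
    · exact h1.trans (D.one_le_phi_of_nonpos hθ hp.2 (mul_nonneg hκ hp.1))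
    -- For `q = 0` the Cantelli value is `0`, and nothing lies below it since `quad` is nonnegative
    -- here.
    · rw [D.phi_cantelli hθ, ← hq, zero_div] at hc
      refine hc.trans (le_trans ?_ (D.quad_le_phi p))
      have a1 := mul_nonneg (mul_nonneg hκ hp.1) hp.2
      have a2 := mul_nonneg hv.le (sq_nonneg p.1)
      simp only [quad, ← hq]
      nlinarith [sq_nonneg p.2.1]
  rcases hκ.eq_or_lt with hκ | hκ
  · exact hr.trans (D.phi_ray_le hv hκ.symm hp.2)
  obtain ⟨p', hp'⟩ := D.exists_isExtremal_cone hv hq hκ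
  refine le_trans ?_ (hp'.min p hp)
  obtain ⟨hα, hs⟩ := hp'.mem
  rcases hα.eq_or_lt with hα | hα
  · exact D.le_phi_of_constant hs (by simp [← hα]) (fun i _ => by simp [← hα]) h1 hc
  rcases hs.eq_or_lt with hs | hs
  · exact h1.trans (D.one_le_phi_of_scale_eq_zero hs.symm)
  obtain ⟨k, hk, j, hjn, he⟩ := D.exists_jointCand_eq hp' hα hs hq
  rw [← he]
  exact hj k hk j hjn

/-- A problem in the offset alone, `w² + hinge (k - w)` with `k = θ s`. On the middle piece it is
affine in `w` with slope `2k`, so for `0 < k < 1` the minimum lies on the kink `w = k - 1`;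
otherwise `w = 0` is optimal. -/
theorem le_phi_of_slope_eq {s : ℝ} {B : ℝ} (h0 : B ≤ D.phi (0, 0, s))
    (h1 : B ≤ D.phi (0, D.θ * s - 1, s)) {p : ℝ × ℝ × ℝ} (hs : p.2.2 = s) (hκ : 0 ≤ D.κ * p.1 * s)
    (hz : ∀ i < D.n, p.1 * D.z i = 0) : B ≤ D.phi p := by
  have key : ∀ (α w : ℝ), (∀ i < D.n, α * D.z i = 0) → D.phi (α, w, s) =
      D.q * s ^ 2 + D.κ * α * s + (w ^ 2 + hinge (D.θ * s - w)) := fun α w hα => by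
    unfold phi
    congr 1
    refine D.avg_const' fun i hi => ?_
    simp only [m, h, hα i hi, sub_zero, zero_add]
  rw [key 0 _ fun i _ => zero_mul _] at h0 h1
  obtain ⟨α, w, s'⟩ := p
  simp only at hs hκ hz
  subst hs
  rw [key _ _ hz]
  set k := D.θ * s' with hk
  rw [sub_sub_cancel, hinge_of_one_le le_rfl] at h1
  rw [sub_zero] at h0
  have hw := hinge_nonneg (k - w)
  rcases le_or_gt k 0 with hk0 | hk0
  · rw [hinge_of_nonpos hk0] at h0
    have := le_sq_add_hinge k 0 w
    rw [if_pos hk0] at this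
    nlinarith
  rcases le_or_gt 1 k with hk1 | hk1
  · rw [hinge_of_one_le hk1] at h0
    nlinarith
  rcases le_or_gt (k - w) 0 with hw0 | hw0
  · rw [hinge_of_nonpos hw0]
    nlinarith
  rcases le_or_gt (k - w) 1 with hw1 | hw1
  · rw [hinge_of_mem hw0.le hw1]
    nlinarith
  · rw [hinge_of_one_le hw1.le]
    nlinarith

/-- The candidates solve the reduced problem for a prescribed scale. -/
theorem le_phi_of_le_candidates_slice {s : ℝ} (hs : 0 ≤ s) (hκ : D.v = 0 → 0 ≤ D.κ) {B : ℝ}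
    (h0 : B ≤ D.phi (0, 0, s)) (h1 : B ≤ D.phi (0, D.θ * s - 1, s))
    (hk : ∀ k < D.n, ∀ j < D.n, B ≤ D.phi (D.kinkCand s k j))
    (hm : ∀ j < D.n, ∀ k < D.n, B ≤ D.phi (D.smoothCand s j k))
    {p : ℝ × ℝ × ℝ} (hp : p ∈ slice s) : B ≤ D.phi p := by
  rcases D.v_nonneg.eq_or_lt with hv | hv
  · exact D.le_phi_of_slope_eq h0 h1 hp.2 (mul_nonneg (mul_nonneg (hκ hv.symm) hp.1) hs)
      fun i hi => by rw [D.z_eq_zero hv.symm hi, mul_zero]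
  obtain ⟨p', hp'⟩ := D.exists_isExtremal_slice hv s
  refine le_trans ?_ (hp'.min p hp)
  rcases hp'.mem.1.eq_or_lt with hα | hα
  · exact D.le_phi_of_slope_eq h0 h1 hp'.mem.2 (by simp [← hα]) fun i _ => by simp [← hα]
  by_cases hkink : ∃ k < D.n, D.h p' k = 1
  · obtain ⟨k, hkn, hk1⟩ := hkink
    obtain ⟨j, hj, he⟩ := D.exists_kinkCand_eq hp' hs hα hkn hk1
    rw [← he]
    exact hk k hkn j hj
  · push Not at hkink
    obtain ⟨j, hj, k, hkn, he⟩ := D.exists_smoothCand_eq hp' hv hα hkink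
    rw [← he]
    exact hm j hj k hkn

/-! ### Unboundedness -/

/-- Without variance the quadratic part is affine in the slope, with negative coefficient `κ s`. The
slope is chosen to bring it down to `B - 2`, and the hinges add at most `1`. -/
theorem exists_phi_lt_slice {s : ℝ} (hs : 0 < s) (hv : D.v = 0) (hκ : D.κ < 0) (B : ℝ) :
    ∃ p ∈ slice s, D.phi p < B := by
  set a := max 0 ((D.q * s ^ 2 + 2 - B) / (-D.κ * s)) with ha
  have hks : 0 < -D.κ * s := mul_pos (neg_pos.2 hκ) hs
  refine ⟨(a, 0, s), ⟨le_max_left _ _, rfl⟩, (D.phi_le_quad _).trans_lt ?_⟩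
  have h1 : (D.q * s ^ 2 + 2 - B) / (-D.κ * s) ≤ a := le_max_right _ _
  rw [div_le_iff₀ hks] at h1
  simp only [quad, hv]
  nlinarith

theorem exists_quad_neg (hκ : D.κ < -(2 * √(D.q * D.v))) :
    ∃ a s : ℝ, 0 < a ∧ 0 < s ∧ D.quad (a, 0, s) < 0 := by
  have hκ0 : D.κ < 0 := by
    have := Real.sqrt_nonneg (D.q * D.v); linarith
  rcases D.v_nonneg.eq_or_lt with hv | hv
  · refine ⟨(D.q + 1) / (-D.κ), 1, div_pos (by linarith [D.q_nonneg]) (by linarith), one_pos, ?_⟩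
    have : D.κ * ((D.q + 1) / (-D.κ)) = -(D.q + 1) := by
      have := hκ0.ne
      field_simp
    simp only [quad, ← hv]
    linarith
  rcases D.q_nonneg.eq_or_lt with hq | hq
  · refine ⟨1, (D.v + 1) / (-D.κ), one_pos, div_pos (by linarith) (by linarith), ?_⟩
    have : D.κ * ((D.v + 1) / (-D.κ)) = -(D.v + 1) := by
      have := hκ0.ne
      field_simp
    simp only [quad, ← hq]
    linarith
  · rw [Real.sqrt_mul hq.le] at hκ
    have hsv : 0 < √D.v := Real.sqrt_pos.2 hv
    have hsq : 0 < √D.q := Real.sqrt_pos.2 hq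
    refine ⟨√D.q, √D.v, hsq, hsv, ?_⟩
    -- At `(√q, 0, √v)` the two squares contribute `2 q v` and the mixed term `κ √(q v)`, which is
    -- smaller than `-2 q v`.
    simp only [quad, Real.sq_sqrt hv.le, Real.sq_sqrt hq.le]
    have e : √D.q ^ 2 * √D.v ^ 2 = D.q * D.v := by rw [Real.sq_sqrt hv.le, Real.sq_sqrt hq.le]
    have := mul_lt_mul_of_pos_right hκ (mul_pos hsq hsv)
    nlinarith

/-- `quad` is homogeneous of degree two and the hinges add at most `1`, so scaling a point with
negative `quad` suffices. -/
theorem exists_phi_lt (hκ : D.κ < -(2 * √(D.q * D.v))) (B : ℝ) :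
    ∃ p : ℝ × ℝ × ℝ, 0 ≤ p.1 ∧ 0 < p.2.2 ∧ D.phi p < B := by
  obtain ⟨a, s, ha, hs, hneg⟩ := D.exists_quad_neg hκ
  set Q := D.quad (a, 0, s) with hQ
  set t := max 1 ((2 - B) / -Q) with ht
  have ht1 : 1 ≤ t := le_max_left _ _
  have ht2 : (2 - B) / -Q ≤ t := le_max_right _ _
  refine ⟨(t * a, 0, t * s), by positivity, by positivity, (D.phi_le_quad _).trans_lt ?_⟩
  have : D.quad (t * a, 0, t * s) = t ^ 2 * Q := by rw [hQ]; simp only [quad]; ring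
  rw [this]
  rw [div_le_iff₀ (by linarith)] at ht2
  nlinarith [mul_nonneg (sub_nonneg.2 ht1) (sub_nonneg.2 ht1)]

end Reduced

end UZPM

namespace UZPM

open RealRAM (Cmd)

/-! ### The closed form of `Ψ` -/

theorem coe_sum_real {ι : Type*} (s : Finset ι) (f : ι → ℝ) :
    ∑ i ∈ s, (f i : EReal) = ((∑ i ∈ s, f i : ℝ) : EReal) := by
  classical
  induction s using Finset.induction_on with
  | empty => simp
  | insert a s ha ih => rw [Finset.sum_insert ha, Finset.sum_insert ha, ih, EReal.coe_add]

/-- The function maximized in `Ψ`. -/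
noncomputable def objective (τ xi l₁ l₂ l₃ x : ℝ) : ℝ :=
  (if τ ≤ x then 1 else 0) - l₁ * (x - xi) ^ 2 - l₂ * x - l₃ * x ^ 2

theorem Psi_eq_iSup (τ xi l₁ l₂ l₃ : ℝ) :
    Psi τ xi l₁ l₂ l₃ = ⨆ x : ℝ, ((objective τ xi l₁ l₂ l₃ x : ℝ) : EReal) := by
  simp only [Psi, objective, Set.indicator_apply, Set.mem_Ici]

theorem objective_le_Psi (τ xi l₁ l₂ l₃ x : ℝ) :
    ((objective τ xi l₁ l₂ l₃ x : ℝ) : EReal) ≤ Psi τ xi l₁ l₂ l₃ := by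
  rw [Psi_eq_iSup]
  exact le_iSup (fun x : ℝ => ((objective τ xi l₁ l₂ l₃ x : ℝ) : EReal)) x

theorem Psi_le {τ xi l₁ l₂ l₃ r : ℝ} (h : ∀ x, objective τ xi l₁ l₂ l₃ x ≤ r) :
    Psi τ xi l₁ l₂ l₃ ≤ (r : EReal) := by
  rw [Psi_eq_iSup]
  exact iSup_le fun x => EReal.coe_le_coe_iff.2 (h x)

theorem Psi_eq_top {τ xi l₁ l₂ l₃ : ℝ} (h : ∀ B : ℝ, ∃ x, B < objective τ xi l₁ l₂ l₃ x) :
    Psi τ xi l₁ l₂ l₃ = ⊤ := by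
  rw [EReal.eq_top_iff_forall_lt]
  intro B
  obtain ⟨x, hx⟩ := h B
  exact (EReal.coe_lt_coe_iff.2 hx).trans_le (objective_le_Psi _ _ _ _ _ _)

theorem Psi_eq_coe {τ xi l₁ l₂ l₃ r x₀ : ℝ} (h : ∀ x, objective τ xi l₁ l₂ l₃ x ≤ r)
    (h₀ : objective τ xi l₁ l₂ l₃ x₀ = r) : Psi τ xi l₁ l₂ l₃ = (r : EReal) :=
  le_antisymm (Psi_le h) (h₀ ▸ objective_le_Psi _ _ _ _ _ _)

theorem objective_eq (τ xi l₁ l₂ ξ x : ℝ) : objective τ xi l₁ l₂ (ξ - l₁) x =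
    -l₁ * xi ^ 2 + ((if τ ≤ x then 1 else 0) - ξ * x ^ 2 + (2 * l₁ * xi - l₂) * x) := by
  rw [objective]; ring

theorem Psi_of_neg {τ xi l₁ l₂ ξ : ℝ} (hξ : ξ < 0) : Psi τ xi l₁ l₂ (ξ - l₁) = ⊤ := by
  refine Psi_eq_top fun B => ?_
  set c := 2 * l₁ * xi - l₂ with hc
  -- With this `t` the leading term is `t (-ξ + |c| + |B + λ₁ x_i²|)`; here `|c| t` absorbs the
  -- linear term, and `t ≥ 1` yields the rest.
  set t := 1 + (|c| + |B + l₁ * xi ^ 2|) / (-ξ) with ht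
  have hb : 0 ≤ (|c| + |B + l₁ * xi ^ 2|) / (-ξ) :=
    div_nonneg (by positivity) (by linarith)
  have e : (-ξ) * t = -ξ + (|c| + |B + l₁ * xi ^ 2|) := by
    rw [ht]; have := hξ.ne; field_simp; ring
  refine ⟨t, ?_⟩
  rw [objective_eq, ← hc]
  have h1 : (0 : ℝ) ≤ if τ ≤ t then 1 else 0 := by split_ifs <;> norm_num
  have h2 := neg_abs_le c
  have h3 := le_abs_self (B + l₁ * xi ^ 2)
  have h4 := abs_nonneg (B + l₁ * xi ^ 2)
  have h5 : -ξ * t ^ 2 + c * t ≥ |B + l₁ * xi ^ 2| * t + -ξ * t := by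
    have : -ξ * t ^ 2 = t * (-ξ + (|c| + |B + l₁ * xi ^ 2|)) := by rw [← e]; ring
    rw [this]
    nlinarith
  nlinarith

theorem Psi_of_zero {τ xi l₁ l₂ : ℝ} (hc : 2 * l₁ * xi - l₂ ≠ 0) :
    Psi τ xi l₁ l₂ (0 - l₁) = ⊤ := by
  refine Psi_eq_top fun B => ⟨(B + l₁ * xi ^ 2 + 1) / (2 * l₁ * xi - l₂), ?_⟩
  rw [objective_eq, mul_div_cancel₀ _ hc]
  have h1 : (0 : ℝ) ≤ if τ ≤ (B + l₁ * xi ^ 2 + 1) / (2 * l₁ * xi - l₂) then 1 else 0 := by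
    split_ifs <;> norm_num
  linarith

theorem Psi_of_zero_of_zero {τ xi l₁ l₂ : ℝ} (hc : 2 * l₁ * xi - l₂ = 0) :
    Psi τ xi l₁ l₂ (0 - l₁) = ((-l₁ * xi ^ 2 + 1 : ℝ) : EReal) := by
  refine Psi_eq_coe (x₀ := τ) (fun x => ?_) ?_
  · rw [objective_eq, hc]
    split_ifs <;> linarith
  · rw [objective_eq, hc]
    simp

/-- The closed form of `Ψ` for `λ₁ + λ₃ = s²`. -/
noncomputable def psi (τ xi l₁ l₂ s : ℝ) : ℝ :=
  -l₁ * xi ^ 2 + (((2 * l₁ * xi - l₂) / (2 * s)) ^ 2 +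
    hinge (s * τ - (2 * l₁ * xi - l₂) / (2 * s)))

/-- In the scaled coordinate `X = s x` the bound is `le_sq_add_hinge`. It is attained at the vertex
`m / s`, unless the threshold lies between `0` and `1` beyond it, in which case it is attained at
`τ`. -/
theorem Psi_eq_psi {τ xi l₁ l₂ s : ℝ} (hs : 0 < s) :
    Psi τ xi l₁ l₂ (s ^ 2 - l₁) = (psi τ xi l₁ l₂ s : EReal) := by
  unfold psi
  set m := (2 * l₁ * xi - l₂) / (2 * s) with hm
  have hcm : 2 * l₁ * xi - l₂ = 2 * s * m := by rw [hm]; field_simp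
  have hle : ∀ x, objective τ xi l₁ l₂ (s ^ 2 - l₁) x ≤
      -l₁ * xi ^ 2 + (m ^ 2 + hinge (s * τ - m)) := fun x => by
    have := le_sq_add_hinge (s * τ) (s * x) m
    simp only [mul_le_mul_iff_right₀ hs] at this
    rw [objective_eq, hcm]
    linarith
  have hmid : s * (m / s) = m := by field_simp
  rcases le_or_gt (s * τ - m) 0 with h0 | h0
  · refine Psi_eq_coe (x₀ := m / s) hle ?_
    rw [objective_eq, hcm, hinge_of_nonpos h0,
      if_pos (by rw [le_div_iff₀ hs]; linarith)]
    linear_combination (2 * m - s * (m / s) - m) * hmid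
  rcases le_or_gt (s * τ - m) 1 with h1 | h1
  · refine Psi_eq_coe (x₀ := τ) hle ?_
    rw [objective_eq, hcm, hinge_of_mem h0.le h1, if_pos le_rfl]
    ring
  · refine Psi_eq_coe (x₀ := m / s) hle ?_
    rw [objective_eq, hcm, hinge_of_one_le h1.le,
      if_neg (by rw [not_le, div_lt_iff₀ hs]; linarith)]
    linear_combination (2 * m - s * (m / s) - m) * hmid

theorem Psi_eq_psi_sqrt {τ xi l₁ l₂ ξ : ℝ} (hξ : 0 < ξ) :
    Psi τ xi l₁ l₂ (ξ - l₁) = (psi τ xi l₁ l₂ √ξ : EReal) := by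
  rw [← Psi_eq_psi (Real.sqrt_pos.2 hξ), Real.sq_sqrt hξ.le]

theorem Psi_cases (τ xi l₁ l₂ ξ : ℝ) :
    (ξ < 0 → Psi τ xi l₁ l₂ (ξ - l₁) = ⊤) ∧
    (ξ = 0 → 2 * l₁ * xi - l₂ ≠ 0 → Psi τ xi l₁ l₂ (ξ - l₁) = ⊤) ∧
    (ξ = 0 → 2 * l₁ * xi - l₂ = 0 →
      Psi τ xi l₁ l₂ (ξ - l₁) = ((-l₁ * xi ^ 2 + 1 : ℝ) : EReal)) ∧
    (0 < ξ → τ ≤ (2 * l₁ * xi - l₂) / (2 * ξ) →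
      Psi τ xi l₁ l₂ (ξ - l₁) =
        ((-l₁ * xi ^ 2 + (1 + (2 * l₁ * xi - l₂) ^ 2 / (4 * ξ)) : ℝ) : EReal)) ∧
    (0 < ξ → (2 * l₁ * xi - l₂) / (2 * ξ) < τ →
      τ < (2 * l₁ * xi - l₂) / (2 * ξ) + 1 / Real.sqrt ξ →
      Psi τ xi l₁ l₂ (ξ - l₁) =
        ((-l₁ * xi ^ 2 + (1 - ξ * τ ^ 2 + (2 * l₁ * xi - l₂) * τ) : ℝ) : EReal)) ∧
    (0 < ξ → (2 * l₁ * xi - l₂) / (2 * ξ) + 1 / Real.sqrt ξ ≤ τ →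
      Psi τ xi l₁ l₂ (ξ - l₁) =
        ((-l₁ * xi ^ 2 + (2 * l₁ * xi - l₂) ^ 2 / (4 * ξ) : ℝ) : EReal)) := by
  refine ⟨Psi_of_neg, ?_, ?_, fun hξ h => ?_, fun hξ h h' => ?_, fun hξ h => ?_⟩
  · rintro rfl; exact Psi_of_zero
  · rintro rfl; exact Psi_of_zero_of_zero
  all_goals
    rw [Psi_eq_psi_sqrt hξ, EReal.coe_eq_coe_iff, psi]
    obtain ⟨s, hs, rfl⟩ : ∃ s : ℝ, 0 < s ∧ ξ = s ^ 2 :=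
      ⟨√ξ, Real.sqrt_pos.2 hξ, (Real.sq_sqrt hξ.le).symm⟩
    rw [Real.sqrt_sq hs.le] at *
    generalize 2 * l₁ * xi - l₂ = c at *
    have e : c / (2 * s ^ 2) = c / (2 * s) / s := by field_simp
  · rw [e, le_div_iff₀ hs] at h
    rw [hinge_of_nonpos (by linarith)]
    field_simp
    ring
  · rw [e, div_lt_iff₀ hs] at h
    rw [e, ← add_div, lt_div_iff₀ hs] at h'
    rw [hinge_of_mem (by linarith) (by linarith)]
    field_simp
    ring
  · rw [e, ← add_div, div_le_iff₀ hs] at h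
    rw [hinge_of_one_le (by linarith)]
    field_simp
    ring

/-! ### Convexity and the reduction to `ξ > 0` -/

variable {n : ℕ} (x : Fin n → ℝ) (δ μ σ τ : ℝ)

/-- The real value of the dual objective for `λ₁ + λ₃ = ξ > 0`. -/
noncomputable def realF (l₁ l₂ ξ : ℝ) : ℝ :=
  (l₁ * δ + l₂ * μ + (ξ - l₁) * (σ ^ 2 + μ ^ 2)) + 1 / (n : ℝ) * ∑ i, psi τ (x i) l₁ l₂ √ξ

theorem F_eq_realF (l₁ l₂ : ℝ) {ξ : ℝ} (hξ : 0 < ξ) :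
    F x δ μ σ τ l₁ l₂ (ξ - l₁) = (realF x δ μ σ τ l₁ l₂ ξ : EReal) := by
  simp only [F, realF, Psi_eq_psi_sqrt hξ, coe_sum_real, EReal.coe_add, EReal.coe_mul]

/-- For each `y` the objective is affine in `(λ₁, λ₂, ξ)`, so the convex combination is bounded
pointwise before the supremum is taken. -/
theorem psi_convex {τ xi l₁ l₂ ξ l₁' l₂' ξ' a b : ℝ} (hξ : 0 < ξ) (hξ' : 0 < ξ') (ha : 0 ≤ a)
    (hb : 0 ≤ b) (hab : a + b = 1) :
    psi τ xi (a * l₁ + b * l₁') (a * l₂ + b * l₂') √(a * ξ + b * ξ') ≤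
      a * psi τ xi l₁ l₂ √ξ + b * psi τ xi l₁' l₂' √ξ' := by
  have hpos : 0 < a * ξ + b * ξ' := by
    rcases ha.eq_or_lt with h | h
    · rw [← h] at hab ⊢
      rw [zero_add] at hab
      rw [hab]
      linarith
    · have := mul_pos h hξ
      have := mul_nonneg hb hξ'.le
      linarith
  rw [← EReal.coe_le_coe_iff, ← Psi_eq_psi_sqrt hpos]
  refine Psi_le fun y => ?_
  have h1 := objective_le_Psi τ xi l₁ l₂ (ξ - l₁) y
  have h2 := objective_le_Psi τ xi l₁' l₂' (ξ' - l₁') y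
  rw [Psi_eq_psi_sqrt hξ, EReal.coe_le_coe_iff] at h1
  rw [Psi_eq_psi_sqrt hξ', EReal.coe_le_coe_iff] at h2
  refine le_trans (le_of_eq ?_)
    (add_le_add (mul_le_mul_of_nonneg_left h1 ha) (mul_le_mul_of_nonneg_left h2 hb))
  rw [objective_eq, objective_eq, objective_eq]
  linear_combination (-(if τ ≤ y then (1 : ℝ) else 0)) * hab

theorem realF_convex {l₁ l₂ ξ l₁' l₂' ξ' a b : ℝ} (hξ : 0 < ξ) (hξ' : 0 < ξ') (ha : 0 ≤ a)
    (hb : 0 ≤ b) (hab : a + b = 1) :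
    realF x δ μ σ τ (a * l₁ + b * l₁') (a * l₂ + b * l₂') (a * ξ + b * ξ') ≤
      a * realF x δ μ σ τ l₁ l₂ ξ + b * realF x δ μ σ τ l₁' l₂' ξ' := by
  have h := Finset.sum_le_sum fun (i : Fin n) (_ : i ∈ Finset.univ) =>
    psi_convex (τ := τ) (xi := x i) (l₁ := l₁) (l₂ := l₂) (l₁' := l₁') (l₂' := l₂') hξ hξ' ha hb hab
  rw [Finset.sum_add_distrib, ← Finset.mul_sum, ← Finset.mul_sum] at h
  have h' := mul_le_mul_of_nonneg_left h (by positivity : (0 : ℝ) ≤ 1 / n)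
  unfold realF
  linarith

theorem innerValue_le {l₁ : ℝ} (h : 0 ≤ l₁) (l₂ : ℝ) (ξ : ℝ) :
    innerValue x δ μ σ τ ξ ≤ F x δ μ σ τ l₁ l₂ (ξ - l₁) :=
  iInf₂_le_of_le l₁ h (iInf_le _ l₂)

theorem exists_realF_lt {ξ : ℝ} (hξ : 0 < ξ) {t : ℝ} (h : innerValue x δ μ σ τ ξ < (t : EReal)) :
    ∃ l₁ l₂, 0 ≤ l₁ ∧ realF x δ μ σ τ l₁ l₂ ξ < t := by
  simp only [innerValue, iInf_lt_iff] at h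
  obtain ⟨l₁, h₁, l₂, h₂⟩ := h
  rw [F_eq_realF x δ μ σ τ l₁ l₂ hξ, EReal.coe_lt_coe_iff] at h₂
  exact ⟨l₁, l₂, h₁, h₂⟩

theorem le_coe_of_forall_pos {a : EReal} {t : ℝ} (h : ∀ ε : ℝ, 0 < ε → a ≤ ((t + ε : ℝ) : EReal)) :
    a ≤ (t : EReal) := by
  by_contra! hlt
  obtain ⟨r, h1, h2⟩ := EReal.lt_iff_exists_real_btwn.1 hlt
  have h3 := EReal.coe_lt_coe_iff.1 h1
  have := h (r - t) (by linarith)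
  rw [add_sub_cancel] at this
  exact absurd h2 (not_lt.2 this)

theorem convex_epigraph_innerValue :
    Convex ℝ {p : ℝ × ℝ | 0 < p.1 ∧ innerValue x δ μ σ τ p.1 ≤ (p.2 : EReal)} := by
  rintro ⟨ξ, t⟩ ⟨hξ, ht⟩ ⟨ξ', t'⟩ ⟨hξ', ht'⟩ a b ha hb hab
  simp only at hξ ht hξ' ht'
  have hpos : 0 < a * ξ + b * ξ' := by
    have := (convex_Ioi (0 : ℝ)) hξ hξ' ha hb hab
    simpa using this
  refine ⟨by simpa using hpos, ?_⟩
  simp only [Prod.smul_mk, Prod.mk_add_mk, smul_eq_mul]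
  -- The infimum need not be attained and may be `-∞`, hence multipliers with slack `ε` on both
  -- sides.
  refine le_coe_of_forall_pos fun ε hε => ?_
  obtain ⟨l₁, l₂, h₁, h₂⟩ := exists_realF_lt x δ μ σ τ hξ (t := t + ε)
    (ht.trans_lt (EReal.coe_lt_coe_iff.2 (by linarith)))
  obtain ⟨l₁', l₂', h₁', h₂'⟩ := exists_realF_lt x δ μ σ τ hξ' (t := t' + ε)
    (ht'.trans_lt (EReal.coe_lt_coe_iff.2 (by linarith)))
  refine (innerValue_le x δ μ σ τ (by positivity : 0 ≤ a * l₁ + b * l₁')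
    (a * l₂ + b * l₂') _).trans ?_
  rw [F_eq_realF _ _ _ _ _ _ _ hpos, EReal.coe_le_coe_iff]
  refine (realF_convex x δ μ σ τ hξ hξ' ha hb hab).trans ?_
  have e1 := mul_le_mul_of_nonneg_left h₂.le ha
  have e2 := mul_le_mul_of_nonneg_left h₂'.le hb
  nlinarith

/-- A larger `λ₃` lowers every function under the supremum by `ε y²`, so only the linear term can
grow. -/
theorem F_add_le (l₁ l₂ l₃ : ℝ) {ε : ℝ} (hε : 0 ≤ ε) :
    F x δ μ σ τ l₁ l₂ (l₃ + ε) ≤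
      F x δ μ σ τ l₁ l₂ l₃ + ((ε * (σ ^ 2 + μ ^ 2) : ℝ) : EReal) := by
  have hP : ∀ i, Psi τ (x i) l₁ l₂ (l₃ + ε) ≤ Psi τ (x i) l₁ l₂ l₃ := fun i => by
    rw [Psi_eq_iSup, Psi_eq_iSup]
    refine iSup_mono fun y => EReal.coe_le_coe_iff.2 ?_
    simp only [objective]
    nlinarith [mul_nonneg hε (sq_nonneg y)]
  have h0 : (0 : EReal) ≤ ((1 / (n : ℝ) : ℝ) : EReal) := EReal.coe_nonneg.2 (by positivity)
  have hsum := mul_le_mul_of_nonneg_left (Finset.sum_le_sum fun i (_ : i ∈ Finset.univ) => hP i) h0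
  unfold F
  conv_rhs => rw [add_right_comm, ← EReal.coe_add]
  refine add_le_add (le_of_eq ?_) hsum
  rw [EReal.coe_eq_coe_iff]
  ring

theorem sum_top {n : ℕ} (hn : 0 < n) : ∑ _i : Fin n, (⊤ : EReal) = ⊤ := by
  obtain ⟨k, rfl⟩ : ∃ k, n = k + 1 := ⟨n - 1, by omega⟩
  induction k with
  | zero => simp
  | succ k ih =>
    rw [Fin.sum_univ_succ, ih (by omega), EReal.top_add_top]

theorem F_of_neg (hn : 0 < n) {l₁ l₂ l₃ : ℝ} (h : l₁ + l₃ < 0) : F x δ μ σ τ l₁ l₂ l₃ = ⊤ := by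
  have hP : ∀ i, Psi τ (x i) l₁ l₂ l₃ = ⊤ := fun i => by
    have := Psi_of_neg (τ := τ) (xi := x i) (l₁ := l₁) (l₂ := l₂) h
    rwa [add_sub_cancel_left] at this
  have hn' : (0 : ℝ) < 1 / n := by positivity
  simp only [F, hP, sum_top hn]
  rw [EReal.coe_mul_top_of_pos hn', EReal.coe_add_top]

theorem dualValue_le {l₁ : ℝ} (h : 0 ≤ l₁) (l₂ l₃ : ℝ) :
    dualValue x δ μ σ τ ≤ F x δ μ σ τ l₁ l₂ l₃ := by
  unfold dualValue
  refine (iInf₂_le l₁ h).trans ?_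
  refine (iInf_le _ l₂).trans ?_
  exact iInf_le _ l₃

theorem dualValue_eq_iInf (hn : 0 < n) :
    dualValue x δ μ σ τ = ⨅ (ξ : ℝ) (_ : 0 < ξ), innerValue x δ μ σ τ ξ := by
  apply le_antisymm
  · refine le_iInf₂ fun ξ _ => le_iInf₂ fun l₁ h₁ => le_iInf fun l₂ => ?_
    exact dualValue_le x δ μ σ τ h₁ l₂ (ξ - l₁)
  · refine le_iInf₂ fun l₁ h₁ => le_iInf₂ fun l₂ l₃ => ?_
    rcases lt_or_ge (l₁ + l₃) 0 with hneg | hpos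
    · rw [F_of_neg x δ μ σ τ hn hneg]
      exact le_top
    have key : ∀ ε : ℝ, 0 < ε → (⨅ (ξ : ℝ) (_ : 0 < ξ), innerValue x δ μ σ τ ξ) ≤
        F x δ μ σ τ l₁ l₂ l₃ + ((ε * (σ ^ 2 + μ ^ 2) : ℝ) : EReal) := fun ε hε => by
      refine le_trans ?_ (F_add_le x δ μ σ τ l₁ l₂ l₃ hε.le)
      refine iInf₂_le_of_le (l₁ + l₃ + ε) (by linarith) ?_
      have := innerValue_le x δ μ σ τ h₁ l₂ (l₁ + l₃ + ε)
      rwa [show l₁ + l₃ + ε - l₁ = l₃ + ε by ring] at this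
    generalize hF : F x δ μ σ τ l₁ l₂ l₃ = A at key ⊢
    induction A using EReal.rec with
    | top => exact le_top
    | bot => simpa using key 1 one_pos
    | coe r =>
      refine le_coe_of_forall_pos fun ε hε => ?_
      -- The summand `1` keeps the denominator positive when `σ = μ = 0`.
      have hC : 0 < σ ^ 2 + μ ^ 2 + 1 := by positivity
      refine (key (ε / (σ ^ 2 + μ ^ 2 + 1)) (by positivity)).trans ?_
      rw [← EReal.coe_add, EReal.coe_le_coe_iff]
      have : ε / (σ ^ 2 + μ ^ 2 + 1) * (σ ^ 2 + μ ^ 2) ≤ ε := by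
        rw [div_mul_eq_mul_div, div_le_iff₀ hC]
        nlinarith
      linarith

/-! ### The reduced objective of a data set -/

section reduction

open RealRAM.Cmd (array)

/-- The mean of the data points. -/
noncomputable def mean : ℝ := (∑ i ∈ Finset.range n, array x i) / n

/-- The second moment of the data points. -/
noncomputable def moment₂ : ℝ := (∑ i ∈ Finset.range n, array x i ^ 2) / n

/-- The reduced problem of a data set. -/
noncomputable def reduced (hn : 0 < n) : Reduced where
  n := n
  z i := array x i - mean x
  q := σ ^ 2
  κ := δ - σ ^ 2 - μ ^ 2 - moment₂ x + 2 * μ * mean x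
  θ := τ - μ
  n_pos := hn
  sum_z := by
    have : (n : ℝ) ≠ 0 := by positivity
    rw [Finset.sum_sub_distrib]
    simp [mean]
    field_simp
    simp
  q_nonneg := sq_nonneg σ

/-- The substitution is made so that `c_i / (2s) = α z_i + w + s μ`. After averaging, the terms
linear in `w` cancel against `λ₂ μ`, and the terms in `α s` collect into `κ`. -/
theorem realF_eq_phi (hn : 0 < n) (α w : ℝ) {s : ℝ} (hs : 0 < s) :
    realF x δ μ σ τ (α * s) (-2 * s * (w + s * μ - α * mean x)) (s ^ 2) =
      (reduced x δ μ σ τ hn).phi (α, w, s) := by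
  set D := reduced x δ μ σ τ hn with hD
  have hsum : 1 / (n : ℝ) * ∑ i, psi τ (x i) (α * s) (-2 * s * (w + s * μ - α * mean x)) s =
      D.avg fun i => ((-(α * s) * array x i ^ 2) + ((2 * s * μ) * (α * D.z i + w) + s ^ 2 * μ ^ 2)) +
        (D.m (α, w, s) i ^ 2 + hinge (D.h (α, w, s) i)) := by
    unfold Reduced.avg
    change _ = (∑ i ∈ Finset.range n, _) / (n : ℝ)
    rw [Finset.sum_range, one_div_mul_eq_div]
    congr 1
    refine Finset.sum_congr rfl fun i _ => ?_
    have hx : array x i = x i := by simp [array]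
    have e : (2 * (α * s) * x i - -2 * s * (w + s * μ - α * mean x)) / (2 * s) =
        α * (x i - mean x) + w + s * μ := by
      field_simp
      ring
    simp only [psi, e, Reduced.m, Reduced.h, hD, reduced, hx]
    rw [show s * τ - (α * (x i - mean x) + w + s * μ) =
      (τ - μ) * s - α * (x i - mean x) - w by ring]
    ring
  unfold realF
  rw [Real.sqrt_sq hs.le, hsum, Reduced.avg_add, Reduced.avg_add, Reduced.avg_add, Reduced.avg_mul,
    Reduced.avg_mul, Reduced.avg_linear, Reduced.avg_const]
  have hm : D.avg (fun i => array x i ^ 2) = moment₂ x := rfl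
  rw [hm]
  unfold Reduced.phi
  simp only [hD, reduced]
  ring

theorem F_eq_phi (hn : 0 < n) (α w : ℝ) {s : ℝ} (hs : 0 < s) :
    F x δ μ σ τ (α * s) (-2 * s * (w + s * μ - α * mean x)) (s ^ 2 - α * s) =
      ((reduced x δ μ σ τ hn).phi (α, w, s) : EReal) := by
  rw [F_eq_realF x δ μ σ τ _ _ (by positivity : 0 < s ^ 2), realF_eq_phi x δ μ σ τ hn α w hs]

theorem exists_phi_eq (hn : 0 < n) {l₁ : ℝ} (h₁ : 0 ≤ l₁) (l₂ : ℝ) {s : ℝ} (hs : 0 < s) :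
    ∃ p ∈ Reduced.slice s, F x δ μ σ τ l₁ l₂ (s ^ 2 - l₁) =
      ((reduced x δ μ σ τ hn).phi p : EReal) := by
  refine ⟨(l₁ / s, -l₂ / (2 * s) - s * μ + l₁ / s * mean x, s), ⟨by positivity, rfl⟩, ?_⟩
  rw [← F_eq_phi x δ μ σ τ hn _ _ hs]
  congr 1
  · field_simp
  · field_simp
    ring
  · field_simp

theorem innerValue_le_phi (hn : 0 < n) {s : ℝ} (hs : 0 < s) {p : ℝ × ℝ × ℝ}
    (hp : p ∈ Reduced.slice s) :
    innerValue x δ μ σ τ (s ^ 2) ≤ ((reduced x δ μ σ τ hn).phi p : EReal) := by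
  obtain ⟨α, w, s'⟩ := p
  obtain ⟨h1, h2⟩ := hp
  simp only at h1 h2
  subst h2
  rw [← F_eq_phi x δ μ σ τ hn α w hs]
  exact innerValue_le x δ μ σ τ (mul_nonneg h1 hs.le) _ _

theorem innerValue_eq (hn : 0 < n) {s : ℝ} (hs : 0 < s) {p : ℝ × ℝ × ℝ}
    (hp : p ∈ Reduced.slice s)
    (hmin : ∀ p' ∈ Reduced.slice s,
      (reduced x δ μ σ τ hn).phi p ≤ (reduced x δ μ σ τ hn).phi p') :
    innerValue x δ μ σ τ (s ^ 2) = ((reduced x δ μ σ τ hn).phi p : EReal) := by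
  refine le_antisymm (innerValue_le_phi x δ μ σ τ hn hs hp) ?_
  refine le_iInf₂ fun l₁ h₁ => le_iInf fun l₂ => ?_
  obtain ⟨p', hp', he⟩ := exists_phi_eq x δ μ σ τ hn h₁ l₂ hs
  rw [he]
  exact EReal.coe_le_coe_iff.2 (hmin p' hp')

theorem innerValue_eq_bot (hn : 0 < n) {s : ℝ} (hs : 0 < s)
    (h : ∀ B, ∃ p ∈ Reduced.slice s, (reduced x δ μ σ τ hn).phi p < B) :
    innerValue x δ μ σ τ (s ^ 2) = ⊥ := by
  rw [EReal.eq_bot_iff_forall_lt]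
  intro B
  obtain ⟨p, hp, hlt⟩ := h B
  exact (innerValue_le_phi x δ μ σ τ hn hs hp).trans_lt (EReal.coe_lt_coe_iff.2 hlt)

theorem dualValue_eq_bot (hn : 0 < n)
    (h : ∀ B, ∃ p : ℝ × ℝ × ℝ, 0 ≤ p.1 ∧ 0 < p.2.2 ∧ (reduced x δ μ σ τ hn).phi p < B) :
    dualValue x δ μ σ τ = ⊥ := by
  rw [EReal.eq_bot_iff_forall_lt]
  intro B
  obtain ⟨p, hp1, hp2, hlt⟩ := h B
  rw [dualValue_eq_iInf x δ μ σ τ hn]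
  refine lt_of_le_of_lt (iInf₂_le_of_le (p.2.2 ^ 2) (by positivity)
    (innerValue_le_phi x δ μ σ τ hn hp2 ⟨hp1, rfl⟩)) (EReal.coe_lt_coe_iff.2 hlt)

theorem coe_le_dualValue (hn : 0 < n) {B : ℝ}
    (h : ∀ p ∈ Reduced.cone, B ≤ (reduced x δ μ σ τ hn).phi p) :
    (B : EReal) ≤ dualValue x δ μ σ τ := by
  rw [dualValue_eq_iInf x δ μ σ τ hn]
  refine le_iInf₂ fun ξ hξ => le_iInf₂ fun l₁ h₁ => le_iInf fun l₂ => ?_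
  obtain ⟨p, hp, he⟩ := exists_phi_eq x δ μ σ τ hn h₁ l₂ (Real.sqrt_pos.2 hξ)
  rw [Real.sq_sqrt hξ.le] at he
  rw [he]
  exact EReal.coe_le_coe_iff.2 (h p ⟨hp.1, hp.2 ▸ Real.sqrt_nonneg ξ⟩)

/-- Needed when the search ends at scale zero, where the change of variables is not available. -/
theorem F_zero (hn : 0 < n) : F x δ μ σ τ 0 0 0 = (1 : ℝ) := by
  have hP : ∀ i, Psi τ (x i) 0 0 0 = ((1 : ℝ) : EReal) := fun i => by
    have := Psi_of_zero_of_zero (τ := τ) (xi := x i) (l₁ := 0) (l₂ := 0) (by simp)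
    simpa using this
  have hn' : (n : ℝ) ≠ 0 := by positivity
  simp only [F, hP, coe_sum_real, ← EReal.coe_mul, ← EReal.coe_add, EReal.coe_eq_coe_iff]
  simp [hn']

end reduction

end UZPM

/-! ### Notation for expressions and their evaluation -/

namespace RealRAM.RExpr

instance : Add RExpr := ⟨RExpr.add⟩
instance : Sub RExpr := ⟨RExpr.sub⟩
instance : Mul RExpr := ⟨RExpr.mul⟩
instance : Div RExpr := ⟨RExpr.div⟩
instance (k : ℕ) : OfNat RExpr k := ⟨RExpr.const k⟩

section

variable (n : ℕ) (x : ℕ → ℝ) (ρ : Fin 64 → ℝ) (a b c e : RExpr) (ι : List ℕ)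

@[simp] theorem eval_var (r : Fin 64) : (var r).eval n x ρ ι = ρ r := rfl
@[simp] theorem eval_add : (a + b).eval n x ρ ι = a.eval n x ρ ι + b.eval n x ρ ι := rfl
@[simp] theorem eval_sub : (a - b).eval n x ρ ι = a.eval n x ρ ι - b.eval n x ρ ι := rfl
@[simp] theorem eval_mul : (a * b).eval n x ρ ι = a.eval n x ρ ι * b.eval n x ρ ι := rfl
@[simp] theorem eval_div : (a / b).eval n x ρ ι = a.eval n x ρ ι / b.eval n x ρ ι := rfl
@[simp] theorem eval_sqrt : (sqrt a).eval n x ρ ι = √(a.eval n x ρ ι) := rfl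
@[simp] theorem eval_zero : (0 : RExpr).eval n x ρ ι = 0 := by
  change (((0 : ℕ) : ℚ) : ℝ) = 0
  simp
@[simp] theorem eval_one : (1 : RExpr).eval n x ρ ι = 1 := by
  change (((1 : ℕ) : ℚ) : ℝ) = 1
  simp
@[simp] theorem eval_two : (2 : RExpr).eval n x ρ ι = 2 := by
  change (((2 : ℕ) : ℚ) : ℝ) = 2
  simp

open Classical in
@[simp] theorem eval_ite : (ite a b c e).eval n x ρ ι =
    if a.eval n x ρ ι < b.eval n x ρ ι then c.eval n x ρ ι else e.eval n x ρ ι := rfl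

@[simp] theorem eval_sum :
    (sum e).eval n x ρ ι = ∑ i ∈ Finset.range n, e.eval n x ρ (i :: ι) := rfl

end

/-- The maximum of two expressions. -/
def max (a b : RExpr) : RExpr := ite a b b a

@[simp] theorem eval_max (n : ℕ) (x : ℕ → ℝ) (ρ : Fin 64 → ℝ) (a b : RExpr) (ι : List ℕ) :
    (max a b).eval n x ρ ι = Max.max (a.eval n x ρ ι) (b.eval n x ρ ι) := by
  simp only [max, eval_ite]
  split_ifs with h
  · exact (max_eq_right h.le).symm
  · exact (max_eq_left (not_lt.1 h)).symm

/-- The average over the data points. -/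
def avg (e : RExpr) : RExpr := sum e / sum 1

end RealRAM.RExpr

namespace UZPM

open RealRAM RExpr
open RealRAM.Cmd (array)

/-! ### Expressions for the reduced data -/

/-- The mean of the data points. -/
def meanE : RExpr := avg (elem 0)
/-- The second moment of the data points. -/
def moment₂E : RExpr := avg (elem 0 * elem 0)
/-- The deviation of the data point addressed by the `j`-th bound variable. -/
def zE (j : ℕ) : RExpr := elem j - meanE
/-- The variance. -/
def vE : RExpr := avg (zE 0 * zE 0)
/-- The squared standard deviation of the ambiguity set. -/
def qE : RExpr := var 2 * var 2
/-- The centered threshold. -/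
def θE : RExpr := var 3 - var 1
/-- The coefficient of the mixed term. -/
def κE : RExpr := var 0 - qE - var 1 * var 1 - moment₂E + 2 * var 1 * meanE
/-- The function `hinge`. -/
def hingeE (h : RExpr) : RExpr := RExpr.max 0 (1 - RExpr.max 0 h * RExpr.max 0 h)
/-- The reduced objective. -/
def phiE (a w s : Fin 64) : RExpr :=
  qE * (var s * var s) + κE * var a * var s +
    avg ((var a * zE 0 + var w) * (var a * zE 0 + var w) +
      hingeE (θE * var s - var a * zE 0 - var w))

/-- The moments over a half-open range. -/
def kinkMomentE (e : RExpr) : RExpr := avg (ite (zE 2) (zE 0) (ite (zE 1) (zE 0) 0 e) 0)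
/-- Coefficients of the stationarity system on a kink. -/
def kinkAE : RExpr := zE 1 * zE 1 + vE - kinkMomentE ((zE 0 - zE 2) * (zE 0 - zE 2))
/-- The mixed coefficient. -/
def kinkBE : RExpr := κE / 2 - θE * zE 1
/-- The coefficient of the scale. -/
def kinkCE : RExpr := θE * θE + qE
/-- The right-hand side. -/
def kinkRE : RExpr := 0 - zE 1 - kinkMomentE (zE 0 - zE 2)
/-- The moments over a closed range. -/
def rangeMomentE (e : RExpr) : RExpr := avg (ite (zE 0) (zE 2) 0 (ite (zE 1) (zE 0) 0 e))
/-- The determinant of the stationarity system away from the kinks. -/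
def smoothDetE : RExpr :=
  (vE - rangeMomentE (zE 0 * zE 0)) * (1 - rangeMomentE 1) - rangeMomentE (zE 0) * rangeMomentE (zE 0)
/-- The scaling factor of `Reduced.ray`. -/
def rayE : RExpr :=
  sum (ite 0 (θE * sqrt vE - sqrt qE * zE 0) (1 / (θE * sqrt vE - sqrt qE * zE 0)) 0)

/-- The first variables hold the parameters. -/
structure Inputs (δ μ σ τ ξ : ℝ) (ρ : Fin 64 → ℝ) : Prop where
  h0 : ρ 0 = δ
  h1 : ρ 1 = μ
  h2 : ρ 2 = σ
  h3 : ρ 3 = τ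
  h4 : ρ 4 = ξ

/-! ### Correctness of the expressions -/

section eval

variable {n : ℕ} (hn : 0 < n) (x : Fin n → ℝ) {δ μ σ τ ξ : ℝ} {ρ : Fin 64 → ℝ} (ι : List ℕ)

theorem eval_avg (e : RExpr) : (avg e).eval n (array x) ρ ι =
    (reduced x δ μ σ τ hn).avg fun i => e.eval n (array x) ρ (i :: ι) := by
  simp [avg, Reduced.avg, reduced]

/-- The expression is closed, since its sum binds its own index; it can therefore be used in any
scope, and recomputing it costs only a polynomial factor. -/
theorem eval_meanE : meanE.eval n (array x) ρ ι = mean x := by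
  simp [meanE, avg, mean, eval]

theorem eval_moment₂E : moment₂E.eval n (array x) ρ ι = moment₂ x := by
  simp [moment₂E, avg, moment₂, eval, sq]

theorem eval_zE {j : ℕ} (hj : j < ι.length) :
    (zE j).eval n (array x) ρ ι = (reduced x δ μ σ τ hn).z (ι.getD j 0) := by
  simp only [zE, eval_sub, eval_meanE, eval, if_pos hj]
  rfl

theorem eval_vE : vE.eval n (array x) ρ ι = (reduced x δ μ σ τ hn).v := by
  rw [vE, eval_avg hn x (δ := δ) (μ := μ) (σ := σ) (τ := τ), Reduced.v]
  congr 1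
  funext i
  rw [eval_mul, eval_zE hn x (δ := δ) (μ := μ) (σ := σ) (τ := τ) _ (by simp), sq]
  rfl

theorem eval_qE (hρ : Inputs δ μ σ τ ξ ρ) :
    qE.eval n (array x) ρ ι = (reduced x δ μ σ τ hn).q := by
  simp [qE, hρ.h2, reduced, sq]

theorem eval_θE (hρ : Inputs δ μ σ τ ξ ρ) :
    θE.eval n (array x) ρ ι = (reduced x δ μ σ τ hn).θ := by
  simp [θE, hρ.h1, hρ.h3, reduced]

theorem eval_κE (hρ : Inputs δ μ σ τ ξ ρ) :
    κE.eval n (array x) ρ ι = (reduced x δ μ σ τ hn).κ := by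
  simp only [κE, eval_add, eval_sub, eval_mul, eval_var, eval_moment₂E, eval_meanE,
    eval_qE hn x ι hρ, hρ.h0, hρ.h1, reduced, eval_two]
  ring

theorem eval_phiE (hρ : Inputs δ μ σ τ ξ ρ) (a w s : Fin 64) :
    (phiE a w s).eval n (array x) ρ ι = (reduced x δ μ σ τ hn).phi (ρ a, ρ w, ρ s) := by
  simp only [phiE, eval_add, eval_mul, eval_var, eval_qE hn x ι hρ, eval_κE hn x ι hρ,
    eval_avg hn x (δ := δ) (μ := μ) (σ := σ) (τ := τ), Reduced.phi]
  congr 1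
  · ring
  · congr 1
    funext i
    simp only [hingeE, eval_sub, eval_mul, eval_var, eval_max, eval_zero, eval_one,
      eval_θE hn x _ hρ, eval_zE hn x (δ := δ) (μ := μ) (σ := σ) (τ := τ) (i :: ι) (j := 0) (by simp),
      Reduced.m, Reduced.h, hinge, List.getD_cons_zero, sq]

theorem eval_kinkMomentE (k j : ℕ) (e : RExpr) (f : ℕ → ℝ)
    (he : ∀ i, e.eval n (array x) ρ (i :: j :: k :: ι) = f i) : open Classical in
    (kinkMomentE e).eval n (array x) ρ (j :: k :: ι) =
      (reduced x δ μ σ τ hn).avg fun i =>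
        if (reduced x δ μ σ τ hn).z k < (reduced x δ μ σ τ hn).z i then
          if (reduced x δ μ σ τ hn).z j < (reduced x δ μ σ τ hn).z i then 0 else f i else 0 := by
  have hz := fun i l : ℕ => @eval_zE n hn x δ μ σ τ ρ (i :: j :: k :: ι) l
  simp only [kinkMomentE, eval_avg hn x (δ := δ) (μ := μ) (σ := σ) (τ := τ), eval_ite, he]
  congr 1
  funext i
  rw [hz i 0 (by simp), hz i 1 (by simp), hz i 2 (by simp)]
  simp

theorem eval_rangeMomentE (k j r : ℕ) (e : RExpr)
    (he : ∀ i, e.eval n (array x) ρ (i :: k :: j :: ι) = (reduced x δ μ σ τ hn).z i ^ r) :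
    (rangeMomentE e).eval n (array x) ρ (k :: j :: ι) =
      (reduced x δ μ σ τ hn).rangeMoment r j k := by
  have hz := fun i l : ℕ => @eval_zE n hn x δ μ σ τ ρ (i :: k :: j :: ι) l
  simp only [rangeMomentE, eval_avg hn x (δ := δ) (μ := μ) (σ := σ) (τ := τ), eval_ite, he,
    Reduced.rangeMoment]
  congr 1
  funext i
  rw [hz i 0 (by simp), hz i 1 (by simp), hz i 2 (by simp)]
  simp

theorem eval_kinkAE (k j : ℕ) : kinkAE.eval n (array x) ρ (j :: k :: ι) =
    (reduced x δ μ σ τ hn).kinkA k j := by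
  set D := reduced x δ μ σ τ hn with hD
  have hz := fun i l : ℕ => @eval_zE n hn x δ μ σ τ ρ (i :: j :: k :: ι) l
  rw [kinkAE, eval_sub, eval_add, eval_mul,
    eval_zE hn x (δ := δ) (μ := μ) (σ := σ) (τ := τ) (j :: k :: ι) (j := 1) (by simp),
    eval_vE hn x (δ := δ) (μ := μ) (σ := σ) (τ := τ),
    eval_kinkMomentE hn x (δ := δ) (μ := μ) (σ := σ) (τ := τ) ι k j _ (fun i => (D.z i - D.z k) ^ 2)]
  · simp [Reduced.kinkA, Reduced.kinkMoment₂, sq, hD]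
  · intro i
    rw [eval_mul, eval_sub, hz i 0 (by simp), hz i 2 (by simp)]
    simp [sq, hD]

theorem eval_kinkRE (k j : ℕ) : kinkRE.eval n (array x) ρ (j :: k :: ι) =
    (reduced x δ μ σ τ hn).kinkR k j := by
  set D := reduced x δ μ σ τ hn with hD
  have hz := fun i l : ℕ => @eval_zE n hn x δ μ σ τ ρ (i :: j :: k :: ι) l
  rw [kinkRE, eval_sub, eval_sub, eval_zero,
    eval_zE hn x (δ := δ) (μ := μ) (σ := σ) (τ := τ) (j :: k :: ι) (j := 1) (by simp),
    eval_kinkMomentE hn x (δ := δ) (μ := μ) (σ := σ) (τ := τ) ι k j _ (fun i => D.z i - D.z k)]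
  · simp [Reduced.kinkR, Reduced.kinkMoment₁, hD]
  · intro i
    rw [eval_sub, hz i 0 (by simp), hz i 2 (by simp)]
    simp [hD]

theorem eval_kinkBE (hρ : Inputs δ μ σ τ ξ ρ) (k j : ℕ) :
    kinkBE.eval n (array x) ρ (j :: k :: ι) = (reduced x δ μ σ τ hn).kinkB k := by
  rw [kinkBE, eval_sub, eval_div, eval_mul, eval_two, eval_κE hn x _ hρ, eval_θE hn x _ hρ,
    eval_zE hn x (δ := δ) (μ := μ) (σ := σ) (τ := τ) (j :: k :: ι) (j := 1) (by simp)]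
  simp [Reduced.kinkB]

theorem eval_kinkCE (hρ : Inputs δ μ σ τ ξ ρ) :
    kinkCE.eval n (array x) ρ ι = (reduced x δ μ σ τ hn).kinkC := by
  rw [kinkCE, eval_add, eval_mul, eval_θE hn x _ hρ, eval_qE hn x _ hρ, Reduced.kinkC, sq]

theorem eval_rangeMomentE_zero (k j : ℕ) :
    (rangeMomentE 1).eval n (array x) ρ (k :: j :: ι) =
      (reduced x δ μ σ τ hn).rangeMoment 0 j k :=
  eval_rangeMomentE hn x ι k j 0 1 fun i => by simp

theorem eval_rangeMomentE_one (k j : ℕ) :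
    (rangeMomentE (zE 0)).eval n (array x) ρ (k :: j :: ι) =
      (reduced x δ μ σ τ hn).rangeMoment 1 j k :=
  eval_rangeMomentE hn x ι k j 1 _ fun i => by
    rw [eval_zE hn x (δ := δ) (μ := μ) (σ := σ) (τ := τ) (i :: k :: j :: ι) (j := 0) (by simp)]
    simp

theorem eval_rangeMomentE_two (k j : ℕ) :
    (rangeMomentE (zE 0 * zE 0)).eval n (array x) ρ (k :: j :: ι) =
      (reduced x δ μ σ τ hn).rangeMoment 2 j k :=
  eval_rangeMomentE hn x ι k j 2 _ fun i => by
    rw [eval_mul,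
      eval_zE hn x (δ := δ) (μ := μ) (σ := σ) (τ := τ) (i :: k :: j :: ι) (j := 0) (by simp)]
    simp [sq]

theorem eval_smoothDetE (k j : ℕ) : smoothDetE.eval n (array x) ρ (k :: j :: ι) =
    (reduced x δ μ σ τ hn).smoothDet j k := by
  simp only [smoothDetE, eval_sub, eval_mul, eval_one,
    eval_rangeMomentE_zero hn x (δ := δ) (μ := μ) (σ := σ) (τ := τ),
    eval_rangeMomentE_one hn x (δ := δ) (μ := μ) (σ := σ) (τ := τ),
    eval_rangeMomentE_two hn x (δ := δ) (μ := μ) (σ := σ) (τ := τ),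
    eval_vE hn x (δ := δ) (μ := μ) (σ := σ) (τ := τ), Reduced.smoothDet]

theorem eval_rayE (hρ : Inputs δ μ σ τ ξ ρ) : rayE.eval n (array x) ρ ι =
    ∑ i ∈ Finset.range (reduced x δ μ σ τ hn).n,
      (if 0 < (reduced x δ μ σ τ hn).h (reduced x δ μ σ τ hn).dir i then
        1 / (reduced x δ μ σ τ hn).h (reduced x δ μ σ τ hn).dir i else 0) := by
  simp only [rayE, eval_sum]
  refine Finset.sum_congr rfl fun i _ => ?_
  have hz := eval_zE hn x (δ := δ) (μ := μ) (σ := σ) (τ := τ) (ρ := ρ) (i :: ι) (j := 0) (by simp)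
  simp only [eval_ite, eval_sub, eval_mul, eval_div, eval_sqrt, eval_zero, eval_one, hz,
    eval_θE hn x _ hρ, eval_qE hn x _ hρ, eval_vE hn x (δ := δ) (μ := μ) (σ := σ) (τ := τ),
    Reduced.h, Reduced.dir, List.getD_cons_zero, sub_zero]

end eval

/-! ### Programs which improve a feasible point -/

/-- Replace the best point found so far, in the variables `6`, `7`, `8` and with value in the
variable `5`, if the given point is better. The offset may refer to the slope and the scale through
the variables `10` and `12`. -/
def tryCand (a w s : RExpr) : Cmd :=
  .seq (.assign 10 a) (.seq (.assign 12 s) (.seq (.assign 11 w) (.seq (.assign 13 (phiE 10 11 12))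
    (.ite (var 13) (var 5) (.seq (.assign 5 (var 13)) (.seq (.assign 6 (var 10))
      (.seq (.assign 7 (var 11)) (.assign 8 (var 12))))) .skip))))

section improve

variable {n : ℕ} (hn : 0 < n) (x : Fin n → ℝ) (δ μ σ τ ξ : ℝ) (S : Set (ℝ × ℝ × ℝ))

/-- The variables hold the parameters and a feasible point together with its value. -/
structure Inv (ρ : Fin 64 → ℝ) : Prop where
  inputs : Inputs δ μ σ τ ξ ρ
  val : ρ 5 = (reduced x δ μ σ τ hn).phi (ρ 6, ρ 7, ρ 8)
  mem : (ρ 6, ρ 7, ρ 8) ∈ S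

/-- The command keeps the invariant, does not increase the value, and ends with a value not above
any element of `C`. -/
def Improves (c : Cmd) (ι : List ℕ) (C : Set ℝ) : Prop :=
  ∀ ρ, Inv hn x δ μ σ τ ξ S ρ → Inv hn x δ μ σ τ ξ S (c.run n (array x) ι ρ) ∧
    c.run n (array x) ι ρ 5 ≤ ρ 5 ∧ ∀ b ∈ C, c.run n (array x) ι ρ 5 ≤ b

variable {hn x δ μ σ τ ξ S}

theorem Improves.seq {c c' : Cmd} {ι : List ℕ} {C C' : Set ℝ}
    (h : Improves hn x δ μ σ τ ξ S c ι C) (h' : Improves hn x δ μ σ τ ξ S c' ι C') :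
    Improves hn x δ μ σ τ ξ S (.seq c c') ι (C ∪ C') := by
  intro ρ hρ
  obtain ⟨h1, h2, h3⟩ := h ρ hρ
  obtain ⟨h1', h2', h3'⟩ := h' _ h1
  refine ⟨h1', h2'.trans h2, ?_⟩
  rintro b (hb | hb)
  · exact h2'.trans (h3 b hb)
  · exact h3' b hb

theorem Improves.loop {c : Cmd} {ι : List ℕ} {C : ℕ → Set ℝ}
    (h : ∀ i < n, Improves hn x δ μ σ τ ξ S c (i :: ι) (C i)) :
    Improves hn x δ μ σ τ ξ S (.loop c) ι {b | ∃ i < n, b ∈ C i} := by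
  intro ρ hρ
  have key : ∀ k ≤ n,
      Inv hn x δ μ σ τ ξ S ((List.range k).foldl (fun ρ i => c.run n (array x) (i :: ι) ρ) ρ) ∧
      (List.range k).foldl (fun ρ i => c.run n (array x) (i :: ι) ρ) ρ 5 ≤ ρ 5 ∧
      ∀ i < k, ∀ b ∈ C i,
        (List.range k).foldl (fun ρ i => c.run n (array x) (i :: ι) ρ) ρ 5 ≤ b := by
    intro k
    induction k with
    | zero => exact fun _ => ⟨hρ, le_rfl, fun i hi => absurd hi (Nat.not_lt_zero i)⟩
    | succ k ih =>
      intro hk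
      obtain ⟨i1, i2, i3⟩ := ih (by omega)
      obtain ⟨j1, j2, j3⟩ := h k (by omega) _ i1
      simp only [List.range_succ, List.foldl_append, List.foldl_cons, List.foldl_nil]
      refine ⟨j1, j2.trans i2, fun i hi b hb => ?_⟩
      rcases Nat.lt_succ_iff_lt_or_eq.1 hi with hi | rfl
      · exact j2.trans (i3 i hi b hb)
      · exact j3 b hb
  obtain ⟨k1, k2, k3⟩ := key n le_rfl
  exact ⟨k1, k2, fun b ⟨i, hi, hb⟩ => k3 i hi b hb⟩

/-- Only the variables `5`–`8` and `10`–`13` are written, so the parameters survive. The hypotheses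
quantify over all `ρ` because earlier assignments have already changed the scratch variables. -/
theorem improves_tryCand {a w s : RExpr} {ι : List ℕ} {p : ℝ × ℝ × ℝ} (hp : p ∈ S)
    (ha : ∀ ρ, Inputs δ μ σ τ ξ ρ → a.eval n (array x) ρ ι = p.1)
    (hs : ∀ ρ, Inputs δ μ σ τ ξ ρ → s.eval n (array x) ρ ι = p.2.2)
    (hw : ∀ ρ, Inputs δ μ σ τ ξ ρ → ρ 10 = p.1 → ρ 12 = p.2.2 →
      w.eval n (array x) ρ ι = p.2.1) :
    Improves hn x δ μ σ τ ξ S (tryCand a w s) ι {(reduced x δ μ σ τ hn).phi p} := by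
  intro ρ hρ
  set ρ₁ := Function.update ρ 10 p.1 with h₁
  set ρ₂ := Function.update ρ₁ 12 p.2.2 with h₂
  set ρ₃ := Function.update ρ₂ 11 p.2.1 with h₃
  set v := (reduced x δ μ σ τ hn).phi p with hv
  set ρ₄ := Function.update ρ₃ 13 v with h₄
  have i0 := hρ.inputs
  have i1 : Inputs δ μ σ τ ξ ρ₁ := ⟨i0.h0, i0.h1, i0.h2, i0.h3, i0.h4⟩
  have i2 : Inputs δ μ σ τ ξ ρ₂ := ⟨i0.h0, i0.h1, i0.h2, i0.h3, i0.h4⟩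
  have i3 : Inputs δ μ σ τ ξ ρ₃ := ⟨i0.h0, i0.h1, i0.h2, i0.h3, i0.h4⟩
  have e3 : (phiE 10 11 12).eval n (array x) ρ₃ ι = v := by
    rw [eval_phiE hn x ι i3]
    simp [h₃, h₂, h₁, hv]
  have hrun : (tryCand a w s).run n (array x) ι ρ = open Classical in
      if ρ₄ 13 < ρ₄ 5 then
        Function.update (Function.update (Function.update (Function.update ρ₄ 5 v) 6 p.1) 7 p.2.1)
          8 p.2.2
      else ρ₄ := by
    simp only [tryCand, Cmd.run, ha ρ i0, ← h₁, hs ρ₁ i1, ← h₂,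
      hw ρ₂ i2 (by simp [h₂, h₁]) (by simp [h₂]), ← h₃, e3, ← h₄, eval_var]
    refine if_congr Iff.rfl ?_ rfl
    simp [h₄, h₃, h₂, h₁]
  have e5 : ρ₄ 5 = ρ 5 := by simp [h₄, h₃, h₂, h₁]
  have e13 : ρ₄ 13 = v := by simp [h₄]
  rw [hrun, e5, e13]
  split_ifs with hlt
  · refine ⟨⟨⟨i0.h0, i0.h1, i0.h2, i0.h3, i0.h4⟩, ?_, ?_⟩, ?_, ?_⟩
    · simp [hv]
    · simpa using hp
    · simpa using hlt.le
    · simp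
  · refine ⟨⟨⟨i0.h0, i0.h1, i0.h2, i0.h3, i0.h4⟩, hρ.val, hρ.mem⟩, le_rfl, ?_⟩
    rintro b rfl
    rw [e5]
    exact not_lt.1 hlt

end improve

end UZPM

/-! ### Search commands and their correctness -/

namespace UZPM

open RealRAM RExpr
open RealRAM.Cmd (array)

/-- Try the stationary point on a kink, for all kinks and all sets of intermediate indices. -/
def jointSearch : Cmd :=
  .loop (.loop (tryCand
    (RExpr.max 0 ((kinkRE * kinkCE - kinkBE * θE) / (kinkAE * kinkCE - kinkBE * kinkBE)))
    (θE * var 12 - var 10 * zE 1 - 1)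
    (RExpr.max 0 ((kinkAE * θE - kinkBE * kinkRE) / (kinkAE * kinkCE - kinkBE * kinkBE)))))

/-- The same for the scale `√ξ`. -/
def kinkSearch : Cmd :=
  .loop (.loop (tryCand
    (RExpr.max 0 ((kinkRE - kinkBE * sqrt (var 4)) / kinkAE))
    (θE * var 12 - var 10 * zE 1 - 1)
    (RExpr.max 0 (sqrt (var 4)))))

/-- Try the stationary point away from the kinks, for all sets of intermediate indices. -/
def smoothSearch : Cmd :=
  .loop (.loop (tryCand
    (RExpr.max 0 (((0 - κE * sqrt (var 4) / 2 - θE * sqrt (var 4) * rangeMomentE (zE 0)) *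
        (1 - rangeMomentE 1) -
      rangeMomentE (zE 0) * (θE * sqrt (var 4) * rangeMomentE 1)) / smoothDetE))
    (((vE - rangeMomentE (zE 0 * zE 0)) * (0 - θE * sqrt (var 4) * rangeMomentE 1) +
      rangeMomentE (zE 0) *
        (0 - κE * sqrt (var 4) / 2 - θE * sqrt (var 4) * rangeMomentE (zE 0))) / smoothDetE)
    (sqrt (var 4))))

/-- Start with the point of slope and offset `0` and scale `s`. -/
def initCmd (s : RExpr) : Cmd :=
  .seq (.assign 6 0) (.seq (.assign 7 0) (.seq (.assign 8 s) (.assign 5 (phiE 6 7 8))))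

/-- Minimize over the slice `s = √ξ`. -/
def sliceSearch : Cmd :=
  .seq (tryCand 0 (θE * var 12 - 1) (sqrt (var 4))) (.seq kinkSearch smoothSearch)

/-- Minimize over the cone. -/
def coneSearch : Cmd :=
  .seq (tryCand 0 ((0 - qE) / (qE + θE * θE)) (RExpr.max 0 (θE / (qE + θE * θE))))
    (.seq (tryCand (sqrt qE * rayE) 0 (sqrt vE * rayE)) jointSearch)

section search

variable {n : ℕ} (hn : 0 < n) (x : Fin n → ℝ) (δ μ σ τ ξ : ℝ)

/-- Truncation at `0` makes every candidate feasible, even one computed from a singular system with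
a division by zero. Trying spurious candidates is thus harmless. -/
theorem kinkPoint_mem_cone (D : Reduced) (k : ℕ) (α s : ℝ) : D.kinkPoint k α s ∈ Reduced.cone :=
  ⟨le_max_left _ _, le_max_left _ _⟩

theorem improves_jointSearch : Improves hn x δ μ σ τ ξ Reduced.cone jointSearch []
    {b | ∃ k < n, b ∈ {b | ∃ j < n, b ∈ ({(reduced x δ μ σ τ hn).phi
      ((reduced x δ μ σ τ hn).jointCand k j)} : Set ℝ)}} := by
  refine Improves.loop fun k _ => Improves.loop fun j _ =>
    improves_tryCand (kinkPoint_mem_cone _ _ _ _) ?_ ?_ ?_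
  · intro ρ hρ
    simp only [eval_max, eval_zero, eval_div, eval_sub, eval_mul, eval_kinkBE hn x [] hρ,
      eval_kinkCE hn x _ hρ, eval_θE hn x _ hρ,
      eval_kinkAE hn x (δ := δ) (μ := μ) (σ := σ) (τ := τ),
      eval_kinkRE hn x (δ := δ) (μ := μ) (σ := σ) (τ := τ)]
    rfl
  · intro ρ hρ
    simp only [eval_max, eval_zero, eval_div, eval_sub, eval_mul, eval_kinkBE hn x [] hρ,
      eval_kinkCE hn x _ hρ, eval_θE hn x _ hρ,
      eval_kinkAE hn x (δ := δ) (μ := μ) (σ := σ) (τ := τ),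
      eval_kinkRE hn x (δ := δ) (μ := μ) (σ := σ) (τ := τ)]
    rfl
  · intro ρ hρ h10 h12
    rw [eval_sub, eval_sub, eval_mul, eval_mul, eval_one, eval_var, eval_var, h10, h12,
      eval_θE hn x _ hρ,
      eval_zE hn x (δ := δ) (μ := μ) (σ := σ) (τ := τ) [j, k] (j := 1) (by simp)]
    rfl

variable {ξ}

theorem improves_kinkSearch : Improves hn x δ μ σ τ ξ (Reduced.slice √ξ) kinkSearch []
    {b | ∃ k < n, b ∈ {b | ∃ j < n, b ∈ ({(reduced x δ μ σ τ hn).phi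
      ((reduced x δ μ σ τ hn).kinkCand √ξ k j)} : Set ℝ)}} := by
  refine Improves.loop fun k _ => Improves.loop fun j _ => improves_tryCand
    ⟨le_max_left _ _, max_eq_right (Real.sqrt_nonneg ξ)⟩ ?_ ?_ ?_
  · intro ρ hρ
    simp only [eval_max, eval_zero, eval_div, eval_sub, eval_mul, eval_kinkBE hn x [] hρ,
      eval_kinkAE hn x (δ := δ) (μ := μ) (σ := σ) (τ := τ), eval_sqrt, eval_var, hρ.h4,
      eval_kinkRE hn x (δ := δ) (μ := μ) (σ := σ) (τ := τ), Reduced.kinkPoint, Reduced.kinkCand]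
  · intro ρ hρ
    simp only [eval_max, eval_zero, eval_sqrt, eval_var, hρ.h4, Reduced.kinkPoint, Reduced.kinkCand]
  · intro ρ hρ h10 h12
    rw [eval_sub, eval_sub, eval_mul, eval_mul, eval_one, eval_var, eval_var, h10, h12,
      eval_θE hn x _ hρ,
      eval_zE hn x (δ := δ) (μ := μ) (σ := σ) (τ := τ) [j, k] (j := 1) (by simp)]
    rfl

theorem improves_smoothSearch : Improves hn x δ μ σ τ ξ (Reduced.slice √ξ) smoothSearch []
    {b | ∃ j < n, b ∈ {b | ∃ k < n, b ∈ ({(reduced x δ μ σ τ hn).phi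
      ((reduced x δ μ σ τ hn).smoothCand √ξ j k)} : Set ℝ)}} := by
  refine Improves.loop fun k _ => Improves.loop fun j _ => improves_tryCand
    ⟨le_max_left _ _, rfl⟩ ?_ ?_ ?_
  · intro ρ hρ
    simp only [eval_max, eval_zero, eval_one, eval_two, eval_div, eval_sub, eval_mul,
      eval_sqrt, eval_var, hρ.h4, eval_θE hn x _ hρ, eval_κE hn x _ hρ,
      eval_rangeMomentE_zero hn x (δ := δ) (μ := μ) (σ := σ) (τ := τ),
      eval_rangeMomentE_one hn x (δ := δ) (μ := μ) (σ := σ) (τ := τ),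
      eval_smoothDetE hn x (δ := δ) (μ := μ) (σ := σ) (τ := τ), Reduced.smoothCand, zero_sub,
      neg_mul, neg_div]
  · intro ρ hρ
    simp only [eval_sqrt, eval_var, hρ.h4, Reduced.smoothCand]
  · intro ρ hρ _ _
    simp only [eval_zero, eval_two, eval_div, eval_sub, eval_add, eval_mul,
      eval_sqrt, eval_var, hρ.h4, eval_θE hn x _ hρ, eval_κE hn x _ hρ,
      eval_rangeMomentE_zero hn x (δ := δ) (μ := μ) (σ := σ) (τ := τ),
      eval_rangeMomentE_one hn x (δ := δ) (μ := μ) (σ := σ) (τ := τ),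
      eval_rangeMomentE_two hn x (δ := δ) (μ := μ) (σ := σ) (τ := τ),
      eval_vE hn x (δ := δ) (μ := μ) (σ := σ) (τ := τ),
      eval_smoothDetE hn x (δ := δ) (μ := μ) (σ := σ) (τ := τ), Reduced.smoothCand, zero_sub,
      neg_mul, neg_div]

theorem inv_initCmd {S : Set (ℝ × ℝ × ℝ)} {s : ℝ} {e : RExpr} (hs : (0, 0, s) ∈ S)
    (he : ∀ ρ, Inputs δ μ σ τ ξ ρ → e.eval n (array x) ρ [] = s) {ρ : Fin 64 → ℝ}
    (hρ : Inputs δ μ σ τ ξ ρ) :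
    Inv hn x δ μ σ τ ξ S ((initCmd e).run n (array x) [] ρ) ∧
      (initCmd e).run n (array x) [] ρ 5 = (reduced x δ μ σ τ hn).phi (0, 0, s) := by
  set ρ₁ := Function.update ρ 6 0 with h₁
  set ρ₂ := Function.update ρ₁ 7 0 with h₂
  set ρ₃ := Function.update ρ₂ 8 s with h₃
  have i2 : Inputs δ μ σ τ ξ ρ₂ := ⟨hρ.h0, hρ.h1, hρ.h2, hρ.h3, hρ.h4⟩
  have i3 : Inputs δ μ σ τ ξ ρ₃ := ⟨hρ.h0, hρ.h1, hρ.h2, hρ.h3, hρ.h4⟩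
  have hp : (ρ₃ 6, ρ₃ 7, ρ₃ 8) = (0, 0, s) := by simp [h₃, h₂, h₁]
  have hrun : (initCmd e).run n (array x) [] ρ =
      Function.update ρ₃ 5 ((reduced x δ μ σ τ hn).phi (0, 0, s)) := by
    simp only [initCmd, Cmd.run, eval_zero, ← h₁, ← h₂, he ρ₂ i2, ← h₃, eval_phiE hn x [] i3, hp]
  rw [hrun]
  have hp' : ((Function.update ρ₃ 5 ((reduced x δ μ σ τ hn).phi (0, 0, s)) : Fin 64 → ℝ) 6,
      (Function.update ρ₃ 5 ((reduced x δ μ σ τ hn).phi (0, 0, s)) : Fin 64 → ℝ) 7,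
      (Function.update ρ₃ 5 ((reduced x δ μ σ τ hn).phi (0, 0, s)) : Fin 64 → ℝ) 8) =
      (0, 0, s) := by simp [h₃, h₂, h₁]
  refine ⟨⟨⟨hρ.h0, hρ.h1, hρ.h2, hρ.h3, hρ.h4⟩, ?_, ?_⟩, by simp⟩
  · rw [hp']; simp
  · rw [hp']; exact hs

theorem sliceSearch_spec {ρ : Fin 64 → ℝ} (hρ : Inputs δ μ σ τ ξ ρ) :
    Inv hn x δ μ σ τ ξ (Reduced.slice √ξ)
      ((Cmd.seq (initCmd (sqrt (var 4))) sliceSearch).run n (array x) [] ρ) ∧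
    (((reduced x δ μ σ τ hn).v = 0 → 0 ≤ (reduced x δ μ σ τ hn).κ) → ∀ p ∈ Reduced.slice √ξ,
      (Cmd.seq (initCmd (sqrt (var 4))) sliceSearch).run n (array x) [] ρ 5 ≤
        (reduced x δ μ σ τ hn).phi p) := by
  obtain ⟨hinv, hval⟩ := inv_initCmd hn x δ μ σ τ (ξ := ξ) (S := Reduced.slice √ξ) (s := √ξ)
    (e := sqrt (var 4)) ⟨le_rfl, rfl⟩ (fun ρ hρ => by simp [hρ.h4]) hρ
  have htry : Improves hn x δ μ σ τ ξ (Reduced.slice √ξ)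
      (tryCand 0 (θE * var 12 - 1) (sqrt (var 4))) []
      {(reduced x δ μ σ τ hn).phi (0, (reduced x δ μ σ τ hn).θ * √ξ - 1, √ξ)} :=
    improves_tryCand ⟨le_rfl, rfl⟩ (fun ρ _ => by simp) (fun ρ hρ => by simp [hρ.h4])
      (fun ρ hρ _ h12 => by simp [eval_θE hn x _ hρ, h12])
  obtain ⟨h1, h2, h3⟩ := (htry.seq ((improves_kinkSearch hn x δ μ σ τ).seq
    (improves_smoothSearch hn x δ μ σ τ))) _ hinv
  refine ⟨h1, fun hκ p hp => ?_⟩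
  refine (reduced x δ μ σ τ hn).le_phi_of_le_candidates_slice (Real.sqrt_nonneg ξ) hκ
    (h2.trans_eq hval) (h3 _ (Or.inl rfl)) (fun k hk j hj => ?_) (fun j hj k hk => ?_) hp
  · exact h3 _ (Or.inr (Or.inl ⟨k, hk, j, hj, rfl⟩))
  · exact h3 _ (Or.inr (Or.inr ⟨j, hj, k, hk, rfl⟩))

theorem coneSearch_spec {ρ : Fin 64 → ℝ} (hρ : Inputs δ μ σ τ ξ ρ) :
    Inv hn x δ μ σ τ ξ Reduced.cone
      ((Cmd.seq (initCmd 0) coneSearch).run n (array x) [] ρ) ∧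
    (Cmd.seq (initCmd 0) coneSearch).run n (array x) [] ρ 5 ≤ 1 ∧
    (-(2 * √((reduced x δ μ σ τ hn).q * (reduced x δ μ σ τ hn).v)) ≤
      (reduced x δ μ σ τ hn).κ → ∀ p ∈ Reduced.cone,
      (Cmd.seq (initCmd 0) coneSearch).run n (array x) [] ρ 5 ≤
        (reduced x δ μ σ τ hn).phi p) := by
  set D := reduced x δ μ σ τ hn with hD
  obtain ⟨hinv, hval⟩ := inv_initCmd hn x δ μ σ τ (ξ := ξ) (S := Reduced.cone) (s := 0)
    (e := 0) ⟨le_rfl, le_rfl⟩ (fun ρ hρ => by simp) hρ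
  have hc : Improves hn x δ μ σ τ ξ Reduced.cone
      (tryCand 0 ((0 - qE) / (qE + θE * θE)) (RExpr.max 0 (θE / (qE + θE * θE)))) []
      {D.phi D.cantelli} :=
    improves_tryCand ⟨le_rfl, le_max_left _ _⟩ (fun ρ _ => by simp [Reduced.cantelli])
      (fun ρ hρ => by
        simp [eval_θE hn x _ hρ, eval_qE hn x _ hρ, Reduced.cantelli, hD, sq])
      (fun ρ hρ _ _ => by
        simp [eval_θE hn x _ hρ, eval_qE hn x _ hρ, Reduced.cantelli, hD, sq])
  have hray : D.ray ∈ Reduced.cone := by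
    have : 0 ≤ ∑ i ∈ Finset.range D.n, (if 0 < D.h D.dir i then 1 / D.h D.dir i else 0) :=
      Finset.sum_nonneg fun i _ => by split_ifs <;> positivity
    exact ⟨mul_nonneg (Real.sqrt_nonneg _) this, mul_nonneg (Real.sqrt_nonneg _) this⟩
  have hr : Improves hn x δ μ σ τ ξ Reduced.cone
      (tryCand (sqrt qE * rayE) 0 (sqrt vE * rayE)) [] {D.phi D.ray} :=
    improves_tryCand hray
      (fun ρ hρ => by
        simp only [eval_mul, eval_sqrt, eval_qE hn x _ hρ, eval_rayE hn x _ hρ, Reduced.ray, hD])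
      (fun ρ hρ => by
        simp only [eval_mul, eval_sqrt, eval_vE hn x (δ := δ) (μ := μ) (σ := σ) (τ := τ),
          eval_rayE hn x _ hρ, Reduced.ray, hD])
      (fun ρ hρ _ _ => by simp [Reduced.ray])
  obtain ⟨h1, h2, h3⟩ := (hc.seq (hr.seq (improves_jointSearch hn x δ μ σ τ ξ))) _ hinv
  -- The search starts at the origin, where `phi` is `1`.
  have hone : (Cmd.seq (initCmd 0) coneSearch).run n (array x) [] ρ 5 ≤ 1 :=
    (h2.trans_eq hval).trans_eq D.phi_zero
  refine ⟨h1, hone, fun hκ p hp => ?_⟩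
  refine D.le_phi_of_le_candidates hκ hone (h3 _ (Or.inl rfl)) (h3 _ (Or.inr (Or.inl rfl)))
    (fun k hk j hj => ?_) hp
  exact h3 _ (Or.inr (Or.inr ⟨k, hk, j, hj, rfl⟩))

end search

/-! ### The complete programs -/

/-- Evaluate `f ξ`. -/
def innerCmd : Cmd :=
  .seq (.seq (initCmd (sqrt (var 4))) sliceSearch)
    -- The final test compares variable `20` with `21`; it reports failure exactly when `v = 0` and
    -- `κ < 0`.
    (.seq (.assign 20 (ite 0 vE 0 κE)) (.seq (.assign 21 0) (.assign 0 (var 5))))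

/-- Solve the dual problem. -/
def dualCmd : Cmd :=
  .seq (.seq (initCmd 0) coneSearch)
    (.seq (.assign 20 κE) (.seq (.assign 21 (0 - 2 * sqrt (qE * vE)))
      -- `λ₂` depends on `μ`, so it is set aside before the outputs overwrite the parameters.
      (.seq (.assign 31 (0 - 2 * var 8 * (var 7 + var 8 * var 1 - var 6 * meanE)))
        (.seq (.assign 0 (var 5)) (.seq (.assign 1 (var 6 * var 8))
          (.seq (.assign 2 (var 31)) (.assign 3 (var 8 * var 8 - var 6 * var 8))))))))

theorem exists_program_innerValue : ∃ (prog : Prog) (P : Polynomial ℕ),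
    ∀ (n : ℕ) (x : Fin n → ℝ) (δ μ σ τ ξ : ℝ), 0 < n → 0 < ξ →
      ∃ (s : State) (t : ℕ),
        Exec prog (input x [δ, μ, σ, τ, ξ]) s t ∧ t ≤ P.eval n ∧
        ((s.idx 0 = 0 ∧ innerValue x δ μ σ τ ξ = ⊥) ∨
         (s.idx 0 = 1 ∧ innerValue x δ μ σ τ ξ = (s.reg 0 : EReal))) := by
  classical
  refine ⟨innerCmd.program 20 21, innerCmd.time + 3, fun n x δ μ σ τ ξ hn hξ => ?_⟩
  obtain ⟨s, t, hx, ht, hreg, hidx⟩ := innerCmd.exec_program 20 21 x [δ, μ, σ, τ, ξ] rfl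
  refine ⟨s, t, hx, ht, ?_⟩
  set D := reduced x δ μ σ τ hn with hD
  set ρ : Fin 64 → ℝ := fun r => [δ, μ, σ, τ, ξ].getD r 0 with hρ
  obtain ⟨hinv, hopt⟩ := sliceSearch_spec hn x δ μ σ τ (ξ := ξ) (ρ := ρ) ⟨rfl, rfl, rfl, rfl, rfl⟩
  set ρ₁ := (Cmd.seq (initCmd (sqrt (var 4))) sliceSearch).run n (array x) [] ρ with h₁
  have hrun : innerCmd.run n (array x) [] ρ = Function.update (Function.update
      (Function.update ρ₁ 20 (if 0 < D.v then 0 else D.κ)) 21 0) 0 (ρ₁ 5) := by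
    rw [innerCmd, Cmd.run, ← h₁]
    simp only [Cmd.run, eval_ite, eval_zero, eval_var,
      eval_vE hn x (δ := δ) (μ := μ) (σ := σ) (τ := τ), eval_κE hn x _ hinv.inputs, ← hD]
    simp
  have hs : 0 < √ξ := Real.sqrt_pos.2 hξ
  have hsq : √ξ ^ 2 = ξ := Real.sq_sqrt hξ.le
  have hval : s.reg 0 = ρ₁ 5 := by
    have := hreg 0
    rw [hrun] at this
    simpa using this
  rw [hrun] at hidx
  simp only [Function.update_self, Function.update_of_ne (show (20 : Fin 64) ≠ 0 by decide),
    Function.update_of_ne (show (20 : Fin 64) ≠ 21 by decide),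
    Function.update_of_ne (show (21 : Fin 64) ≠ 0 by decide)] at hidx
  by_cases hbad : (if 0 < D.v then 0 else D.κ) < 0
  · left
    rw [if_pos hbad] at hidx
    refine ⟨hidx, ?_⟩
    have hv : ¬ 0 < D.v := fun h => by simp [h] at hbad
    rw [if_neg hv] at hbad
    have h := innerValue_eq_bot x δ μ σ τ hn hs
      (D.exists_phi_lt_slice hs (le_antisymm (not_lt.1 hv) D.v_nonneg) hbad)
    rwa [hsq] at h
  · right
    rw [if_neg hbad] at hidx
    refine ⟨hidx, ?_⟩
    have hmin := hopt fun hv => by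
      have hv' : D.v = 0 := hv
      simpa [hv'] using hbad
    rw [hinv.val] at hmin
    have h := innerValue_eq x δ μ σ τ hn hs hinv.mem hmin
    rw [hsq] at h
    rw [hval, h, hinv.val]

theorem exists_program_dualValue : ∃ (prog : Prog) (P : Polynomial ℕ),
    ∀ (n : ℕ) (x : Fin n → ℝ) (δ μ σ τ : ℝ), 0 < n →
      ∃ (s : State) (t : ℕ),
        Exec prog (input x [δ, μ, σ, τ]) s t ∧ t ≤ P.eval n ∧
        ((s.idx 0 = 0 ∧ dualValue x δ μ σ τ = ⊥) ∨
         (s.idx 0 = 1 ∧ dualValue x δ μ σ τ = (s.reg 0 : EReal) ∧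
          0 ≤ s.reg 1 ∧
          F x δ μ σ τ (s.reg 1) (s.reg 2) (s.reg 3) = (s.reg 0 : EReal))) := by
  classical
  refine ⟨dualCmd.program 20 21, dualCmd.time + 3, fun n x δ μ σ τ hn => ?_⟩
  obtain ⟨s, t, hx, ht, hreg, hidx⟩ := dualCmd.exec_program 20 21 x [δ, μ, σ, τ] rfl
  refine ⟨s, t, hx, ht, ?_⟩
  set D := reduced x δ μ σ τ hn with hD
  set ρ : Fin 64 → ℝ := fun r => [δ, μ, σ, τ].getD r 0 with hρ
  -- There are only four parameters; variable `4` holds the default value `0`, which plays the role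
  -- of `ξ`.
  obtain ⟨hinv, hone, hopt⟩ :=
    coneSearch_spec hn x δ μ σ τ (ξ := 0) (ρ := ρ) ⟨rfl, rfl, rfl, rfl, rfl⟩
  set ρ₁ := (Cmd.seq (initCmd 0) coneSearch).run n (array x) [] ρ with h₁
  set b := -(2 * √(D.q * D.v)) with hb
  set l₂ := -2 * ρ₁ 8 * (ρ₁ 7 + ρ₁ 8 * μ - ρ₁ 6 * mean x) with hl₂
  have hrun : dualCmd.run n (array x) [] ρ = Function.update (Function.update (Function.update
      (Function.update (Function.update (Function.update (Function.update ρ₁ 20 D.κ) 21 b) 31 l₂)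
        0 (ρ₁ 5)) 1 (ρ₁ 6 * ρ₁ 8)) 2 l₂) 3 (ρ₁ 8 ^ 2 - ρ₁ 6 * ρ₁ 8) := by
    have i1 : Inputs δ μ σ τ 0 (Function.update ρ₁ 20 D.κ) :=
      ⟨hinv.inputs.h0, hinv.inputs.h1, hinv.inputs.h2, hinv.inputs.h3, hinv.inputs.h4⟩
    rw [dualCmd, Cmd.run, ← h₁]
    simp only [Cmd.run, eval_zero, eval_two, eval_var, eval_sub, eval_add, eval_mul, eval_sqrt,
      eval_vE hn x (δ := δ) (μ := μ) (σ := σ) (τ := τ), eval_κE hn x _ hinv.inputs, ← hD,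
      eval_qE hn x _ i1, eval_meanE, zero_sub, ← hb]
    simp [hinv.inputs.h1, hl₂, sq]
  have hval : s.reg 0 = ρ₁ 5 := by
    have := hreg 0
    rw [hrun] at this
    simpa using this
  have hr1 : s.reg 1 = ρ₁ 6 * ρ₁ 8 := by
    have := hreg 1
    rw [hrun] at this
    simpa using this
  have hr2 : s.reg 2 = l₂ := by
    have := hreg 2
    rw [hrun] at this
    simpa using this
  have hr3 : s.reg 3 = ρ₁ 8 ^ 2 - ρ₁ 6 * ρ₁ 8 := by
    have := hreg 3
    rw [hrun] at this
    simpa using this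
  rw [hrun] at hidx
  have h20 : (Function.update (Function.update (Function.update
      (Function.update (Function.update (Function.update (Function.update ρ₁ 20 D.κ) 21 b) 31 l₂)
        0 (ρ₁ 5)) 1 (ρ₁ 6 * ρ₁ 8)) 2 l₂) 3 (ρ₁ 8 ^ 2 - ρ₁ 6 * ρ₁ 8) : Fin 64 → ℝ) 20 = D.κ := by
    simp
  have h21 : (Function.update (Function.update (Function.update
      (Function.update (Function.update (Function.update (Function.update ρ₁ 20 D.κ) 21 b) 31 l₂)
        0 (ρ₁ 5)) 1 (ρ₁ 6 * ρ₁ 8)) 2 l₂) 3 (ρ₁ 8 ^ 2 - ρ₁ 6 * ρ₁ 8) : Fin 64 → ℝ) 21 = b := by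
    simp
  rw [h20, h21] at hidx
  by_cases hbad : D.κ < b
  · left
    rw [if_pos hbad] at hidx
    exact ⟨hidx, dualValue_eq_bot x δ μ σ τ hn (D.exists_phi_lt hbad)⟩
  · right
    rw [if_neg hbad] at hidx
    have hmin := hopt (not_lt.1 hbad)
    have hα : 0 ≤ ρ₁ 6 := hinv.mem.1
    have hs : 0 ≤ ρ₁ 8 := hinv.mem.2
    have hF : F x δ μ σ τ (ρ₁ 6 * ρ₁ 8) l₂ (ρ₁ 8 ^ 2 - ρ₁ 6 * ρ₁ 8) = (ρ₁ 5 : EReal) := by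
      -- At scale zero the returned multipliers are all `0`. There `phi ≥ 1`, and the value found is
      -- at most `1`, so it equals `F` at the origin.
      rcases hs.eq_or_lt with h0 | hpos
      · have h1 : 1 ≤ ρ₁ 5 := by
          rw [hinv.val]
          exact D.one_le_phi_of_scale_eq_zero h0.symm
        rw [le_antisymm hone h1, ← F_zero x δ μ σ τ hn]
        simp [hl₂, ← h0]
      · rw [hinv.val, hl₂]
        exact F_eq_phi x δ μ σ τ hn _ _ hpos
    have hdual : dualValue x δ μ σ τ = (ρ₁ 5 : EReal) := by
      refine le_antisymm ?_ (coe_le_dualValue x δ μ σ τ hn hmin)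
      rw [← hF]
      exact dualValue_le x δ μ σ τ (mul_nonneg hα hs) _ _
    refine ⟨hidx, ?_, ?_, ?_⟩
    · rw [hval, hdual]
    · rw [hr1]; exact mul_nonneg hα hs
    · rw [hr1, hr2, hr3, hval, hF]

end UZPM

theorem proposition2p3 :
    -- the explicit formula for `Ψ_i`, where `ξ = λ₁ + λ₃`
    (∀ τ xi l₁ l₂ ξ : ℝ,
      (ξ < 0 → UZPM.Psi τ xi l₁ l₂ (ξ - l₁) = ⊤) ∧
      (ξ = 0 → 2 * l₁ * xi - l₂ ≠ 0 → UZPM.Psi τ xi l₁ l₂ (ξ - l₁) = ⊤) ∧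
      (ξ = 0 → 2 * l₁ * xi - l₂ = 0 →
        UZPM.Psi τ xi l₁ l₂ (ξ - l₁) = ((-l₁ * xi ^ 2 + 1 : ℝ) : EReal)) ∧
      (0 < ξ → τ ≤ (2 * l₁ * xi - l₂) / (2 * ξ) →
        UZPM.Psi τ xi l₁ l₂ (ξ - l₁) =
          ((-l₁ * xi ^ 2 + (1 + (2 * l₁ * xi - l₂) ^ 2 / (4 * ξ)) : ℝ) : EReal)) ∧
      (0 < ξ → (2 * l₁ * xi - l₂) / (2 * ξ) < τ →
        τ < (2 * l₁ * xi - l₂) / (2 * ξ) + 1 / Real.sqrt ξ →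
        UZPM.Psi τ xi l₁ l₂ (ξ - l₁) =
          ((-l₁ * xi ^ 2 + (1 - ξ * τ ^ 2 + (2 * l₁ * xi - l₂) * τ) : ℝ) : EReal)) ∧
      (0 < ξ → (2 * l₁ * xi - l₂) / (2 * ξ) + 1 / Real.sqrt ξ ≤ τ →
        UZPM.Psi τ xi l₁ l₂ (ξ - l₁) =
          ((-l₁ * xi ^ 2 + (2 * l₁ * xi - l₂) ^ 2 / (4 * ξ) : ℝ) : EReal))) ∧
    -- the dual problem is the minimization over `ξ > 0` of the convex function `f`
    (∀ (n : ℕ) (x : Fin n → ℝ) (δ μ σ τ : ℝ), 0 < n →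
      Convex ℝ {p : ℝ × ℝ | 0 < p.1 ∧ UZPM.innerValue x δ μ σ τ p.1 ≤ (p.2 : EReal)} ∧
      UZPM.dualValue x δ μ σ τ = ⨅ (ξ : ℝ) (_ : 0 < ξ), UZPM.innerValue x δ μ σ τ ξ) ∧
    -- `f(ξ)` is computed in polynomial time
    (∃ (prog : RealRAM.Prog) (P : Polynomial ℕ),
      ∀ (n : ℕ) (x : Fin n → ℝ) (δ μ σ τ ξ : ℝ), 0 < n → 0 < ξ →
        ∃ (s : RealRAM.State) (t : ℕ),
          RealRAM.Exec prog (RealRAM.input x [δ, μ, σ, τ, ξ]) s t ∧ t ≤ P.eval n ∧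
          ((s.idx 0 = 0 ∧ UZPM.innerValue x δ μ σ τ ξ = ⊥) ∨
           (s.idx 0 = 1 ∧ UZPM.innerValue x δ μ σ τ ξ = (s.reg 0 : EReal)))) ∧
    -- the solution of the dual problem is computed in polynomial time
    (∃ (prog : RealRAM.Prog) (P : Polynomial ℕ),
      ∀ (n : ℕ) (x : Fin n → ℝ) (δ μ σ τ : ℝ), 0 < n →
        ∃ (s : RealRAM.State) (t : ℕ),
          RealRAM.Exec prog (RealRAM.input x [δ, μ, σ, τ]) s t ∧ t ≤ P.eval n ∧
          ((s.idx 0 = 0 ∧ UZPM.dualValue x δ μ σ τ = ⊥) ∨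
           (s.idx 0 = 1 ∧ UZPM.dualValue x δ μ σ τ = (s.reg 0 : EReal) ∧
            0 ≤ s.reg 1 ∧
            UZPM.F x δ μ σ τ (s.reg 1) (s.reg 2) (s.reg 3) = (s.reg 0 : EReal)))) :=
  ⟨UZPM.Psi_cases,
    fun _ x δ μ σ τ hn =>
      ⟨UZPM.convex_epigraph_innerValue x δ μ σ τ, UZPM.dualValue_eq_iInf x δ μ σ τ hn⟩,
    UZPM.exists_program_innerValue, UZPM.exists_program_dualValue⟩
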